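/- **Setting.** Let $(\mathcal M,g)$ be a compact smooth Riemannian manifold without boundary, $n=\dim\mathcal M$, let $\iota:\mathcal M\to\mathbb R^D$ ($D\ge n+1$) be a smooth isometric embedding, $\nu$ the Riemannian volume measure of $\mathcal M$ (equivalently, the pull-back under $\iota$ of the $n$-dimensional volume of $\iota(\mathcal M)$), and let $p\in C^\infty(\mathcal M)$ be a positive probability density with respect to $\nu$. Let $x_1,\dots,x_N$ ($N\ge1$) be i.i.d. with law $p\,d\nu$. Let $k:[0,\infty)\to[0,\infty)$ be a kernel function: non-increasing, smooth on $(0,\infty)$, such that for every $m\ge 0$ there are $R_m,A_m>0$ with $|k^{(m)}(t)|\le e^{-A_mt}$ for $t>R_m$, and such that $k>\|k\|_\infty/2$ on $[0,r_k)$ for some $r_k>0$. For $\epsilon>0$ and $\lambda\ge0$ put $k_\epsilon(x,y)=\epsilon^{-n/2}k(|\iota(x)-\iota(y)|^2/\epsilon)$, and $$p_\epsilon(x)=\int k_\epsilon(x,y)\,p(y)\,d\nu(y),\qquad k_{\lambda,\epsilon}(x,y)=\frac{k_\epsilon(x,y)}{(p_\epsilon(x)p_\epsilon(y))^{\lambda}},\qquad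 A_{\lambda,\epsilon}[u](x)=\frac{\int k_{\lambda,\epsilon}(x,y)u(y)p(y)\,d\nu(y)}{\int k_{\lambda,\epsilon}(x,y)p(y)\,d\nu(y)},$$ $$p_{\epsilon,N}(x)=\frac1N\sum_{j=1}^N k_\epsilon(x,x_j),\qquad k_{\lambda,\epsilon,N}(x,y)=\frac{k_\epsilon(x,y)}{(p_{\epsilon,N}(x)p_{\epsilon,N}(y))^{\lambda}},\qquad A_{\lambda,\epsilon,N}[u](x)=\frac{\sum_j k_{\lambda,\epsilon,N}(x,x_j)u(x_j)}{\sum_j k_{\lambda,\epsilon,N}(x,x_j)},$$ with $A_{\lambda,\epsilon,N}[u](x)=0$ if $p_{\epsilon,N}(x)=0$. For an entire function $f$ and an operator $T$ on functions write $f(T)[u](x)=\sum_{m\ge0}\frac{f^{(m)}(0)}{m!}\,T^m[u](x)$. **The probability bound $\gamma$.** Let $\underline C=\inf p_\epsilon$ and $\overline C=\sup p_\epsilon$. Given $K>0$ and $K_\lambda>1$, let $\gamma_{\lambda,N}(\delta;u)$ be the minimum of $1$ and of those of the following quantities that apply: $$(4+2N)\exp\left(-\frac{N\epsilon^{n/2}\delta^2}{2K_\lambda\underline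 C^{-\lambda}\|u\|_\infty\left(KK_\lambda\|u\|_\infty\underline C^{-\lambda}+\|k\|_\infty\delta/3\right)}\right)\quad\text{if } \frac{2\|k\|_\infty\epsilon^{-n/2}}{N}<\delta\le\frac{\underline C}{2},$$ $$6\exp\left(-\frac{N\epsilon^{n/2}\delta^2}{8\|u\|_\infty\left(K\|u\|_\infty+\|k\|_\infty\delta/6\right)}\right)\quad\text{if }\lambda=0$$ (for $u=0$ put $\gamma_{\lambda,N}=1$). Let $\tilde\gamma_{\lambda,N}=\gamma_{\lambda,N}/(1-\gamma_{\lambda,N})^2$, which is $+\infty$ where $\gamma_{\lambda,N}=1$. **Theorem.** There is a function $(a,b,c,\lambda)\mapsto K_\lambda(a,b,c)\in(1,\infty)$ and, for all $(\mathcal M,g,\iota,p,k)$ as above and every $\epsilon_0>0$, a constant $K>0$ depending only on $(\mathcal M,g,\iota,p,k)$ and $\epsilon_0$, such that for all $\lambda\ge0$, $0<\epsilon\le\epsilon_0$, $N\ge1$, $u\in C^\infty(\mathcal M;\mathbb C)$ and $x\in\mathcal M$, with $\gamma_{\lambda,N}$ formed with the constants $K$ and $K_\lambda=K_\lambda(\|k\|_\infty,\underline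 C,\overline C)$: 1. for all $\delta>0$, $\ \Pr\left[\,|A_{\lambda,\epsilon,N}[u](x)-A_{\lambda,\epsilon}[u](x)|>\delta\,\right]\le\gamma_{\lambda,N}(\delta;u)$; 2. for every entire $f$, every $w\in\mathbb C$ and $K_w>0$ with $|f^{(m)}(w)|<K_w$ for all $m\ge0$, and all $\delta>0$, $$\Pr\left[\,\left|f(A_{\lambda,\epsilon,N}+wI)[u](x)-f(A_{\lambda,\epsilon}+wI)[u](x)\right|>\delta\,\right]\le\tilde\gamma_{\lambda,N}\left(\frac{\delta}{2eK_w};u\right).$$ -/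

import Mathlib

open MeasureTheory Set Function
open scoped Manifold ContDiff ENNReal

noncomputable section

/-- The uniform norm of a kernel profile on `[0, ∞)`. -/
def kernelSup (k : ℝ → ℝ) : ℝ := ⨆ t : Ici (0 : ℝ), |k t|

/-- Kernel functions `k : [0, ∞) → [0, ∞)` (the values of `k` at negative numbers play no role):
monotonically decreasing, smooth on `(0, ∞)`, with exponentially decaying derivatives of every
order, and larger than half of the supremum near `0`. -/
structure IsKernelFunction (k : ℝ → ℝ) : Prop where
  nonneg : ∀ t, 0 ≤ t → 0 ≤ k t
  antitone : AntitoneOn k (Ici 0)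
  smooth : ContDiffOn ℝ ∞ k (Ioi 0)
  decay : ∀ m : ℕ, ∃ R > 0, ∃ A > 0, ∀ t, R < t → |iteratedDeriv m k t| ≤ Real.exp (-(A * t))
  half : ∃ r > 0, ∀ t, 0 ≤ t → t < r → kernelSup k / 2 < k t

/-- `ι` is a smooth isometric embedding of the Riemannian manifold `(M, g)` into `ℝ^D`
(for compact `M`, an injective immersion is an embedding). -/
structure IsSmoothIsometricEmbedding {n D : ℕ} {M : Type*} [TopologicalSpace M]
    [ChartedSpace (EuclideanSpace ℝ (Fin n)) M] [IsManifold (𝓡 n) ∞ M]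
    (g : Bundle.ContMDiffRiemannianMetric (𝓡 n) ∞ (EuclideanSpace ℝ (Fin n))
      (fun x : M => TangentSpace (𝓡 n) x))
    (ι : M → EuclideanSpace ℝ (Fin D)) : Prop where
  smooth : ContMDiff (𝓡 n) (𝓡 D) ∞ ι
  injective : Injective ι
  isometric : ∀ (x : M) (v w : TangentSpace (𝓡 n) x),
    @inner ℝ (EuclideanSpace ℝ (Fin D)) _ (mfderiv (𝓡 n) (𝓡 D) ι x v)
      (mfderiv (𝓡 n) (𝓡 D) ι x w) = g.inner x v w

section Operators

variable {M : Type*} {D : ℕ}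

/-- The Riemannian volume of an `n`-dimensional manifold `M` isometrically embedded in `ℝ^D` by `ι`:
the pull-back under `ι` of the `n`-dimensional volume element of `ι(M)`, that is, of the
`n`-dimensional Hausdorff measure, normalised to be Lebesgue measure on `ℝ^n`. -/
def embeddedVolume [MeasurableSpace M] (n : ℕ) (ι : M → EuclideanSpace ℝ (Fin D)) : Measure M :=
  (Measure.euclideanHausdorffMeasure n).comap ι

/-- The law on `M` of one sample: density `p` with respect to the Riemannian volume. -/
def samplingLaw [MeasurableSpace M] (n : ℕ) (ι : M → EuclideanSpace ℝ (Fin D)) (p : M → ℝ) :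
    Measure M :=
  (embeddedVolume n ι).withDensity fun x => ENNReal.ofReal (p x)

/-- `k_ε(x, y) = ε^{-n/2} k(|ι(x) - ι(y)|² / ε)`. -/
def kernelEps (n : ℕ) (ι : M → EuclideanSpace ℝ (Fin D)) (k : ℝ → ℝ) (ε : ℝ) (x y : M) : ℝ :=
  ε ^ (-((n : ℝ) / 2)) * k (‖ι x - ι y‖ ^ 2 / ε)

/-- Continuum degree function `p_ε(x) = ∫ k_ε(x, y) p(y) dν(y)`. -/
def degreeEps [MeasurableSpace M] (n : ℕ) (ι : M → EuclideanSpace ℝ (Fin D)) (k : ℝ → ℝ)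
    (p : M → ℝ) (ε : ℝ) (x : M) : ℝ :=
  ∫ y, kernelEps n ι k ε x y * p y ∂(embeddedVolume n ι)

/-- `k_{λ,ε}(x, y) = k_ε(x, y) / (p_ε(x) p_ε(y))^λ`. -/
def kernelLam [MeasurableSpace M] (n : ℕ) (ι : M → EuclideanSpace ℝ (Fin D)) (k : ℝ → ℝ)
    (p : M → ℝ) (lam ε : ℝ) (x y : M) : ℝ :=
  kernelEps n ι k ε x y / (degreeEps n ι k p ε x * degreeEps n ι k p ε y) ^ lam

/-- `p_{λ,ε}(x) = ∫ k_{λ,ε}(x, y) p(y) dν(y)`. -/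
def degreeLam [MeasurableSpace M] (n : ℕ) (ι : M → EuclideanSpace ℝ (Fin D)) (k : ℝ → ℝ)
    (p : M → ℝ) (lam ε : ℝ) (x : M) : ℝ :=
  ∫ y, kernelLam n ι k p lam ε x y * p y ∂(embeddedVolume n ι)

/-- The continuum `λ`-renormalized averaging operator
`A_{λ,ε}[u](x) = p_{λ,ε}(x)⁻¹ ∫ k_{λ,ε}(x, y) u(y) p(y) dν(y)`. -/
def avgOp [MeasurableSpace M] (n : ℕ) (ι : M → EuclideanSpace ℝ (Fin D)) (k : ℝ → ℝ)
    (p : M → ℝ) (lam ε : ℝ) (u : M → ℂ) (x : M) : ℂ :=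
  ((degreeLam n ι k p lam ε x)⁻¹ : ℝ) *
    ∫ y, ((kernelLam n ι k p lam ε x y * p y : ℝ) : ℂ) * u y ∂(embeddedVolume n ι)

/-- Discrete degree function `p_{ε,N}(x) = N⁻¹ ∑ⱼ k_ε(x, xⱼ)`. -/
def degreeEpsN (n : ℕ) (ι : M → EuclideanSpace ℝ (Fin D)) (k : ℝ → ℝ) (ε : ℝ)
    {N : ℕ} (X : Fin N → M) (x : M) : ℝ :=
  (N : ℝ)⁻¹ * ∑ j, kernelEps n ι k ε x (X j)

/-- `k_{λ,ε,N}(x, y) = k_ε(x, y) / (p_{ε,N}(x) p_{ε,N}(y))^λ`. -/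
def kernelLamN (n : ℕ) (ι : M → EuclideanSpace ℝ (Fin D)) (k : ℝ → ℝ) (lam ε : ℝ)
    {N : ℕ} (X : Fin N → M) (x y : M) : ℝ :=
  kernelEps n ι k ε x y / (degreeEpsN n ι k ε X x * degreeEpsN n ι k ε X y) ^ lam

/-- `p_{λ,ε,N}(x) = N⁻¹ ∑ⱼ k_{λ,ε,N}(x, xⱼ)`. -/
def degreeLamN (n : ℕ) (ι : M → EuclideanSpace ℝ (Fin D)) (k : ℝ → ℝ) (lam ε : ℝ)
    {N : ℕ} (X : Fin N → M) (x : M) : ℝ :=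
  (N : ℝ)⁻¹ * ∑ j, kernelLamN n ι k lam ε X x (X j)

/-- The discrete `λ`-renormalized averaging operator for the samples `X`, acting on functions on all
of `M`: `A_{λ,ε,N}[u](x) = p_{λ,ε,N}(x)⁻¹ N⁻¹ ∑ⱼ k_{λ,ε,N}(x, xⱼ) u(xⱼ)`. (It is `0` at a point `x`
with `p_{ε,N}(x) = 0`.) -/
def avgOpN (n : ℕ) (ι : M → EuclideanSpace ℝ (Fin D)) (k : ℝ → ℝ) (lam ε : ℝ)
    {N : ℕ} (X : Fin N → M) (u : M → ℂ) (x : M) : ℂ :=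
  ((degreeLamN n ι k lam ε X x)⁻¹ : ℝ) *
    ((N : ℂ)⁻¹ * ∑ j, (kernelLamN n ι k lam ε X x (X j) : ℂ) * u (X j))

/-- `T + w I`, for an operator `T` on functions. -/
def addScalarOp (T : (M → ℂ) → M → ℂ) (w : ℂ) (u : M → ℂ) (x : M) : ℂ := T u x + w * u x

/-- Functional calculus of an entire function: `f(T)[u](x) = ∑ₘ (f⁽ᵐ⁾(0) / m!) (T^m u)(x)`. -/
def entireCalc (f : ℂ → ℂ) (T : (M → ℂ) → M → ℂ) (u : M → ℂ) (x : M) : ℂ :=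
  ∑' m : ℕ, iteratedDeriv m f 0 / (m.factorial : ℂ) * (T^[m] u) x

/-- The uniform norm of a function on `M`. -/
def supNorm (u : M → ℂ) : ℝ := ⨆ x, ‖u x‖

end Operators

/-- The Bernstein-type bound for all `λ ≥ 0`. The arguments are the dimension `n`, the
constants `K = K_{M,k,p}` and `Kl = K_λ`, the norm `kinf = ‖k‖_∞`, `cp = inf p_ε`, and
`uinf = ‖u‖_∞`. -/
def bernsteinLam (n : ℕ) (K Kl kinf cp lam ε : ℝ) (N : ℕ) (uinf δ : ℝ) : ℝ :=
  (4 + 2 * N) * Real.exp (-((N * ε ^ ((n : ℝ) / 2) * δ ^ 2) /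
    (2 * Kl * cp ^ (-lam) * uinf * (K * Kl * uinf * cp ^ (-lam) + kinf * δ / 3))))

/-- The Bernstein-type bound special to `λ = 0`. -/
def bernsteinZero (n : ℕ) (K kinf ε : ℝ) (N : ℕ) (uinf δ : ℝ) : ℝ :=
  6 * Real.exp (-((N * ε ^ ((n : ℝ) / 2) * δ ^ 2) /
    (8 * uinf * (K * uinf + kinf * δ / 6))))

open Classical in
/-- The probability bound `γ_{λ,N}(δ; u)`: the least of `1` and those of the two bounds that apply.
The first one applies for `2 ‖k‖_∞ ε^{-n/2} / N < δ ≤ inf p_ε / 2`, the second one for `λ = 0`. -/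
def gammaBound (n : ℕ) (K Kl kinf cp lam ε : ℝ) (N : ℕ) (uinf δ : ℝ) : ℝ :=
  min 1 (min
    (if 2 * kinf * ε ^ (-((n : ℝ) / 2)) / N < δ ∧ δ ≤ cp / 2
      then bernsteinLam n K Kl kinf cp lam ε N uinf δ else 1)
    (if lam = 0 then bernsteinZero n K kinf ε N uinf δ else 1))

/-- `γ / (1 - γ)²` for `γ ∈ [0, 1]`, as an extended number: it is `∞` for `γ = 1`. -/
def gammaTilde (γ : ℝ) : ℝ≥0∞ := ENNReal.ofReal γ / (1 - ENNReal.ofReal γ) ^ 2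

end

/-!
The continuum operator `A_{λ,ε}` and its discrete counterpart are averages with respect to the
kernel `k_ε`, weighted by powers of the continuum and the empirical degree function
(`avgOp_eq_contAvg`, `avgOpN_eq_discAvg`: the power of the degree at the base point cancels). What
geometry contributes is a lower bound for `p_ε` that is uniform in `ε ∈ (0, ε₀]`
(`exists_degreeEps_ge`): the inverse charts, followed by the embedding, are locally bi-Lipschitz, so
that by compactness a ball of radius `r` has volume at least of order `r ^ n`. Everything else holds
for a bounded kernel on a probability space whose degree function is bounded below.

The `m`-th powers of the discrete operator `T_N` and the continuum operator `T` are compared by the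
telescoping sum `T_N ^ m - T ^ m = ∑ T_N ^ i (T_N - T) T ^ j` over `i + j = m - 1`
(`norm_discAvg_iterate_sub_le`). Since `T` is a contraction in the uniform norm, this leaves the
one-step error for the function `T ^ j u`, averaged along `i` steps of the random walk on the
samples. Two tail bounds control it, both of the form
`A exp(2 i² + 2 i) exp(-b t²)` with `b` proportional to `N ε ^ (n / 2) / ‖u‖²`.

* For every `λ`, `measure_weighted_gt_le`: a union bound makes the empirical means accurate at the
  base point and at all samples at once, whence the factor `N + 1`; the random walk then does not
  matter. A mean at a sample `x_j` is treated by integrating over the other samples only.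
* For `λ = 0`, `measure_unweighted_gt_le`, without a factor growing with `N`: a union bound over the
  samples is not affordable. Instead, as long as the walk visits points of empirical degree at least
  half of the expected one, its transition probabilities are at most twice `k(y, x_l) / (N d(y))`,
  and the expectation of the exponential of the error at its end becomes a sum over paths
  (`ofReal_discAvgReal_iterate_le`, `lintegral_pathOp_exp_le`). Integrating out the vertices one by
  one, each vertex is either a fresh sample, which contributes an integral of the kernel, or one of
  the at most `i` earlier ones (`lmarginal_pathOp_iterate_le`); every sample on the path costs the
  exponential moment at most a factor `e`.

For entire `f`, the calculus is recentred, `f(T + w) = ∑ f⁽ʲ⁾(w) / j! T ^ j`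
(`hasSum_entireCalc_addScalarOp`), and a union bound over all pairs `(i, j)` is taken with thresholds
proportional to `i + j + 1`: the resulting factor `m²` at order `m` is harmless against `1 / m!`,
while the exponent `b t² (i + j + 1)²` beats `2 i² + 2 i` and leaves a geometric series
(`measure_entireCalc_sub_gt_le`). This works once the exponent of the leading term is at least `5`;
otherwise the asserted bound exceeds `1` (`le_mul_exp_of_large`). The remaining constants are
absorbed by `K` and `K_λ`.
-/

/-! ### Volumes of small balls in an embedded manifold -/

open Filter Topology in
/-- A `C¹` map with injective derivative is bi-Lipschitz near the point. -/
theorem HasStrictFDerivAt.exists_bilipschitz_ball {E F : Type*} [NormedAddCommGroup E]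
    [NormedSpace ℝ E] [FiniteDimensional ℝ E] [NormedAddCommGroup F] [NormedSpace ℝ F]
    {f : E → F} {f' : E →L[ℝ] F} {a : E} (hf : HasStrictFDerivAt f f' a)
    (hinj : Injective f') {s : Set E} (hs : s ∈ 𝓝 a) :
    ∃ ρ > 0, ∃ K > 0, ∃ L > 0, Metric.ball a ρ ⊆ s ∧
      ∀ x ∈ Metric.ball a ρ, ∀ y ∈ Metric.ball a ρ,
        ‖x - y‖ ≤ K * ‖f x - f y‖ ∧ ‖f x - f y‖ ≤ L * ‖x - y‖ := by
  obtain ⟨A, hA, hfA⟩ := LinearMap.exists_antilipschitzWith (f' : E →ₗ[ℝ] F)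
    (LinearMap.ker_eq_bot.2 hinj)
  have hA' : (0 : ℝ) < A := hA
  have hlow : ∀ v, ‖v‖ ≤ A * ‖f' v‖ := fun v => by
    have := hfA.le_mul_dist v 0
    simpa using this
  obtain ⟨t, ht, happ⟩ := hf.approximates_deriv_on_nhds (c := (2 * A)⁻¹) (Or.inr (by positivity))
  obtain ⟨ρ, hρ, hball⟩ := Metric.mem_nhds_iff.1 (inter_mem hs ht)
  refine ⟨ρ, hρ, 2 * A, by positivity, (2 * (A : ℝ))⁻¹ + ‖f'‖, by positivity,
    fun x hx => (hball hx).1, fun x hx y hy => ?_⟩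
  have h1 := happ x (hball hx).2 y (hball hy).2
  push_cast at h1
  constructor
  · have h2 := hlow (x - y)
    have h3 : ‖f' (x - y)‖ ≤ ‖f x - f y‖ + (2 * (A : ℝ))⁻¹ * ‖x - y‖ := by
      have := norm_sub_le (f x - f y) (f x - f y - f' (x - y))
      rw [sub_sub_cancel] at this
      linarith
    have h4 : A * ‖f' (x - y)‖ ≤ A * ‖f x - f y‖ + ‖x - y‖ / 2 := by
      calc A * ‖f' (x - y)‖ ≤ A * (‖f x - f y‖ + (2 * (A : ℝ))⁻¹ * ‖x - y‖) := by gcongr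
        _ = _ := by field_simp
    linarith
  · have h2 := f'.le_opNorm (x - y)
    have h3 := norm_add_le (f x - f y - f' (x - y)) (f' (x - y))
    rw [sub_add_cancel] at h3
    rw [add_mul]
    linarith

/-- Images of balls under maps bounded below by `1 / K` have volume at least that of a ball shrunk
by the factor `K`. -/
theorem volume_le_euclideanHausdorffMeasure_image {n : ℕ} {F : Type*} [NormedAddCommGroup F]
    [MeasurableSpace F] [BorelSpace F] {f : EuclideanSpace ℝ (Fin n) → F}
    {s : Set (EuclideanSpace ℝ (Fin n))} {K : ℝ} (hK : 0 < K)
    (h : ∀ x ∈ s, ∀ y ∈ s, ‖x - y‖ ≤ K * ‖f x - f y‖) :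
    volume s ≤ ENNReal.ofReal K ^ n * Measure.euclideanHausdorffMeasure n (f '' s) := by
  have hinj : InjOn f s := fun x hx y hy hxy => by
    have := h x hx y hy
    rw [hxy, sub_self, norm_zero, mul_zero] at this
    exact sub_eq_zero.1 (norm_le_zero_iff.1 this)
  have hlip : LipschitzOnWith K.toNNReal (invFunOn f s) (f '' s) := by
    refine LipschitzOnWith.of_dist_le_mul ?_
    rintro _ ⟨x, hx, rfl⟩ _ ⟨y, hy, rfl⟩
    rw [hinj.leftInvOn_invFunOn hx, hinj.leftInvOn_invFunOn hy, dist_eq_norm, dist_eq_norm,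
      Real.coe_toNNReal _ hK.le]
    exact h x hx y hy
  have h1 := hlip.hausdorffMeasure_image_le (d := n) (by positivity)
  rw [hinj.leftInvOn_invFunOn.image_image] at h1
  rw [← EuclideanSpace.euclideanHausdorffMeasure_eq_volume n]
  rw [Measure.euclideanHausdorffMeasure_def, Measure.euclideanHausdorffMeasure_def]
  simp only [Measure.smul_apply, ENNReal.smul_def, smul_eq_mul]
  rw [ENNReal.rpow_natCast] at h1
  calc _ ≤ _ * (_ * _) := mul_le_mul_right h1 _
    _ = _ := by rw [mul_left_comm]; rfl

section Volume

variable {n D : ℕ} {M : Type*} [TopologicalSpace M]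
  [ChartedSpace (EuclideanSpace ℝ (Fin n)) M] [IsManifold (𝓡 n) ∞ M]
  {g : Bundle.ContMDiffRiemannianMetric (𝓡 n) ∞ (EuclideanSpace ℝ (Fin n))
    (fun x : M => TangentSpace (𝓡 n) x)}
  {ι : M → EuclideanSpace ℝ (Fin D)}

theorem IsSmoothIsometricEmbedding.measurableEmbedding [CompactSpace M] [MeasurableSpace M]
    [BorelSpace M] (h : IsSmoothIsometricEmbedding g ι) :
    MeasurableEmbedding ι :=
  (h.smooth.continuous.isClosedEmbedding h.injective).measurableEmbedding

theorem IsSmoothIsometricEmbedding.mfderiv_injective (h : IsSmoothIsometricEmbedding g ι) (x : M) :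
    Injective (mfderiv (𝓡 n) (𝓡 D) ι x) := by
  refine (injective_iff_map_eq_zero _).2 fun v hv => ?_
  by_contra hne
  have h1 := g.pos x v hne
  rw [← h.isometric x v v, hv] at h1
  exact absurd h1 (by
    have := inner_zero_left (𝕜 := ℝ) (0 : EuclideanSpace ℝ (Fin D))
    exact fun h => h.ne' this)

open Filter Topology in
theorem IsSmoothIsometricEmbedding.exists_bilipschitz_chart (h : IsSmoothIsometricEmbedding g ι)
    (x₀ : M) :
    ∃ ρ > 0, ∃ K > 0, ∃ L > 0,
      Metric.ball (extChartAt (𝓡 n) x₀ x₀) ρ ⊆ (extChartAt (𝓡 n) x₀).target ∧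
      ∀ a ∈ Metric.ball (extChartAt (𝓡 n) x₀ x₀) ρ, ∀ b ∈ Metric.ball (extChartAt (𝓡 n) x₀ x₀) ρ,
        ‖a - b‖ ≤ K * ‖ι ((extChartAt (𝓡 n) x₀).symm a) - ι ((extChartAt (𝓡 n) x₀).symm b)‖ ∧
        ‖ι ((extChartAt (𝓡 n) x₀).symm a) - ι ((extChartAt (𝓡 n) x₀).symm b)‖ ≤ L * ‖a - b‖ := by
  have hw : writtenInExtChartAt (𝓡 n) (𝓡 D) x₀ ι = ι ∘ (extChartAt (𝓡 n) x₀).symm := by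
    rw [writtenInExtChartAt, extChartAt_model_space_eq_id]; rfl
  have hmd : MDifferentiableAt (𝓡 n) (𝓡 D) ι x₀ := h.smooth.mdifferentiable (by simp) x₀
  have hinj := h.mfderiv_injective x₀
  have hcd : ContDiffAt ℝ ∞ (ι ∘ (extChartAt (𝓡 n) x₀).symm) (extChartAt (𝓡 n) x₀ x₀) := by
    have := (contMDiffAt_iff.1 (h.smooth x₀)).2
    rw [ModelWithCorners.range_eq_univ, contDiffWithinAt_univ] at this
    exact hw ▸ this
  have hfd : mfderiv (𝓡 n) (𝓡 D) ι x₀ =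
      fderiv ℝ (ι ∘ (extChartAt (𝓡 n) x₀).symm) (extChartAt (𝓡 n) x₀ x₀) := by
    rw [hmd.mfderiv, hw, ModelWithCorners.range_eq_univ, fderivWithin_univ]
  rw [hfd] at hinj
  exact (hcd.hasStrictFDerivAt (by simp)).exists_bilipschitz_ball hinj
    (extChartAt_target_mem_nhds x₀)

open Filter Topology in
/-- A chart ball of radius `r / L` is mapped into the ball of radius `r`, and its image has
comparable volume. -/
theorem IsSmoothIsometricEmbedding.exists_nhds_volume_ball_ge [CompactSpace M]
    [MeasurableSpace M] [BorelSpace M] (h : IsSmoothIsometricEmbedding g ι) (x₀ : M) :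
    ∃ V ∈ 𝓝 x₀, ∃ c > 0, ∃ r₀ > 0, ∀ x ∈ V, ∀ r, 0 < r → r ≤ r₀ →
      ENNReal.ofReal (c * r ^ n) ≤ embeddedVolume n ι {y | ‖ι x - ι y‖ < r} := by
  obtain ⟨ρ, hρ, K, hK, L, hL, hsub, hbi⟩ := h.exists_bilipschitz_chart x₀
  set φ := extChartAt (𝓡 n) x₀ with hφ
  set β : ℝ := (volume (Metric.ball (0 : EuclideanSpace ℝ (Fin n)) 1)).toReal with hβ
  have hβ0 : 0 < β := ENNReal.toReal_pos (Metric.measure_ball_pos _ _ one_pos).ne'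
    measure_ball_lt_top.ne
  refine ⟨φ.source ∩ φ ⁻¹' Metric.ball (φ x₀) (ρ / 2), ?_, K⁻¹ ^ n * L⁻¹ ^ n * β, by positivity,
    L * (ρ / 2), by positivity, ?_⟩
  · exact inter_mem (extChartAt_source_mem_nhds x₀)
      ((continuousAt_extChartAt x₀).preimage_mem_nhds (Metric.ball_mem_nhds _ (by positivity)))
  rintro x ⟨hxs, hx⟩ r hr hr0
  have hxb : φ x ∈ Metric.ball (φ x₀) ρ := Metric.ball_subset_ball (by linarith) hx
  have hrL : r / L ≤ ρ / 2 := by rw [div_le_iff₀ hL]; linarith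
  have hb : Metric.ball (φ x) (r / L) ⊆ Metric.ball (φ x₀) ρ :=
    Metric.ball_subset_ball' (by have := Metric.mem_ball.1 hx; linarith)
  have hkey := volume_le_euclideanHausdorffMeasure_image (f := ι ∘ φ.symm) hK
    (fun a ha b hb' => (hbi a (hb ha) b (hb hb')).1)
  rw [embeddedVolume, h.measurableEmbedding.comap_apply]
  have himg : (ι ∘ φ.symm) '' Metric.ball (φ x) (r / L) ⊆ ι '' {y | ‖ι x - ι y‖ < r} := by
    rintro _ ⟨a, ha, rfl⟩
    refine ⟨φ.symm a, ?_, rfl⟩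
    have h1 := (hbi (φ x) hxb a (hb ha)).2
    rw [φ.left_inv hxs] at h1
    have h2 : ‖φ x - a‖ < r / L := by rw [← dist_eq_norm, dist_comm]; exact ha
    calc ‖ι x - ι (φ.symm a)‖ ≤ L * ‖φ x - a‖ := h1
      _ < L * (r / L) := by gcongr
      _ = r := by field_simp
  have hvol : volume (Metric.ball (φ x) (r / L)) = ENNReal.ofReal ((r / L) ^ n * β) := by
    rw [Measure.addHaar_ball_of_pos _ _ (by positivity), finrank_euclideanSpace_fin,
      ENNReal.ofReal_mul (by positivity), hβ, ENNReal.ofReal_toReal measure_ball_lt_top.ne]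
  calc ENNReal.ofReal (K⁻¹ ^ n * L⁻¹ ^ n * β * r ^ n)
      = ENNReal.ofReal (K⁻¹ ^ n) * ENNReal.ofReal ((r / L) ^ n * β) := by
        rw [← ENNReal.ofReal_mul (by positivity)]
        congr 1
        rw [div_pow, inv_pow L]
        ring
    _ ≤ ENNReal.ofReal (K⁻¹ ^ n) * (ENNReal.ofReal K ^ n *
        Measure.euclideanHausdorffMeasure n ((ι ∘ φ.symm) '' Metric.ball (φ x) (r / L))) := by
        rw [← hvol]; gcongr
    _ = Measure.euclideanHausdorffMeasure n ((ι ∘ φ.symm) '' Metric.ball (φ x) (r / L)) := by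
        rw [← mul_assoc, ← ENNReal.ofReal_pow hK.le, ← ENNReal.ofReal_mul (by positivity),
          ← mul_pow, inv_mul_cancel₀ hK.ne', one_pow, ENNReal.ofReal_one, one_mul]
    _ ≤ _ := measure_mono himg

/-- By compactness, small balls of an embedded manifold have volume at least `c r ^ n` with the same
constant at all points. -/
theorem IsSmoothIsometricEmbedding.exists_volume_ball_ge [CompactSpace M]
    [MeasurableSpace M] [BorelSpace M] (h : IsSmoothIsometricEmbedding g ι) {r₁ : ℝ} (hr₁ : 0 < r₁) :
    ∃ c > 0, ∀ x, ∀ r, 0 < r → r ≤ r₁ →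
      ENNReal.ofReal (c * r ^ n) ≤ embeddedVolume n ι {y | ‖ι x - ι y‖ < r} := by
  choose V hV c hc r₀ hr₀ hb using h.exists_nhds_volume_ball_ge
  have hloc : ∀ s : Set M, IsCompact s → ∃ c > 0, ∃ r₀ > 0, ∀ x ∈ s, ∀ r, 0 < r → r ≤ r₀ →
      ENNReal.ofReal (c * r ^ n) ≤ embeddedVolume n ι {y | ‖ι x - ι y‖ < r} := by
    intro s hs
    refine hs.induction_on ⟨1, one_pos, 1, one_pos, by simp⟩ ?_ ?_ ?_
    · rintro s t hst ⟨c, hc, r, hr, H⟩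
      exact ⟨c, hc, r, hr, fun x hx => H x (hst hx)⟩
    · rintro s t ⟨c, hc, r, hr, H⟩ ⟨c', hc', r', hr', H'⟩
      refine ⟨min c c', lt_min hc hc', min r r', lt_min hr hr', ?_⟩
      rintro x (hx | hx) a ha har
      · refine le_trans (ENNReal.ofReal_le_ofReal ?_) (H x hx a ha (har.trans (min_le_left _ _)))
        gcongr; exact min_le_left _ _
      · refine le_trans (ENNReal.ofReal_le_ofReal ?_) (H' x hx a ha (har.trans (min_le_right _ _)))
        gcongr; exact min_le_right _ _
    · intro x _
      exact ⟨V x, mem_nhdsWithin_of_mem_nhds (hV x), c x, hc x, r₀ x, hr₀ x, hb x⟩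
  obtain ⟨c, hc, r₀, hr₀, H⟩ := hloc univ isCompact_univ
  -- For `r₀ < r ≤ r₁` the ball of radius `r` contains the one of radius `q * r ≤ r₀`.
  set q := min 1 (r₀ / r₁) with hq
  have hq0 : 0 < q := lt_min one_pos (by positivity)
  refine ⟨c * q ^ n, by positivity, fun x r hr hrr => ?_⟩
  have h1 := H x (mem_univ x) (q * r) (by positivity) (by
    calc q * r ≤ r₀ / r₁ * r₁ := by gcongr; exact min_le_right _ _
      _ = r₀ := by field_simp)
  rw [mul_pow, ← mul_assoc] at h1
  refine h1.trans (measure_mono fun y hy => ?_)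
  rw [mem_ofPred_eq] at hy ⊢
  refine lt_of_lt_of_le hy ?_
  calc q * r ≤ 1 * r := by gcongr; exact min_le_left _ _
    _ = r := one_mul r

end Volume

/-! ### The kernel and its degree function -/

namespace IsKernelFunction

variable {k : ℝ → ℝ}

theorem le_zero (hk : IsKernelFunction k) {t : ℝ} (ht : 0 ≤ t) : k t ≤ k 0 :=
  hk.antitone (mem_Ici.2 le_rfl) ht ht

theorem kernelSup_eq (hk : IsKernelFunction k) : kernelSup k = k 0 := by
  have hle : ∀ t : Ici (0 : ℝ), |k t| ≤ k 0 := fun t => by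
    rw [abs_of_nonneg (hk.nonneg t t.2)]; exact hk.le_zero t.2
  refine le_antisymm (ciSup_le hle) ?_
  have := le_ciSup (f := fun t : Ici (0 : ℝ) => |k t|) ⟨k 0, by rintro _ ⟨t, rfl⟩; exact hle t⟩
    ⟨0, mem_Ici.2 le_rfl⟩
  exact (le_abs_self _).trans this

theorem le_kernelSup (hk : IsKernelFunction k) {t : ℝ} (ht : 0 ≤ t) : k t ≤ kernelSup k :=
  hk.kernelSup_eq ▸ hk.le_zero ht

theorem kernelSup_pos (hk : IsKernelFunction k) : 0 < kernelSup k := by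
  obtain ⟨r, hr, h⟩ := hk.half
  have := h 0 le_rfl hr
  rw [hk.kernelSup_eq] at this ⊢
  linarith

/-- Only the values of `k` on `[0, ∞)` enter, where `k` is monotone. -/
theorem measurable_comp (hk : IsKernelFunction k) {α : Type*} [MeasurableSpace α] {f : α → ℝ}
    (hf : Measurable f) (h0 : ∀ a, 0 ≤ f a) : Measurable fun a => k (f a) := by
  have hanti : Antitone fun t => k (max t 0) := fun s t hst =>
    hk.antitone (mem_Ici.2 (le_max_right _ _)) (mem_Ici.2 (le_max_right _ _))
      (max_le_max_right _ hst)
  have := hanti.measurable.comp hf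
  simpa [comp_def, h0] using this

end IsKernelFunction

section Degree

variable {n D : ℕ} {M : Type*} {ι : M → EuclideanSpace ℝ (Fin D)} {k : ℝ → ℝ}

theorem kernelEps_nonneg (hk : IsKernelFunction k) {ε : ℝ} (hε : 0 < ε) (x y : M) :
    0 ≤ kernelEps n ι k ε x y :=
  mul_nonneg (by positivity) (hk.nonneg _ (by positivity))

theorem kernelEps_le (hk : IsKernelFunction k) {ε : ℝ} (hε : 0 < ε) (x y : M) :
    kernelEps n ι k ε x y ≤ kernelSup k * ε ^ (-((n : ℝ) / 2)) := by
  rw [kernelEps, mul_comm]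
  exact mul_le_mul_of_nonneg_right (hk.le_kernelSup (by positivity)) (by positivity)

theorem measurable_kernelEps [MeasurableSpace M] (hι : Measurable ι) (hk : IsKernelFunction k)
    {ε : ℝ} (hε : 0 < ε) : Measurable (uncurry (kernelEps n ι k ε)) := by
  unfold kernelEps
  refine Measurable.const_mul (hk.measurable_comp (f := fun q : M × M => ‖ι q.1 - ι q.2‖ ^ 2 / ε)
    ?_ fun q => by positivity) _
  exact (((hι.comp measurable_fst).sub (hι.comp measurable_snd)).norm.pow_const 2).div_const ε

theorem integral_samplingLaw [MeasurableSpace M] {p : M → ℝ} (hp : Measurable p)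
    (hp0 : ∀ x, 0 ≤ p x) {E : Type*} [NormedAddCommGroup E] [NormedSpace ℝ E] (f : M → E) :
    ∫ y, f y ∂(samplingLaw n ι p) = ∫ y, p y • f y ∂(embeddedVolume n ι) := by
  rw [samplingLaw, integral_withDensity_eq_integral_toReal_smul hp.ennreal_ofReal
    (by simp)]
  simp [ENNReal.toReal_ofReal, hp0]

theorem degreeEps_eq [MeasurableSpace M] {p : M → ℝ} (hp : Measurable p)
    (hp0 : ∀ x, 0 ≤ p x) (k : ℝ → ℝ) (ε : ℝ) (x : M) :
    degreeEps n ι k p ε x = ∫ y, kernelEps n ι k ε x y ∂(samplingLaw n ι p) := by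
  rw [integral_samplingLaw hp hp0, degreeEps]
  simp [mul_comm]

/-- The degree function is bounded below uniformly in `ε ∈ (0, ε₀]`: the kernel `k_ε` is of order
`ε ^ (-n / 2)` on a ball of radius of order `√ε`, whose volume is at least of order
`ε ^ (n / 2)`. -/
theorem exists_degreeEps_ge [TopologicalSpace M] [CompactSpace M]
    [ChartedSpace (EuclideanSpace ℝ (Fin n)) M] [IsManifold (𝓡 n) ∞ M]
    [MeasurableSpace M] [BorelSpace M]
    {g : Bundle.ContMDiffRiemannianMetric (𝓡 n) ∞ (EuclideanSpace ℝ (Fin n))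
      (fun x : M => TangentSpace (𝓡 n) x)}
    (h : IsSmoothIsometricEmbedding g ι) {p : M → ℝ} (hp : Continuous p) (hp0 : ∀ x, 0 < p x)
    [IsProbabilityMeasure (samplingLaw n ι p)] (hk : IsKernelFunction k) {ε₀ : ℝ} (hε₀ : 0 < ε₀) :
    ∃ c > 0, ∀ ε, 0 < ε → ε ≤ ε₀ → ∀ x, c ≤ degreeEps n ι k p ε x := by
  obtain ⟨r, hr, hhalf⟩ := hk.half
  obtain ⟨c, hc, hball⟩ := h.exists_volume_ball_ge (r₁ := √(r * ε₀)) (by positivity)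
  have hne : Nonempty M := nonempty_of_isProbabilityMeasure (samplingLaw n ι p)
  obtain ⟨x₀, -, hx₀⟩ := isCompact_univ.exists_isMinOn univ_nonempty hp.continuousOn
  have hκ := hk.kernelSup_pos
  have hpx := hp0 x₀
  refine ⟨kernelSup k / 2 * (p x₀ * (c * r ^ ((n : ℝ) / 2))), by positivity,
    fun ε hε hε' x => ?_⟩
  set S := {y | ‖ι x - ι y‖ < √(r * ε)} with hS
  have hmι := h.smooth.continuous.measurable
  have hSm : MeasurableSet S :=
    measurableSet_lt (measurable_const.sub hmι).norm measurable_const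
  have hSge : ENNReal.ofReal (p x₀ * (c * √(r * ε) ^ n)) ≤ samplingLaw n ι p S := by
    rw [samplingLaw, withDensity_apply _ hSm, ENNReal.ofReal_mul hpx.le]
    calc _ ≤ ENNReal.ofReal (p x₀) * embeddedVolume n ι S := by
          gcongr
          exact hball x _ (by positivity) (Real.sqrt_le_sqrt (by gcongr))
      _ = ∫⁻ _ in S, ENNReal.ofReal (p x₀) ∂(embeddedVolume n ι) := by
          rw [setLIntegral_const]
      _ ≤ _ := lintegral_mono fun y => ENNReal.ofReal_le_ofReal (hx₀ (mem_univ y))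
  have hSge' : p x₀ * (c * √(r * ε) ^ n) ≤ (samplingLaw n ι p).real S :=
    (ENNReal.ofReal_le_iff_le_toReal (measure_ne_top _ _)).1 hSge
  have hint : Integrable (fun y => kernelEps n ι k ε x y) (samplingLaw n ι p) := by
    refine Integrable.of_bound (C := kernelSup k * ε ^ (-((n : ℝ) / 2)))
      ((measurable_kernelEps hmι hk hε).comp measurable_prodMk_left).aestronglyMeasurable
      (ae_of_all _ fun y => ?_)
    rw [Real.norm_of_nonneg (kernelEps_nonneg hk hε x y)]
    exact kernelEps_le hk hε x y
  rw [degreeEps_eq hp.measurable (fun x => (hp0 x).le)]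
  have hpow : √(r * ε) ^ n = r ^ ((n : ℝ) / 2) * ε ^ ((n : ℝ) / 2) := by
    rw [← Real.mul_rpow hr.le hε.le, Real.sqrt_eq_rpow, ← Real.rpow_natCast, ← Real.rpow_mul
      (by positivity)]
    congr 1; ring
  have hcancel : ε ^ (-((n : ℝ) / 2)) * ε ^ ((n : ℝ) / 2) = 1 := by
    rw [← Real.rpow_add hε, neg_add_cancel, Real.rpow_zero]
  calc kernelSup k / 2 * (p x₀ * (c * r ^ ((n : ℝ) / 2)))
      = kernelSup k / 2 * (p x₀ * (c * r ^ ((n : ℝ) / 2))) *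
        (ε ^ (-((n : ℝ) / 2)) * ε ^ ((n : ℝ) / 2)) := by rw [hcancel, mul_one]
    _ = ε ^ (-((n : ℝ) / 2)) * (kernelSup k / 2) * (p x₀ * (c * √(r * ε) ^ n)) := by
        rw [hpow]; ring
    _ ≤ ε ^ (-((n : ℝ) / 2)) * (kernelSup k / 2) * (samplingLaw n ι p).real S := by gcongr
    _ = ∫ _ in S, ε ^ (-((n : ℝ) / 2)) * (kernelSup k / 2) ∂(samplingLaw n ι p) := by
        rw [setIntegral_const, smul_eq_mul, mul_comm]
    _ ≤ ∫ y in S, kernelEps n ι k ε x y ∂(samplingLaw n ι p) := by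
        refine setIntegral_mono_on (integrable_const _).integrableOn hint.integrableOn hSm
          fun y hy => ?_
        rw [kernelEps]
        gcongr
        refine (hhalf _ (by positivity) ?_).le
        rw [div_lt_iff₀ hε]
        exact (Real.lt_sqrt (norm_nonneg _)).1 hy
    _ ≤ ∫ y, kernelEps n ι k ε x y ∂(samplingLaw n ι p) :=
        setIntegral_le_integral hint (ae_of_all _ fun y => kernelEps_nonneg hk hε x y)

end Degree

/-! ### Exponential moments with some samples frozen -/

section ExpMoment

variable {M : Type*} [MeasurableSpace M] {μ : Measure M} {N : ℕ}

/-- The variable `X l` is a constant for integration over the other coordinates. -/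
theorem lmarginal_comp_frozen {t : Finset (Fin N)} {l : Fin N} (hl : l ∉ t)
    (Φ : M → (Fin N → M) → ℝ≥0∞) (X : Fin N → M) :
    (∫⋯∫⁻_t, fun X => Φ (X l) X ∂fun _ => μ) X = (∫⋯∫⁻_t, Φ (X l) ∂fun _ => μ) X := by
  simp only [lmarginal]
  simp [updateFinset, hl]

variable [IsProbabilityMeasure μ]

/-- The bound follows from `exp a ≤ 1 + a + a ^ 2` for `|a| ≤ 1`. -/
theorem lintegral_exp_le_exp_of_integral_eq_zero {f : M → ℝ} (hf : Measurable f)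
    (h1 : ∀ z, |f z| ≤ 1) (h0 : ∫ z, f z ∂μ = 0) {V : ℝ} (hV : ∫ z, f z ^ 2 ∂μ ≤ V) :
    ∫⁻ z, ENNReal.ofReal (Real.exp (f z)) ∂μ ≤ ENNReal.ofReal (Real.exp V) := by
  have hi : Integrable f μ := Integrable.of_bound hf.aestronglyMeasurable 1 (ae_of_all _ h1)
  have hi2 : Integrable (fun z => f z ^ 2) μ :=
    Integrable.of_bound (hf.pow_const 2).aestronglyMeasurable (C := 1) (ae_of_all _ fun z => by
      rw [Real.norm_eq_abs, abs_pow]; exact pow_le_one₀ (abs_nonneg _) (h1 z))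
  have hi1 : Integrable (fun z => 1 + f z) μ := (integrable_const _).add hi
  have hi3 : Integrable (fun z => 1 + f z + f z ^ 2) μ := hi1.add hi2
  calc ∫⁻ z, ENNReal.ofReal (Real.exp (f z)) ∂μ
      ≤ ∫⁻ z, ENNReal.ofReal (1 + f z + f z ^ 2) ∂μ := by
        refine lintegral_mono fun z => ENNReal.ofReal_le_ofReal ?_
        have := (abs_le.1 (Real.abs_exp_sub_one_sub_id_le (h1 z))).2
        linarith
    _ = ENNReal.ofReal (∫ z, (1 + f z + f z ^ 2) ∂μ) := by
        rw [ofReal_integral_eq_lintegral_ofReal hi3]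
        refine ae_of_all _ fun z => ?_
        have := (abs_le.1 (h1 z)).1
        simp only [Pi.zero_apply]
        nlinarith [sq_nonneg (f z)]
    _ ≤ ENNReal.ofReal (Real.exp V) := by
        refine ENNReal.ofReal_le_ofReal ?_
        rw [integral_add hi1 hi2, integral_add (integrable_const _) hi, h0]
        simp only [integral_const, probReal_univ, smul_eq_mul, mul_one, add_zero]
        linarith [Real.add_one_le_exp V]

theorem lmarginal_prod_le {G : M → ℝ≥0∞} (hG : Measurable G) {A : ℝ≥0∞} (hA : ∫⁻ z, G z ∂μ ≤ A)
    (t : Finset (Fin N)) (X : Fin N → M) :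
    (∫⋯∫⁻_t, fun X => ∏ l, G (X l) ∂fun _ => μ) X ≤ A ^ t.card * ∏ l ∈ tᶜ, G (X l) := by
  have hm : Measurable fun X : Fin N → M => ∏ l, G (X l) :=
    Finset.measurable_fun_prod _ fun l _ => hG.comp (measurable_pi_apply l)
  induction t using Finset.induction_on generalizing X with
  | empty => simp
  | insert i t hi ih =>
    have hi' : i ∈ tᶜ := Finset.mem_compl.2 hi
    rw [lmarginal_insert _ hm hi]
    calc _ ≤ ∫⁻ z, A ^ t.card * (G z * ∏ l ∈ tᶜ.erase i, G (X l)) ∂μ := by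
          refine lintegral_mono fun z => (ih _).trans ?_
          rw [← Finset.mul_prod_erase _ _ hi', update_self]
          gcongr with l hl
          rw [update_of_ne (Finset.ne_of_mem_erase hl)]
      _ = A ^ t.card * ((∫⁻ z, G z ∂μ) * ∏ l ∈ tᶜ.erase i, G (X l)) := by
          rw [lintegral_const_mul _ (hG.mul_const _), lintegral_mul_const _ hG]
      _ ≤ A ^ t.card * (A * ∏ l ∈ tᶜ.erase i, G (X l)) := by gcongr
      _ = _ := by
          rw [Finset.card_insert_of_notMem hi, Finset.compl_insert, pow_succ, mul_assoc]

theorem lmarginal_exp_sum_le {f : M → ℝ} (hf : Measurable f)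
    (h1 : ∀ z, |f z| ≤ 1) (h0 : ∫ z, f z ∂μ = 0) {V : ℝ} (hV : ∫ z, f z ^ 2 ∂μ ≤ V)
    (t : Finset (Fin N)) (X : Fin N → M) :
    (∫⋯∫⁻_t, fun X => ENNReal.ofReal (Real.exp (∑ l, f (X l))) ∂fun _ => μ) X
      ≤ ENNReal.ofReal (Real.exp (N * V + tᶜ.card)) := by
  have hV0 : 0 ≤ V := (integral_nonneg fun z => sq_nonneg _).trans hV
  simp_rw [Real.exp_sum, ENNReal.ofReal_prod_of_nonneg fun i _ => (Real.exp_pos _).le]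
  refine (lmarginal_prod_le (G := fun z => ENNReal.ofReal (Real.exp (f z)))
    hf.exp.ennreal_ofReal (lintegral_exp_le_exp_of_integral_eq_zero hf h1 h0 hV) t X).trans ?_
  rw [Real.exp_add, ENNReal.ofReal_mul (Real.exp_pos _).le]
  refine mul_le_mul' ?_ ?_
  · rw [← ENNReal.ofReal_pow (Real.exp_pos _).le, ← Real.exp_nat_mul]
    gcongr
    simpa using t.card_le_univ
  · calc _ ≤ ∏ _l ∈ tᶜ, ENNReal.ofReal (Real.exp 1) := by
          gcongr with l
          exact (abs_le.1 (h1 _)).2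
      _ = _ := by
          rw [Finset.prod_const, ← ENNReal.ofReal_pow (Real.exp_pos _).le, ← Real.exp_nat_mul,
            mul_one]

/-- Reduction of the exponential of a complex norm to exponentials of real linear functions. -/
theorem exp_mul_norm_le {s : ℝ} (hs : 0 ≤ s) (z : ℂ) :
    Real.exp (s * ‖z‖) ≤ Real.exp (2 * s * z.re) + Real.exp (-(2 * s * z.re))
      + Real.exp (2 * s * z.im) + Real.exp (-(2 * s * z.im)) := by
  have h := Complex.norm_le_abs_re_add_abs_im z
  have p1 := Real.exp_pos (2 * s * z.re)
  have p2 := Real.exp_pos (-(2 * s * z.re))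
  have p3 := Real.exp_pos (2 * s * z.im)
  have p4 := Real.exp_pos (-(2 * s * z.im))
  have key : ∀ a : ℝ, ‖z‖ ≤ 2 * |a| →
      Real.exp (s * ‖z‖) ≤ Real.exp (2 * s * a) + Real.exp (-(2 * s * a)) := fun a ha => by
    have q1 := Real.exp_pos (2 * s * a)
    have q2 := Real.exp_pos (-(2 * s * a))
    have h3 : s * ‖z‖ ≤ s * (2 * |a|) := by gcongr
    rcases abs_cases a with ⟨h4, -⟩ | ⟨h4, -⟩
    · have := Real.exp_le_exp.2 (show s * ‖z‖ ≤ 2 * s * a by rw [h4] at h3; linarith)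
      linarith
    · have := Real.exp_le_exp.2 (show s * ‖z‖ ≤ -(2 * s * a) by rw [h4] at h3; linarith)
      linarith
  rcases le_total |z.re| |z.im| with h2 | h2
  · linarith [key z.im (by linarith)]
  · linarith [key z.re (by linarith)]

/-- Exponential moment of the empirical mean of a centred bounded function, with the samples outside
`t` frozen: each frozen sample costs at most a factor `e`. -/
theorem lmarginal_exp_norm_mean_le {F : M → ℂ} (hF : Measurable F) {b V s : ℝ}
    (hb : ∀ z, ‖F z‖ ≤ b) (h0 : ∫ z, F z ∂μ = 0) (hV : ∫ z, ‖F z‖ ^ 2 ∂μ ≤ V) (hN : 0 < N)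
    (hs : 0 ≤ s) (hsb : 2 * s * b ≤ N) (t : Finset (Fin N)) (X : Fin N → M) :
    (∫⋯∫⁻_t, fun X => ENNReal.ofReal (Real.exp (s * ‖(N : ℂ)⁻¹ * ∑ l, F (X l)‖)) ∂fun _ => μ) X
      ≤ ENNReal.ofReal (4 * Real.exp (4 * s ^ 2 * V / N + tᶜ.card)) := by
  have hN' : (0 : ℝ) < N := Nat.cast_pos.2 hN
  have hFi : Integrable F μ := Integrable.of_bound hF.aestronglyMeasurable b (ae_of_all _ hb)
  have hF2 : Integrable (fun z => ‖F z‖ ^ 2) μ :=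
    Integrable.of_bound (hF.norm.pow_const 2).aestronglyMeasurable (C := b ^ 2)
      (ae_of_all _ fun z => by
        rw [Real.norm_eq_abs, abs_pow, abs_norm]; gcongr; exact hb z)
  -- The bound for one real component `φ` of `F`.
  have key : ∀ φ : ℂ →L[ℝ] ℝ, (∀ z, |φ z| ≤ ‖z‖) →
      (∫⋯∫⁻_t, fun X => ENNReal.ofReal (Real.exp (∑ l, 2 * s / N * φ (F (X l)))) ∂fun _ => μ) X
      ≤ ENNReal.ofReal (Real.exp (4 * s ^ 2 * V / N + tᶜ.card)) := by
    intro φ hφ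
    have := lmarginal_exp_sum_le (μ := μ) (f := fun z => 2 * s / N * φ (F z))
      (V := 4 * s ^ 2 * V / N ^ 2) ((φ.measurable.comp hF).const_mul _) (fun z => ?_) ?_ ?_ t X
    · convert this using 4
      field_simp
    · rw [abs_mul, abs_of_nonneg (by positivity : 0 ≤ 2 * s / N)]
      calc 2 * s / N * |φ (F z)| ≤ 2 * s / N * b := by gcongr; exact (hφ _).trans (hb z)
        _ = 2 * s * b / N := by ring
        _ ≤ 1 := (div_le_one hN').2 hsb
    · rw [integral_const_mul, φ.integral_comp_comm hFi, h0, map_zero, mul_zero]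
    · calc ∫ z, (2 * s / N * φ (F z)) ^ 2 ∂μ ≤ ∫ z, (2 * s / N) ^ 2 * ‖F z‖ ^ 2 ∂μ := by
            refine integral_mono_of_nonneg (ae_of_all _ fun z => sq_nonneg _)
              (hF2.const_mul _) (ae_of_all _ fun z => ?_)
            simp only [mul_pow]
            gcongr ?_ * ?_
            rw [← sq_abs]
            gcongr
            exact hφ _
        _ ≤ (2 * s / N) ^ 2 * V := by rw [integral_const_mul]; gcongr
        _ = _ := by ring
  set G : (ℂ →L[ℝ] ℝ) → (Fin N → M) → ℝ≥0∞ := fun φ X =>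
    ENNReal.ofReal (Real.exp (∑ l, 2 * s / N * φ (F (X l)))) with hG
  have hcomp : ∀ φ, Measurable (G φ) := fun φ =>
    (Finset.measurable_fun_sum _ fun l _ =>
      ((φ.measurable.comp hF).comp (measurable_pi_apply l)).const_mul _).exp.ennreal_ofReal
  have hpt : ∀ X : Fin N → M,
      ENNReal.ofReal (Real.exp (s * ‖(N : ℂ)⁻¹ * ∑ l, F (X l)‖)) ≤
      (G Complex.reCLM + G (-Complex.reCLM) + G Complex.imCLM + G (-Complex.imCLM)) X := by
    intro X
    simp only [hG, Pi.add_apply]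
    rw [← ENNReal.ofReal_add (by positivity) (by positivity),
      ← ENNReal.ofReal_add (by positivity) (by positivity),
      ← ENNReal.ofReal_add (by positivity) (by positivity)]
    refine ENNReal.ofReal_le_ofReal ((exp_mul_norm_le hs _).trans_eq ?_)
    have hc : ((N : ℂ)⁻¹) = (((N : ℝ)⁻¹ : ℝ) : ℂ) := by push_cast; rfl
    rw [hc, Complex.re_ofReal_mul, Complex.im_ofReal_mul, Complex.re_sum, Complex.im_sum]
    simp only [← Finset.mul_sum, neg_apply, Finset.sum_neg_distrib,
      Complex.reCLM_apply, Complex.imCLM_apply, div_eq_mul_inv, mul_assoc, mul_neg]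
  refine (lmarginal_mono hpt X).trans ?_
  have hadd : ∀ f g : (Fin N → M) → ℝ≥0∞, Measurable f →
      (∫⋯∫⁻_t, f + g ∂fun _ => μ) X
        = (∫⋯∫⁻_t, f ∂fun _ => μ) X + (∫⋯∫⁻_t, g ∂fun _ => μ) X := fun f g hf =>
    lintegral_add_left (hf.comp measurable_updateFinset) _
  rw [hadd _ _ (((hcomp _).add (hcomp _)).add (hcomp _)), hadd _ _ ((hcomp _).add (hcomp _)),
    hadd _ _ (hcomp _)]
  calc _ ≤ ENNReal.ofReal (Real.exp (4 * s ^ 2 * V / N + tᶜ.card))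
        + ENNReal.ofReal (Real.exp (4 * s ^ 2 * V / N + tᶜ.card))
        + ENNReal.ofReal (Real.exp (4 * s ^ 2 * V / N + tᶜ.card))
        + ENNReal.ofReal (Real.exp (4 * s ^ 2 * V / N + tᶜ.card)) := by
        refine add_le_add (add_le_add (add_le_add ?_ ?_) ?_) ?_
        · exact key Complex.reCLM Complex.abs_re_le_norm
        · exact key (-Complex.reCLM) fun z => by simpa using Complex.abs_re_le_norm z
        · exact key Complex.imCLM Complex.abs_im_le_norm
        · exact key (-Complex.imCLM) fun z => by simpa using Complex.abs_im_le_norm z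
    _ = _ := by
        rw [← ENNReal.ofReal_add (by positivity) (by positivity),
          ← ENNReal.ofReal_add (by positivity) (by positivity),
          ← ENNReal.ofReal_add (by positivity) (by positivity)]
        congr 1; ring

end ExpMoment

/-! ### Expected path sums -/

section PathOp

variable {M : Type*} {N : ℕ}

/-- The positive operator `g ↦ ∑ₗ W(·, xₗ) g(xₗ)`, whose powers are sums over paths through the
samples. -/
noncomputable def pathOp (W : M → M → ℝ≥0∞) (X : Fin N → M) (g : M → ℝ≥0∞) (y : M) : ℝ≥0∞ :=
  ∑ l, W y (X l) * g (X l)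

variable [MeasurableSpace M] {μ : Measure M} [IsProbabilityMeasure μ] {W : M → M → ℝ≥0∞}
  {G : M → (Fin N → M) → ℝ≥0∞}

omit [IsProbabilityMeasure μ] in
theorem measurable_pathOp_iterate (hW : Measurable (uncurry W)) (hG : Measurable (uncurry G))
    (i : ℕ) : Measurable fun q : M × (Fin N → M) => (pathOp W q.2)^[i] (fun z => G z q.2) q.1 := by
  induction i with
  | zero => exact hG
  | succ i ih =>
    simp only [iterate_succ_apply']
    refine Finset.measurable_fun_sum _ fun l _ => ?_
    have hl : Measurable fun q : M × (Fin N → M) => q.2 l :=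
      (measurable_pi_apply l).comp measurable_snd
    exact (hW.comp (measurable_fst.prodMk hl)).mul (ih.comp (hl.prodMk measurable_snd))

/-- The sum over the last vertex of a path splits into the free samples, each of which contributes
an integral and becomes frozen, and the at most `#tᶜ` samples frozen before. This accounts for the factor `#tᶜ + 1` per step. -/
theorem lmarginal_pathOp_iterate_le (hW : Measurable (uncurry W)) (hG : Measurable (uncurry G))
    (hW1 : ∀ y, N * ∫⁻ z, W y z ∂μ ≤ 2) (hW2 : ∀ y z, W y z ≤ 2) {A b : ℝ≥0∞} (hb : 1 ≤ b)
    (hA : ∀ y (t : Finset (Fin N)) X, (∫⋯∫⁻_t, G y ∂fun _ => μ) X ≤ A * b ^ tᶜ.card)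
    (i : ℕ) (y : M) (t : Finset (Fin N)) (X : Fin N → M) :
    (∫⋯∫⁻_t, fun X => (pathOp W X)^[i] (fun z => G z X) y ∂fun _ => μ) X
      ≤ A * b ^ (tᶜ.card + i) * 2 ^ i * ((tᶜ.card + 1).ascFactorial i : ℕ) := by
  induction i generalizing y t X with
  | zero => simpa using hA y t X
  | succ i ih =>
    have hmi := measurable_pathOp_iterate (N := N) hW hG i
    have hm : ∀ l, Measurable fun X : Fin N → M =>
        W y (X l) * (pathOp W X)^[i] (fun z => G z X) (X l) := fun l =>
      (hW.comp (measurable_const.prodMk (measurable_pi_apply l))).mul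
        ((show Measurable fun X : Fin N → M => (X l, X) from
          (measurable_pi_apply l).prodMk measurable_id) |> hmi.comp)
    set m := tᶜ.card with hmdef
    set Q : ℝ≥0∞ := A * b ^ (m + 1 + i) * 2 ^ i * ((m + 2).ascFactorial i : ℕ) with hQ
    have hpull : ∀ (s : Finset (Fin N)) (l : Fin N) (X : Fin N → M), l ∉ s →
        (∫⋯∫⁻_s, fun X => W y (X l) * (pathOp W X)^[i] (fun z => G z X) (X l) ∂fun _ => μ) X
        = W y (X l) * (∫⋯∫⁻_s, fun X' => (pathOp W X')^[i] (fun z => G z X') (X l) ∂fun _ => μ) X := by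
      intro s l X hl
      rw [lmarginal_comp_frozen hl (fun z X => W y z * (pathOp W X)^[i] (fun z => G z X) z) X]
      exact lintegral_const_mul _ ((hmi.comp (measurable_const.prodMk measurable_id)).comp
        measurable_updateFinset)
    have hWy : Measurable (W y) := hW.comp measurable_prodMk_left
    have hfree : ∀ l ∈ t, (∫⋯∫⁻_t, fun X => W y (X l) *
        (pathOp W X)^[i] (fun z => G z X) (X l) ∂fun _ => μ) X ≤ (∫⁻ z, W y z ∂μ) * Q := by
      intro l hl
      rw [lmarginal_erase _ (hm l) hl, ← lintegral_mul_const _ hWy]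
      refine lintegral_mono fun z => ?_
      rw [hpull _ _ _ (Finset.notMem_erase l t), update_self]
      refine mul_le_mul_right ((ih z _ _).trans_eq ?_) _
      rw [Finset.compl_erase, Finset.card_insert_of_notMem (by simpa using hl)]
    have hfrozen : ∀ l ∈ tᶜ, (∫⋯∫⁻_t, fun X => W y (X l) *
        (pathOp W X)^[i] (fun z => G z X) (X l) ∂fun _ => μ) X ≤ 2 * Q := by
      intro l hl
      rw [hpull _ _ _ (Finset.mem_compl.1 hl)]
      refine mul_le_mul' (hW2 _ _) ((ih _ _ _).trans ?_)
      rw [hQ]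
      have : (m + 1).ascFactorial i ≤ (m + 2).ascFactorial i := by
        rw [Nat.ascFactorial_eq_prod_range, Nat.ascFactorial_eq_prod_range]
        gcongr
        omega
      gcongr
      omega
    calc (∫⋯∫⁻_t, fun X => (pathOp W X)^[i + 1] (fun z => G z X) y ∂fun _ => μ) X
        = ∑ l, (∫⋯∫⁻_t, fun X => W y (X l) *
          (pathOp W X)^[i] (fun z => G z X) (X l) ∂fun _ => μ) X := by
          simp only [iterate_succ_apply']
          exact lintegral_finsetSum _ fun l _ => (hm l).comp measurable_updateFinset
      _ = ∑ l ∈ t, (∫⋯∫⁻_t, fun X => W y (X l) *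
          (pathOp W X)^[i] (fun z => G z X) (X l) ∂fun _ => μ) X +
          ∑ l ∈ tᶜ, (∫⋯∫⁻_t, fun X => W y (X l) *
          (pathOp W X)^[i] (fun z => G z X) (X l) ∂fun _ => μ) X :=
          (Finset.sum_add_sum_compl t _).symm
      _ ≤ ∑ l ∈ t, (∫⁻ z, W y z ∂μ) * Q + ∑ l ∈ tᶜ, 2 * Q :=
          add_le_add (Finset.sum_le_sum hfree) (Finset.sum_le_sum hfrozen)
      _ ≤ 2 * Q + m * (2 * Q) := by
          rw [Finset.sum_const, Finset.sum_const, nsmul_eq_mul, nsmul_eq_mul, ← mul_assoc]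
          gcongr
          refine le_trans ?_ (hW1 y)
          gcongr
          simpa using t.card_le_univ
      _ = _ := by
          have h1 : (m + 1).ascFactorial (i + 1) = (m + 1) * (m + 2).ascFactorial i := by
            rw [Nat.ascFactorial_succ, ← Nat.succ_ascFactorial]
          rw [hQ, h1, show m + (i + 1) = m + 1 + i by ring, pow_succ]
          push_cast
          ring

end PathOp

/-! ### Averaging operators -/

section Averages

variable {M : Type*} {N : ℕ}

/-- The average of `v` over the samples `X`, with weights proportional to `k(y, ·) q`. It is `0` if
all the weights vanish. -/
noncomputable def discAvg (k : M → M → ℝ) (q : M → ℝ) (X : Fin N → M) (v : M → ℂ) (y : M) : ℂ :=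
  ((∑ l, k y (X l) * q (X l))⁻¹ : ℝ) * ∑ l, ((k y (X l) * q (X l) : ℝ) : ℂ) * v (X l)

/-- `discAvg` on real functions. -/
noncomputable def discAvgReal (k : M → M → ℝ) (q : M → ℝ) (X : Fin N → M) (v : M → ℝ) (y : M) : ℝ :=
  (∑ l, k y (X l) * q (X l))⁻¹ * ∑ l, k y (X l) * q (X l) * v (X l)

/-- The average of `v` with respect to the probability measure proportional to `k(y, ·) q μ`. -/
noncomputable def contAvg [MeasurableSpace M] (μ : Measure M) (k : M → M → ℝ) (q : M → ℝ)
    (v : M → ℂ) (y : M) : ℂ :=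
  ((∫ z, k y z * q z ∂μ)⁻¹ : ℝ) * ∫ z, ((k y z * q z : ℝ) : ℂ) * v z ∂μ

variable {k : M → M → ℝ} {q : M → ℝ} {X : Fin N → M}

theorem discAvg_sub (u v : M → ℂ) (y : M) :
    discAvg k q X u y - discAvg k q X v y = discAvg k q X (fun z => u z - v z) y := by
  simp only [discAvg, mul_sub, Finset.sum_sub_distrib]

theorem discAvg_sum {ι : Type*} (s : Finset ι) (a : ι → ℂ) (v : ι → M → ℂ) (y : M) :
    discAvg k q X (fun z => ∑ j ∈ s, a j * v j z) y = ∑ j ∈ s, a j * discAvg k q X (v j) y := by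
  simp only [discAvg, Finset.mul_sum]
  rw [Finset.sum_comm]
  refine Finset.sum_congr rfl fun j _ => Finset.sum_congr rfl fun l _ => by ring

theorem discAvg_sub_const {v : M → ℂ} {y : M} (hS : ∑ l, k y (X l) * q (X l) ≠ 0) (a : ℂ) :
    discAvg k q X v y - a = ((∑ l, k y (X l) * q (X l))⁻¹ : ℝ) *
      ∑ l, ((k y (X l) * q (X l) : ℝ) : ℂ) * (v (X l) - a) := by
  have h : (((∑ l, k y (X l) * q (X l) : ℝ)) : ℂ) ≠ 0 := Complex.ofReal_ne_zero.2 hS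
  simp only [discAvg, mul_sub, Finset.sum_sub_distrib, ← Finset.sum_mul, ← Complex.ofReal_sum]
  rw [Complex.ofReal_inv, inv_mul_cancel_left₀ h]

variable (hk : ∀ y z, 0 ≤ k y z) (hq : ∀ z, 0 ≤ q z)

include hk hq

theorem norm_discAvg_le (v : M → ℂ) (y : M) :
    ‖discAvg k q X v y‖ ≤ discAvgReal k q X (fun z => ‖v z‖) y := by
  have h0 : ∀ l, 0 ≤ k y (X l) * q (X l) := fun l => mul_nonneg (hk _ _) (hq _)
  rw [discAvg, discAvgReal, norm_mul, Complex.norm_real, Real.norm_of_nonneg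
    (inv_nonneg.2 (Finset.sum_nonneg fun l _ => h0 l))]
  gcongr
  · exact inv_nonneg.2 (Finset.sum_nonneg fun l _ => h0 l)
  · refine norm_sum_le_of_le _ fun l _ => ?_
    rw [norm_mul, Complex.norm_real, Real.norm_of_nonneg (h0 l)]

theorem discAvgReal_mono {g h : M → ℝ} (hgh : ∀ z, g z ≤ h z) (y : M) :
    discAvgReal k q X g y ≤ discAvgReal k q X h y := by
  have h0 : ∀ l, 0 ≤ k y (X l) * q (X l) := fun l => mul_nonneg (hk _ _) (hq _)
  refine mul_le_mul_of_nonneg_left (Finset.sum_le_sum fun l _ => ?_)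
    (inv_nonneg.2 (Finset.sum_nonneg fun l _ => h0 l))
  exact mul_le_mul_of_nonneg_left (hgh _) (h0 l)

theorem discAvgReal_nonneg {g : M → ℝ} (hg : ∀ z, 0 ≤ g z) (y : M) :
    0 ≤ discAvgReal k q X g y := by
  have h0 : ∀ l, 0 ≤ k y (X l) * q (X l) := fun l => mul_nonneg (hk _ _) (hq _)
  exact mul_nonneg (inv_nonneg.2 (Finset.sum_nonneg fun l _ => h0 l))
    (Finset.sum_nonneg fun l _ => mul_nonneg (h0 l) (hg _))

theorem discAvgReal_le_const {g : M → ℝ} {t : ℝ} (ht : 0 ≤ t) (hg : ∀ l, g (X l) ≤ t) (y : M) :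
    discAvgReal k q X g y ≤ t := by
  have h0 : ∀ l, 0 ≤ k y (X l) * q (X l) := fun l => mul_nonneg (hk _ _) (hq _)
  have hS : 0 ≤ ∑ l, k y (X l) * q (X l) := Finset.sum_nonneg fun l _ => h0 l
  calc discAvgReal k q X g y
      ≤ (∑ l, k y (X l) * q (X l))⁻¹ * ∑ l, k y (X l) * q (X l) * t := by
        unfold discAvgReal
        gcongr with l
        · exact h0 l
        · exact hg l
    _ ≤ t := by
        rw [← Finset.sum_mul, ← mul_assoc]
        exact mul_le_of_le_one_left ht (inv_mul_le_one_of_le₀ le_rfl hS)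

theorem discAvgReal_iterate_nonneg {g : M → ℝ} (hg : ∀ z, 0 ≤ g z) (i : ℕ) (y : M) :
    0 ≤ (discAvgReal k q X)^[i] g y := by
  induction i generalizing y with
  | zero => exact hg y
  | succ i ih => rw [iterate_succ_apply']; exact discAvgReal_nonneg hk hq ih y

theorem discAvgReal_iterate_le_const {g : M → ℝ} {t : ℝ} {x : M} (ht : 0 ≤ t)
    (hg : ∀ l, g (X l) ≤ t) (hx : g x ≤ t) (i : ℕ) : (discAvgReal k q X)^[i] g x ≤ t := by
  induction i generalizing x with
  | zero => exact hx
  | succ i ih =>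
    rw [iterate_succ_apply']
    exact discAvgReal_le_const hk hq ht (fun l => ih (hg l)) x

theorem norm_discAvg_le_const {v : M → ℂ} {U : ℝ} (hv : ∀ z, ‖v z‖ ≤ U) (y : M) :
    ‖discAvg k q X v y‖ ≤ U :=
  (norm_discAvg_le hk hq v y).trans
    (discAvgReal_le_const hk hq ((norm_nonneg _).trans (hv y)) (fun _ => hv _) y)

theorem norm_discAvg_iterate_le {v : M → ℂ} {U : ℝ} (hv : ∀ z, ‖v z‖ ≤ U) (m : ℕ) (y : M) :
    ‖(discAvg k q X)^[m] v y‖ ≤ U := by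
  induction m generalizing y with
  | zero => exact hv y
  | succ m ih => rw [iterate_succ_apply']; exact norm_discAvg_le_const hk hq ih y

/-- Telescoping comparison of the powers of `discAvg` with those of any other operator `T`. -/
theorem norm_discAvg_iterate_sub_le (T : (M → ℂ) → M → ℂ) (u : M → ℂ) (m : ℕ) (y : M) :
    ‖(discAvg k q X)^[m] u y - T^[m] u y‖ ≤ ∑ i ∈ Finset.range m,
      (discAvgReal k q X)^[i] (fun z => ‖discAvg k q X (T^[m - 1 - i] u) z
        - T (T^[m - 1 - i] u) z‖) y := by
  induction m generalizing y with
  | zero => simp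
  | succ m ih =>
    have hsum : ∀ (s : Finset ℕ) (h : ℕ → M → ℝ), discAvgReal k q X (fun z => ∑ i ∈ s, h i z) y
        = ∑ i ∈ s, discAvgReal k q X (h i) y := fun s h => by
      simp only [discAvgReal, Finset.mul_sum]
      rw [Finset.sum_comm]
    rw [Finset.sum_range_succ']
    simp only [iterate_zero, id_eq, Nat.add_sub_cancel, Nat.sub_zero]
    rw [iterate_succ_apply', iterate_succ_apply',
      ← sub_add_sub_cancel _ (discAvg k q X (T^[m] u) y) _]
    refine (norm_add_le _ _).trans (add_le_add_left ?_ _)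
    rw [discAvg_sub]
    refine (norm_discAvg_le hk hq _ y).trans ((discAvgReal_mono hk hq ih y).trans_eq ?_)
    rw [hsum]
    refine Finset.sum_congr rfl fun i _ => ?_
    rw [iterate_succ_apply', show m - (i + 1) = m - 1 - i by omega]

end Averages

section ContAvg

variable {M : Type*} [MeasurableSpace M] {μ : Measure M} [IsProbabilityMeasure μ]
  {k : M → M → ℝ} {q : M → ℝ}

/-- A measurable kernel with `0 ≤ k ≤ B`, whose degree function is at least `c > 0`. -/
structure IsBoundedKernel (μ : Measure M) (k : M → M → ℝ) (B c : ℝ) : Prop where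
  measurable : Measurable (uncurry k)
  nonneg : ∀ y z, 0 ≤ k y z
  le : ∀ y z, k y z ≤ B
  pos : 0 < c
  degree_ge : ∀ y, c ≤ ∫ z, k y z ∂μ

namespace IsBoundedKernel

variable {B c : ℝ} (hk : IsBoundedKernel μ k B c)
include hk

omit [IsProbabilityMeasure μ] in
theorem measurable_right (y : M) : Measurable (k y) := hk.measurable.comp measurable_prodMk_left

theorem integrable (y : M) : Integrable (k y) μ :=
  Integrable.of_bound (hk.measurable_right y).aestronglyMeasurable B (ae_of_all _ fun z => by
    rw [Real.norm_of_nonneg (hk.nonneg y z)]; exact hk.le y z)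

theorem degree_le (y : M) : ∫ z, k y z ∂μ ≤ B := by
  calc ∫ z, k y z ∂μ ≤ ∫ _, B ∂μ := integral_mono (hk.integrable y) (integrable_const _) (hk.le y)
    _ = B := by simp

theorem measurable_degree : Measurable fun y => ∫ z, k y z ∂μ :=
  (StronglyMeasurable.integral_prod_right (f := k) hk.measurable.stronglyMeasurable).measurable

theorem integral_sq_le (y : M) : ∫ z, k y z ^ 2 ∂μ ≤ B * ∫ z, k y z ∂μ := by
  rw [← integral_const_mul]
  refine integral_mono_of_nonneg (ae_of_all _ fun z => sq_nonneg _)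
    ((hk.integrable y).const_mul _) (ae_of_all _ fun z => ?_)
  simp only [sq]
  exact mul_le_mul_of_nonneg_right (hk.le y z) (hk.nonneg y z)

theorem bound_pos [Nonempty M] : 0 < B := by
  obtain ⟨y⟩ := ‹Nonempty M›
  exact hk.pos.trans_le ((hk.degree_ge y).trans (hk.degree_le y))

end IsBoundedKernel

omit [IsProbabilityMeasure μ] in
theorem norm_contAvg_le_const (hk : ∀ y z, 0 ≤ k y z) (hq : ∀ z, 0 ≤ q z) {v : M → ℂ} {U : ℝ}
    (hv : ∀ z, ‖v z‖ ≤ U) (y : M) : ‖contAvg μ k q v y‖ ≤ U := by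
  have h0 : ∀ z, 0 ≤ k y z * q z := fun z => mul_nonneg (hk _ _) (hq _)
  have hU : 0 ≤ U := (norm_nonneg _).trans (hv y)
  by_cases hi : Integrable (fun z => k y z * q z) μ
  · have h1 : ‖∫ z, ((k y z * q z : ℝ) : ℂ) * v z ∂μ‖ ≤ (∫ z, k y z * q z ∂μ) * U := by
      rw [← integral_mul_const]
      refine norm_integral_le_of_norm_le (hi.mul_const _) (ae_of_all _ fun z => ?_)
      rw [norm_mul, Complex.norm_real, Real.norm_of_nonneg (h0 z)]
      exact mul_le_mul_of_nonneg_left (hv z) (h0 z)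
    have h2 : 0 ≤ ∫ z, k y z * q z ∂μ := integral_nonneg h0
    rw [contAvg, norm_mul, Complex.norm_real, Real.norm_of_nonneg (inv_nonneg.2 h2)]
    calc _ ≤ (∫ z, k y z * q z ∂μ)⁻¹ * ((∫ z, k y z * q z ∂μ) * U) := by gcongr
      _ ≤ U := by
        rw [← mul_assoc]
        exact mul_le_of_le_one_left hU (inv_mul_le_one_of_le₀ le_rfl h2)
  · rw [contAvg, integral_undef hi]
    simpa using hU

theorem measurable_contAvg (hk : Measurable (uncurry k)) (hq : Measurable q) {v : M → ℂ}
    (hv : Measurable v) : Measurable (contAvg μ k q v) := by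
  have h1 : Measurable (uncurry fun y z => k y z * q z) := hk.mul (hq.comp measurable_snd)
  have h2 : Measurable (uncurry fun y z => ((k y z * q z : ℝ) : ℂ) * v z) :=
    (Complex.measurable_ofReal.comp h1).mul (hv.comp measurable_snd)
  exact (Complex.measurable_ofReal.comp (StronglyMeasurable.integral_prod_right (f := fun y z =>
    k y z * q z) h1.stronglyMeasurable).measurable.inv).mul
    (StronglyMeasurable.integral_prod_right (f := fun y z => ((k y z * q z : ℝ) : ℂ) * v z)
      h2.stronglyMeasurable).measurable

omit [IsProbabilityMeasure μ] in
theorem contAvg_sum {ι : Type*} (s : Finset ι) (a : ι → ℂ) {v : ι → M → ℂ} {y : M}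
    (hi : ∀ j ∈ s, Integrable (fun z => ((k y z * q z : ℝ) : ℂ) * v j z) μ) :
    contAvg μ k q (fun z => ∑ j ∈ s, a j * v j z) y = ∑ j ∈ s, a j * contAvg μ k q (v j) y := by
  have : ∀ z, ((k y z * q z : ℝ) : ℂ) * ∑ j ∈ s, a j * v j z
      = ∑ j ∈ s, a j * (((k y z * q z : ℝ) : ℂ) * v j z) := fun z => by
    rw [Finset.mul_sum]
    exact Finset.sum_congr rfl fun j _ => by ring
  simp only [contAvg, this]
  rw [integral_finsetSum _ fun j hj => (hi j hj).const_mul _, Finset.mul_sum]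
  refine Finset.sum_congr rfl fun j _ => ?_
  rw [integral_const_mul]
  ring

omit [IsProbabilityMeasure μ] in
theorem integral_mul_sub_contAvg {v : M → ℂ} {y : M}
    (hi : Integrable (fun z => k y z * q z) μ)
    (hiv : Integrable (fun z => ((k y z * q z : ℝ) : ℂ) * v z) μ)
    (hne : ∫ z, k y z * q z ∂μ ≠ 0) :
    ∫ z, ((k y z * q z : ℝ) : ℂ) * (v z - contAvg μ k q v y) ∂μ = 0 := by
  have h : ((∫ z, k y z * q z ∂μ : ℝ) : ℂ) ≠ 0 := Complex.ofReal_ne_zero.2 hne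
  simp only [mul_sub]
  have hi' : Integrable (fun z => ((k y z * q z : ℝ) : ℂ) * contAvg μ k q v y) μ :=
    hi.ofReal.mul_const _
  rw [integral_sub hiv hi', integral_mul_const, integral_complex_ofReal,
    contAvg, Complex.ofReal_inv, mul_inv_cancel_left₀ h, sub_self]

end ContAvg

/-! ### Concentration for the unweighted averages, without a factor `N` -/

section Unweighted

variable {M : Type*} {N : ℕ}

/-- The transition weights `2 k(y, z) / (N d(y))`, which dominate those of the random walk on the
samples at every `y` where the empirical degree is at least half of the degree `d y`. -/
noncomputable def pathWeight (N : ℕ) (k : M → M → ℝ) (d : M → ℝ) (y z : M) : ℝ≥0∞ :=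
  ENNReal.ofReal (2 * k y z / (N * d y))

/-- Pathwise bound for the powers of the random walk: the paths are followed until they first meet
a point of small empirical degree, where `G₂` takes over. -/
theorem ofReal_discAvgReal_iterate_le {k : M → M → ℝ} {d : M → ℝ} (hk : ∀ y z, 0 ≤ k y z)
    (hd : ∀ y, 0 < d y) (hN : 0 < N) {X : Fin N → M} {g : M → ℝ} {τ T : ℝ}
    {Θ : ℝ≥0∞} {G₁ G₂ : M → ℝ≥0∞} (hg0 : ∀ z, 0 ≤ g z) (hgT : ∀ z, g z ≤ T)
    (h1 : ∀ y, ENNReal.ofReal (g y) ≤ ENNReal.ofReal τ + Θ * (G₁ y + G₂ y))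
    (h2 : ∀ y, ∑ l, k y (X l) < N * d y / 2 → ENNReal.ofReal T ≤ Θ * G₂ y) (i : ℕ) (y : M) :
    ENNReal.ofReal ((discAvgReal k (fun _ => 1) X)^[i] g y) ≤ ENNReal.ofReal τ +
      Θ * ((pathOp (pathWeight N k d) X)^[i] G₁ y +
        ∑ j ∈ Finset.range (i + 1), (pathOp (pathWeight N k d) X)^[j] G₂ y) := by
  have hq : ∀ _ : M, (0 : ℝ) ≤ 1 := fun _ => zero_le_one
  induction i generalizing y with
  | zero => simpa using h1 y
  | succ i ih =>
    set W := pathWeight N k d with hW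
    have hT : 0 ≤ T := (hg0 y).trans (hgT y)
    rcases lt_or_ge (∑ l, k y (X l)) (N * d y / 2) with hbad | hgood
    · calc _ ≤ ENNReal.ofReal T := ENNReal.ofReal_le_ofReal
            (discAvgReal_iterate_le_const hk hq hT (fun l => hgT _) (hgT _) _)
        _ ≤ Θ * G₂ y := h2 y hbad
        _ ≤ Θ * ∑ j ∈ Finset.range (i + 1 + 1), (pathOp W X)^[j] G₂ y := by
            rw [Finset.sum_range_succ']
            exact mul_le_mul_right (le_add_self) _
        _ ≤ _ := by
            rw [mul_add, ← add_assoc]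
            exact le_add_self
    · set Z : M → ℝ≥0∞ := fun z => (pathOp W X)^[i] G₁ z +
        ∑ j ∈ Finset.range (i + 1), (pathOp W X)^[j] G₂ z with hZ
      have hS : 0 < ∑ l, k y (X l) := lt_of_lt_of_le
        (by have := hd y; have : (0 : ℝ) < N := Nat.cast_pos.2 hN; positivity) hgood
      have hNd : 0 < N * d y := mul_pos (Nat.cast_pos.2 hN) (hd y)
      have hwS : ∀ l, k y (X l) / ∑ l, k y (X l) ≤ 2 * k y (X l) / (N * d y) := fun l => by
        rw [div_le_div_iff₀ hS hNd]
        have := mul_le_mul_of_nonneg_left hgood (hk y (X l))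
        linarith
      have hstep : (discAvgReal k (fun _ => 1) X)^[i + 1] g y
          = ∑ l, k y (X l) / (∑ l, k y (X l)) * (discAvgReal k (fun _ => 1) X)^[i] g (X l) := by
        rw [iterate_succ_apply', discAvgReal, Finset.mul_sum]
        refine Finset.sum_congr rfl fun l _ => ?_
        simp only [mul_one]
        ring
      have hw0 : ∀ l, 0 ≤ k y (X l) / ∑ l, k y (X l) := fun l => div_nonneg (hk _ _) hS.le
      rw [hstep, ENNReal.ofReal_sum_of_nonneg fun l _ =>
        mul_nonneg (hw0 l) (discAvgReal_iterate_nonneg hk hq hg0 i _)]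
      calc _ ≤ ∑ l, (ENNReal.ofReal (k y (X l) / ∑ l, k y (X l)) * ENNReal.ofReal τ +
            Θ * (W y (X l) * Z (X l))) := by
            refine Finset.sum_le_sum fun l _ => ?_
            rw [ENNReal.ofReal_mul (hw0 l)]
            refine (mul_le_mul_right (ih (X l)) _).trans ?_
            rw [mul_add, mul_left_comm _ Θ]
            gcongr
            exact ENNReal.ofReal_le_ofReal (hwS l)
        _ = ENNReal.ofReal τ + Θ * pathOp W X Z y := by
            rw [Finset.sum_add_distrib, ← Finset.sum_mul, ← Finset.mul_sum,
              ← ENNReal.ofReal_sum_of_nonneg fun l _ => hw0 l, ← Finset.sum_div, div_self hS.ne',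
              ENNReal.ofReal_one, one_mul]
            rfl
        _ ≤ _ := by
            have : pathOp W X Z y = (pathOp W X)^[i + 1] G₁ y +
                ∑ j ∈ Finset.range (i + 1), (pathOp W X)^[j + 1] G₂ y := by
              simp only [iterate_succ_apply', hZ, pathOp, mul_add, Finset.sum_add_distrib,
                Finset.mul_sum]
              congr 1
              exact Finset.sum_comm
            rw [this, Finset.sum_range_succ' _ (i + 1)]
            gcongr
            exact le_self_add

variable [MeasurableSpace M] {μ : Measure M} [IsProbabilityMeasure μ]

/-- Expectation of the sum over the paths of length `i` from `x` of the exponential of an empirical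
mean at the end point. -/
theorem lintegral_pathOp_exp_le {W : M → M → ℝ≥0∞} (hW : Measurable (uncurry W))
    (hW1 : ∀ y, N * ∫⁻ z, W y z ∂μ ≤ 2) (hW2 : ∀ y z, W y z ≤ 2) (hN : 0 < N)
    {F : M → M → ℂ} (hF : Measurable (uncurry F)) {b V s : ℝ} (hb : ∀ y z, ‖F y z‖ ≤ b)
    (h0 : ∀ y, ∫ z, F y z ∂μ = 0) (hV : ∀ y, ∫ z, ‖F y z‖ ^ 2 ∂μ ≤ V) (hs : 0 ≤ s)
    (hsb : 2 * s * b ≤ N) (i : ℕ) (x : M) :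
    Measurable (fun X : Fin N → M => (pathOp W X)^[i] (fun z =>
      ENNReal.ofReal (Real.exp (s * ‖(N : ℂ)⁻¹ * ∑ l, F z (X l)‖))) x) ∧
    ∫⁻ X, (pathOp W X)^[i] (fun z => ENNReal.ofReal
      (Real.exp (s * ‖(N : ℂ)⁻¹ * ∑ l, F z (X l)‖))) x ∂(Measure.pi fun _ : Fin N => μ)
      ≤ ENNReal.ofReal (4 * Real.exp (4 * s ^ 2 * V / N) *
        ((2 * Real.exp 1) ^ i * i.factorial)) := by
  set G : M → (Fin N → M) → ℝ≥0∞ := fun z X =>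
    ENNReal.ofReal (Real.exp (s * ‖(N : ℂ)⁻¹ * ∑ l, F z (X l)‖)) with hG
  have hGm : Measurable (uncurry G) := by
    have : Measurable fun q : M × (Fin N → M) => ∑ l, F q.1 (q.2 l) :=
      Finset.measurable_fun_sum _ fun l _ =>
        hF.comp (measurable_fst.prodMk ((measurable_pi_apply l).comp measurable_snd))
    exact (((this.const_mul _).norm.const_mul _).exp).ennreal_ofReal
  have hm := (measurable_pathOp_iterate (N := N) hW hGm i).comp (measurable_prodMk_left (x := x))
  refine ⟨hm, ?_⟩
  have hne : Nonempty M := ⟨x⟩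
  rw [lintegral_eq_lmarginal_univ (fun _ => x)]
  refine (lmarginal_pathOp_iterate_le hW hGm hW1 hW2
    (A := ENNReal.ofReal (4 * Real.exp (4 * s ^ 2 * V / N))) (b := ENNReal.ofReal (Real.exp 1))
    (by rw [← ENNReal.ofReal_one]; exact ENNReal.ofReal_le_ofReal (Real.one_le_exp zero_le_one))
    (fun y t X => ?_) i x Finset.univ _).trans_eq ?_
  · refine (lmarginal_exp_norm_mean_le (hF.comp measurable_prodMk_left) (hb y) (h0 y) (hV y) hN
      hs hsb t X).trans_eq ?_
    rw [Real.exp_add, ← ENNReal.ofReal_pow (Real.exp_pos _).le, ← ENNReal.ofReal_mul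
      (by positivity), ← Real.exp_nat_mul, mul_one, mul_assoc (4 : ℝ) (Real.exp _)]
  · rw [Finset.compl_univ, Finset.card_empty, zero_add, zero_add, Nat.one_ascFactorial,
      ENNReal.ofReal_mul (p := 4 * Real.exp _) (by positivity), mul_pow, mul_comm (2 ^ i : ℝ),
      ENNReal.ofReal_mul (q := (i.factorial : ℝ)) (by positivity),
      ENNReal.ofReal_mul (q := (2 : ℝ) ^ i) (by positivity), ENNReal.ofReal_pow (by positivity),
      ENNReal.ofReal_pow (by positivity), ENNReal.ofReal_natCast]
    simp only [ENNReal.ofReal_ofNat, mul_assoc]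

theorem pathSum_const_le (i : ℕ) :
    4 * ((i : ℝ) + 2) * ((2 * Real.exp 1) ^ i * i.factorial)
      ≤ 8 * Real.exp (2 * i ^ 2 + 2 * i) := by
  have he : (i : ℝ) + 1 ≤ Real.exp i := Real.add_one_le_exp _
  have h1 : (i.factorial : ℝ) ≤ Real.exp (i ^ 2) := by
    calc (i.factorial : ℝ) ≤ (i : ℝ) ^ i := by exact_mod_cast Nat.factorial_le_pow i
      _ ≤ Real.exp i ^ i := by gcongr; linarith
      _ = _ := by rw [← Real.exp_nat_mul, sq]
  have h2 : (2 * Real.exp 1) ^ i ≤ Real.exp (2 * i) := by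
    calc (2 * Real.exp 1) ^ i ≤ (Real.exp 1 * Real.exp 1) ^ i := by
          gcongr; linarith [Real.add_one_le_exp 1]
      _ = _ := by rw [← Real.exp_add, ← Real.exp_nat_mul]; congr 1; ring
  have h3 : (i : ℝ) ≤ i ^ 2 := by exact_mod_cast Nat.le_self_pow two_ne_zero i
  calc 4 * ((i : ℝ) + 2) * ((2 * Real.exp 1) ^ i * i.factorial)
      ≤ 8 * Real.exp i * (Real.exp (2 * i) * Real.exp (i ^ 2)) := by
        refine mul_le_mul ?_ (mul_le_mul h2 h1 (by positivity) (by positivity)) (by positivity)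
          (by positivity)
        linarith [(Nat.cast_nonneg i : (0 : ℝ) ≤ i)]
    _ = 8 * Real.exp (i + (2 * i + i ^ 2)) := by rw [Real.exp_add, Real.exp_add, mul_assoc]
    _ ≤ _ := mul_le_mul_of_nonneg_left (Real.exp_le_exp.2 (by linarith)) (by norm_num)

/-- Chernoff-type domination: above the level `a / 2`, a number is at most `a / 2` times an
exponential, as soon as the rate `s` satisfies `1 ≤ s * a / 2`. -/
theorem le_half_mul_exp {a s h : ℝ} (ha : 0 < a) (hs : 1 ≤ s * a / 2) (hh : a / 2 ≤ h) :
    h ≤ a / 2 * (Real.exp (-(s * a / 2)) * Real.exp (s * h)) := by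
  rw [← Real.exp_add]
  have h1 : 2 * h / a ≤ Real.exp (-(s * a / 2) + s * h) := by
    have h2 : 1 ≤ 2 * h / a := by rw [le_div_iff₀ ha]; linarith
    calc 2 * h / a = (2 * h / a - 1) + 1 := by ring
      _ ≤ Real.exp (2 * h / a - 1) := Real.add_one_le_exp _
      _ ≤ _ := by
        gcongr
        calc 2 * h / a - 1 ≤ s * a / 2 * (2 * h / a - 1) :=
              le_mul_of_one_le_left (by linarith) hs
          _ = _ := by field_simp; ring
  calc h = a / 2 * (2 * h / a) := by field_simp
    _ ≤ _ := by gcongr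

section Fluctuations

variable {k : M → M → ℝ} {B c : ℝ} (hk : IsBoundedKernel μ k B c)
include hk

theorem centered_degree (y : M) :
    ∫ z, ((2 * (k y z / (∫ z, k y z ∂μ) - 1) : ℝ) : ℂ) ∂μ = 0 := by
  have hd := hk.pos.trans_le (hk.degree_ge y)
  rw [integral_complex_ofReal, integral_const_mul, integral_sub ((hk.integrable y).div_const _)
    (integrable_const _), integral_div, div_self hd.ne']
  simp

theorem norm_degree_fluctuation_le (y z : M) :
    ‖((2 * (k y z / (∫ z, k y z ∂μ) - 1) : ℝ) : ℂ)‖ ≤ 2 * B / c := by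
  have hd := hk.pos.trans_le (hk.degree_ge y)
  have hdB := hk.degree_le y
  have hB := hd.trans_le hdB
  have h1 : k y z / (∫ z, k y z ∂μ) ≤ B / c := by
    gcongr
    · exact hk.pos
    · exact hk.le y z
    · exact hk.degree_ge y
  have h2 : 1 ≤ B / c := by rw [le_div_iff₀ hk.pos, one_mul]; exact (hk.degree_ge y).trans hdB
  have h3 : 0 ≤ k y z / (∫ z, k y z ∂μ) := div_nonneg (hk.nonneg y z) hd.le
  rw [Complex.norm_real, Real.norm_eq_abs, abs_mul, abs_two, mul_div_assoc]
  gcongr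
  rw [abs_le]
  constructor <;> linarith

theorem integral_degree_fluctuation_sq_le (y : M) :
    ∫ z, ‖((2 * (k y z / (∫ z, k y z ∂μ) - 1) : ℝ) : ℂ)‖ ^ 2 ∂μ ≤ 4 * B / c := by
  have hd := hk.pos.trans_le (hk.degree_ge y)
  have hB := hd.trans_le (hk.degree_le y)
  set d := ∫ z, k y z ∂μ with hdd
  have hi := hk.integrable y
  have hi2 : Integrable (fun z => k y z ^ 2) μ :=
    Integrable.of_bound ((hk.measurable_right y).pow_const 2).aestronglyMeasurable (B ^ 2)
      (ae_of_all _ fun z => by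
        rw [Real.norm_of_nonneg (sq_nonneg _)]
        exact pow_le_pow_left₀ (hk.nonneg y z) (hk.le y z) 2)
  have hpt : ∀ z, ‖((2 * (k y z / d - 1) : ℝ) : ℂ)‖ ^ 2
      = 4 / d ^ 2 * k y z ^ 2 - (8 / d * k y z - 4) := fun z => by
    rw [Complex.norm_real, Real.norm_eq_abs, sq_abs]
    field_simp
    ring
  simp only [hpt]
  have hi3 : Integrable (fun z => 8 / d * k y z - 4) μ := (hi.const_mul _).sub (integrable_const _)
  rw [integral_sub (hi2.const_mul _) hi3, integral_sub (hi.const_mul _) (integrable_const _),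
    integral_const_mul, integral_const_mul, ← hdd]
  simp only [integral_const, probReal_univ, one_smul]
  calc 4 / d ^ 2 * ∫ z, k y z ^ 2 ∂μ - (8 / d * d - 4)
      ≤ 4 / d ^ 2 * (B * d) - (8 / d * d - 4) := by
        gcongr; exact hk.integral_sq_le y
    _ = 4 * B / d - 4 := by field_simp; ring
    _ ≤ 4 * B / d := by linarith
    _ ≤ 4 * B / c := by
        gcongr
        · exact hk.pos
        · exact hk.degree_ge y

end Fluctuations

end Unweighted

section UnweightedTail

variable {M : Type*} {N : ℕ} [MeasurableSpace M] {μ : Measure M} [IsProbabilityMeasure μ]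
  {k : M → M → ℝ} {B c : ℝ}

section Fluctuations

variable (hk : IsBoundedKernel μ k B c) {v : M → ℂ} (hv : Measurable v) {U : ℝ} (hU : 0 < U)
  (hvU : ∀ z, ‖v z‖ ≤ U)
include hk hv hU hvU

/-- The summand of the numerator of `discAvg v y - contAvg v y`, relative to the size `U` of `v` and
the degree at `y`. -/
theorem value_fluctuation_bounds (y : M) :
    ∫ z, ((k y z / (U * ∫ z, k y z ∂μ) : ℝ) : ℂ) * (v z - contAvg μ k (fun _ => 1) v y) ∂μ = 0 ∧
    (∀ z, ‖((k y z / (U * ∫ z, k y z ∂μ) : ℝ) : ℂ) * (v z - contAvg μ k (fun _ => 1) v y)‖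
      ≤ 2 * B / c) ∧
    ∫ z, ‖((k y z / (U * ∫ z, k y z ∂μ) : ℝ) : ℂ) * (v z - contAvg μ k (fun _ => 1) v y)‖ ^ 2 ∂μ
      ≤ 4 * B / c := by
  have hd := hk.pos.trans_le (hk.degree_ge y)
  have hB := hd.trans_le (hk.degree_le y)
  have hi := hk.integrable y
  set a := contAvg μ k (fun _ => 1) v y with ha
  have haU : ‖a‖ ≤ U := norm_contAvg_le_const hk.nonneg (fun _ => zero_le_one) hvU y
  have hsub : ∀ z, ‖v z - a‖ ≤ 2 * U := fun z => by
    linarith [norm_sub_le (v z) a, hvU z]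
  have hcenter : ∫ z, ((k y z : ℝ) : ℂ) * (v z - a) ∂μ = 0 := by
    have h := integral_mul_sub_contAvg (μ := μ) (k := k) (q := fun _ => 1) (v := v) (y := y)
      (by simpa using hi) ?_ (by simpa using hd.ne')
    · simpa using h
    · simp only [mul_one]
      exact hi.ofReal.mul_bdd (c := U) hv.aestronglyMeasurable (ae_of_all _ hvU)
  set d := ∫ z, k y z ∂μ with hdd
  have hnorm : ∀ z, ‖((k y z / (U * d) : ℝ) : ℂ) * (v z - a)‖ ≤ 2 * (k y z / d) := fun z => by
    have h0 := hk.nonneg y z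
    rw [norm_mul, Complex.norm_real, Real.norm_of_nonneg (by positivity)]
    calc k y z / (U * d) * ‖v z - a‖ ≤ k y z / (U * d) * (2 * U) := by gcongr; exact hsub z
      _ = _ := by field_simp
  refine ⟨?_, fun z => (hnorm z).trans ?_, ?_⟩
  · have : ∀ z, ((k y z / (U * d) : ℝ) : ℂ) * (v z - a)
        = (((U * d)⁻¹ : ℝ) : ℂ) * (((k y z : ℝ) : ℂ) * (v z - a)) := fun z => by
      rw [div_eq_inv_mul, Complex.ofReal_mul, mul_assoc]
    simp only [this]
    rw [integral_const_mul, hcenter, mul_zero]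
  · rw [mul_div_assoc]
    gcongr
    · exact hk.pos
    · exact hk.le y z
    · exact hk.degree_ge y
  · calc ∫ z, ‖((k y z / (U * d) : ℝ) : ℂ) * (v z - a)‖ ^ 2 ∂μ
        ≤ ∫ z, 4 * B / d ^ 2 * k y z ∂μ := by
          refine integral_mono_of_nonneg (ae_of_all _ fun z => sq_nonneg _) (hi.const_mul _)
            (ae_of_all _ fun z => ?_)
          have h0 := hk.nonneg y z
          calc ‖((k y z / (U * d) : ℝ) : ℂ) * (v z - a)‖ ^ 2 ≤ (2 * (k y z / d)) ^ 2 := by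
                gcongr; exact hnorm z
            _ = 4 * k y z / d ^ 2 * k y z := by ring
            _ ≤ 4 * B / d ^ 2 * k y z := by gcongr; exact hk.le y z
      _ = 4 * B / d := by rw [integral_const_mul, ← hdd]; field_simp
      _ ≤ 4 * B / c := by
          gcongr
          · exact hk.pos
          · exact hk.degree_ge y

end Fluctuations

omit [IsProbabilityMeasure μ] in
theorem norm_discAvg_sub_contAvg_le {q q' : M → ℝ} (hk : ∀ y z, 0 ≤ k y z) (hq : ∀ z, 0 ≤ q z)
    (hq' : ∀ z, 0 ≤ q' z) {v : M → ℂ} {U : ℝ} (hvU : ∀ z, ‖v z‖ ≤ U) (X : Fin N → M) (y : M) :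
    ‖discAvg k q X v y - contAvg μ k q' v y‖ ≤ 2 * U := by
  linarith [norm_sub_le (discAvg k q X v y) (contAvg μ k q' v y),
    norm_discAvg_le_const (X := X) hk hq hvU y, norm_contAvg_le_const (μ := μ) hk hq' hvU y]

omit [IsProbabilityMeasure μ] in
theorem norm_discAvg_sub_contAvg_le_of_good (hk : IsBoundedKernel μ k B c) (hN : 0 < N)
    {v : M → ℂ} {U : ℝ} (hU : 0 < U) {X : Fin N → M} {y : M}
    (hgood : N * (∫ z, k y z ∂μ) / 2 ≤ ∑ l, k y (X l)) :
    ‖discAvg k (fun _ => 1) X v y - contAvg μ k (fun _ => 1) v y‖ ≤ 2 * U *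
      ‖(N : ℂ)⁻¹ * ∑ l, ((k y (X l) / (U * ∫ z, k y z ∂μ) : ℝ) : ℂ) *
        (v (X l) - contAvg μ k (fun _ => 1) v y)‖ := by
  have hd := hk.pos.trans_le (hk.degree_ge y)
  set a := contAvg μ k (fun _ => 1) v y
  set d := ∫ z, k y z ∂μ
  have hN' : (0 : ℝ) < N := Nat.cast_pos.2 hN
  have hS : 0 < ∑ l, k y (X l) := lt_of_lt_of_le (by positivity) hgood
  rw [discAvg_sub_const (by simpa using hS.ne')]
  simp only [mul_one, div_eq_mul_inv, Complex.ofReal_mul (k y _)]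
  have : ∀ l, ((k y (X l) : ℝ) : ℂ) * (((U * d)⁻¹ : ℝ) : ℂ) * (v (X l) - a)
      = (((U * d)⁻¹ : ℝ) : ℂ) * (((k y (X l) : ℝ) : ℂ) * (v (X l) - a)) := fun l => by ring
  simp only [this, ← Finset.mul_sum]
  rw [norm_mul, norm_mul, norm_mul, Complex.norm_real, Complex.norm_real,
    Real.norm_of_nonneg (by positivity), Real.norm_of_nonneg (by positivity), norm_inv,
    Complex.norm_natCast]
  set r := ‖∑ l, ((k y (X l) : ℝ) : ℂ) * (v (X l) - a)‖
  calc (∑ l, k y (X l))⁻¹ * r ≤ (N * d / 2)⁻¹ * r := by gcongr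
    _ = _ := by field_simp

omit [IsProbabilityMeasure μ] in
/-- A small empirical degree is itself a large deviation of an empirical mean. -/
theorem one_le_degree_fluctuation_of_bad (hk : IsBoundedKernel μ k B c) (hN : 0 < N)
    {X : Fin N → M} {y : M} (hbad : ∑ l, k y (X l) < N * (∫ z, k y z ∂μ) / 2) :
    1 ≤ ‖(N : ℂ)⁻¹ * ∑ l, ((2 * (k y (X l) / (∫ z, k y z ∂μ) - 1) : ℝ) : ℂ)‖ := by
  have hd := hk.pos.trans_le (hk.degree_ge y)
  set d := ∫ z, k y z ∂μ
  have hN' : (0 : ℝ) < N := Nat.cast_pos.2 hN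
  have h1 : (N : ℂ)⁻¹ * ∑ l, ((2 * (k y (X l) / d - 1) : ℝ) : ℂ)
      = ((2 * ((∑ l, k y (X l)) / (N * d) - 1) : ℝ) : ℂ) := by
    rw [← Complex.ofReal_sum, ← Complex.ofReal_natCast, ← Complex.ofReal_inv,
      ← Complex.ofReal_mul]
    congr 1
    rw [← Finset.mul_sum, Finset.sum_sub_distrib, ← Finset.sum_div]
    simp only [Finset.sum_const, Finset.card_univ, Fintype.card_fin, nsmul_eq_mul, mul_one]
    field_simp
  rw [h1, Complex.norm_real, Real.norm_eq_abs]
  have h2 : (∑ l, k y (X l)) / (N * d) < 1 / 2 := by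
    rw [div_lt_iff₀ (by positivity)]; linarith
  rw [abs_of_nonpos (by linarith)]
  linarith

theorem measurable_pathWeight (hk : IsBoundedKernel μ k B c) :
    Measurable (uncurry (pathWeight N k fun y => ∫ z, k y z ∂μ)) :=
  ((hk.measurable.const_mul 2).div
    ((hk.measurable_degree.comp measurable_fst).const_mul _)).ennreal_ofReal

theorem lintegral_pathWeight_le (hk : IsBoundedKernel μ k B c) (hN : 0 < N) (y : M) :
    N * ∫⁻ z, pathWeight N k (fun y => ∫ z, k y z ∂μ) y z ∂μ ≤ 2 := by
  have hd := hk.pos.trans_le (hk.degree_ge y)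
  have hN' : (0 : ℝ) < N := Nat.cast_pos.2 hN
  have h0 := hk.nonneg y
  unfold pathWeight
  rw [← ofReal_integral_eq_lintegral_ofReal (((hk.integrable y).const_mul 2).div_const _)
    (ae_of_all _ fun z => by have := h0 z; positivity), ← ENNReal.ofReal_natCast,
    ← ENNReal.ofReal_mul hN'.le, integral_div, integral_const_mul]
  refine (ENNReal.ofReal_le_ofReal (le_of_eq ?_)).trans_eq (ENNReal.ofReal_ofNat 2)
  field_simp

theorem pathWeight_le (hk : IsBoundedKernel μ k B c) (hN : B ≤ c * N) (y z : M) :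
    pathWeight N k (fun y => ∫ z, k y z ∂μ) y z ≤ 2 := by
  have hd := hk.pos.trans_le (hk.degree_ge y)
  refine (ENNReal.ofReal_le_ofReal ?_).trans_eq (ENNReal.ofReal_ofNat 2)
  have hB := hd.trans_le (hk.degree_le y)
  have hN' : (0 : ℝ) < N := pos_of_mul_pos_right (hB.trans_le hN) hk.pos.le
  rw [div_le_iff₀ (by positivity)]
  have h1 : c * N ≤ (∫ z, k y z ∂μ) * N := by gcongr; exact hk.degree_ge y
  linarith [hk.le y z]

/-- Tail bound for the error of the unweighted averages, averaged along the random walk of `i` steps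
on the samples. No union bound over the samples is used: the expectation of the exponential of the
error at the end of the walk is a sum over paths. -/
theorem measure_unweighted_gt_le (hk : IsBoundedKernel μ k B c) (hN : 0 < N) {v : M → ℂ}
    (hv : Measurable v) {U : ℝ} (hU : 0 < U) (hvU : ∀ z, ‖v z‖ ≤ U) (x : M) (i : ℕ) {t : ℝ}
    (ht : 0 < t) :
    Measure.pi (fun _ : Fin N => μ) {X | t < (discAvgReal k (fun _ => 1) X)^[i]
      (fun z => ‖discAvg k (fun _ => 1) X v z - contAvg μ k (fun _ => 1) v z‖) x}
    ≤ ENNReal.ofReal (8 * Real.exp (2 * i ^ 2 + 2 * i) *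
        Real.exp (-(N * c / (1024 * B * U ^ 2) * t ^ 2))) := by
  have hne : Nonempty M := ⟨x⟩
  have hB := hk.bound_pos
  have hc := hk.pos
  have hN' : (0 : ℝ) < N := Nat.cast_pos.2 hN
  have hq : ∀ _ : M, (0 : ℝ) ≤ 1 := fun _ => zero_le_one
  have hD : ∀ (X : Fin N → M) z,
      ‖discAvg k (fun _ => 1) X v z - contAvg μ k (fun _ => 1) v z‖ ≤ 2 * U := fun X z =>
    norm_discAvg_sub_contAvg_le hk.nonneg hq hq hvU X z
  set a : ℝ := t / (2 * U) with ha
  have ha0 : 0 < a := by positivity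
  have hta : t = 2 * U * a := by rw [ha]; field_simp
  set s : ℝ := a * N * c / (64 * B) with hs
  have hs0 : 0 ≤ s := by positivity
  have hexpo : N * c / (1024 * B * U ^ 2) * t ^ 2 = a ^ 2 * N * c / (256 * B) := by
    rw [hta]; field_simp; norm_num
  rcases lt_or_ge (2 * U) t with htU | htU
  · -- The error never exceeds `2 * U`.
    refine le_of_eq_of_le ?_ zero_le
    rw [← measure_empty (μ := Measure.pi fun _ : Fin N => μ)]
    congr 1
    refine eq_empty_of_forall_notMem fun X hX => ?_
    exact absurd (lt_of_lt_of_le hX (discAvgReal_iterate_le_const hk.nonneg hq (by positivity)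
      (fun l => hD X _) (hD X _) i)) htU.not_gt
  have ha1 : a ≤ 1 := by rw [ha, div_le_one (by positivity)]; exact htU
  rcases lt_or_ge (s * a / 2) 1 with hsmall | hlarge
  · -- In this range the right-hand side exceeds `1`.
    refine prob_le_one.trans ?_
    rw [← ENNReal.ofReal_one]
    refine ENNReal.ofReal_le_ofReal ?_
    have h1 : -1 ≤ -(N * c / (1024 * B * U ^ 2) * t ^ 2) := by
      rw [hexpo]
      have : s * a / 2 = 2 * (a ^ 2 * N * c / (256 * B)) := by rw [hs]; field_simp; norm_num
      linarith
    have h2 : 1 / 8 ≤ Real.exp (-(N * c / (1024 * B * U ^ 2) * t ^ 2)) := by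
      calc (1 : ℝ) / 8 ≤ Real.exp (-1) := by
            rw [Real.exp_neg, one_div]
            exact inv_anti₀ (Real.exp_pos _) (by linarith [Real.exp_one_lt_d9])
        _ ≤ _ := Real.exp_le_exp.2 h1
    have h3 : 1 ≤ Real.exp (2 * (i : ℝ) ^ 2 + 2 * i) := Real.one_le_exp (by positivity)
    calc (1 : ℝ) = 8 * 1 * (1 / 8) := by norm_num
      _ ≤ _ := by gcongr
  have hNB : B ≤ c * N := by
    have h1 : s * a / 2 = a ^ 2 * (c * N) / (128 * B) := by rw [hs]; field_simp; norm_num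
    rw [h1, le_div_iff₀ (by positivity)] at hlarge
    have h2 : a ^ 2 * (c * N) ≤ 1 * (c * N) := by gcongr; exact pow_le_one₀ ha0.le ha1
    linarith
  set d : M → ℝ := fun y => ∫ z, k y z ∂μ with hd
  have hd0 : ∀ y, 0 < d y := fun y => hk.pos.trans_le (hk.degree_ge y)
  set W := pathWeight N k d with hW
  set F₁ : M → M → ℂ := fun y z =>
    ((k y z / (U * d y) : ℝ) : ℂ) * (v z - contAvg μ k (fun _ => 1) v y) with hF₁
  set F₂ : M → M → ℂ := fun y z => ((2 * (k y z / d y - 1) : ℝ) : ℂ) with hF₂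
  have hmd : Measurable fun q : M × M => d q.1 := hk.measurable_degree.comp measurable_fst
  have hF₁m : Measurable (uncurry F₁) :=
    (Complex.measurable_ofReal.comp (hk.measurable.div (hmd.const_mul _))).mul
      ((hv.comp measurable_snd).sub
        ((measurable_contAvg hk.measurable measurable_const hv).comp measurable_fst))
  have hF₂m : Measurable (uncurry F₂) :=
    Complex.measurable_ofReal.comp (((hk.measurable.div hmd).sub_const 1).const_mul 2)
  set G : (M → M → ℂ) → (Fin N → M) → M → ℝ≥0∞ := fun F X z =>
    ENNReal.ofReal (Real.exp (s * ‖(N : ℂ)⁻¹ * ∑ l, F z (X l)‖)) with hG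
  have hsb : 2 * s * (2 * B / c) ≤ N := by
    have : 2 * s * (2 * B / c) = a * N / 16 := by rw [hs]; field_simp; norm_num
    rw [this]
    have : a * N ≤ 1 * N := by gcongr
    linarith
  have hE₁ := fun j => lintegral_pathOp_exp_le (measurable_pathWeight hk)
    (lintegral_pathWeight_le hk hN) (pathWeight_le hk hNB) hN hF₁m
    (fun y => (value_fluctuation_bounds hk hv hU hvU y).2.1)
    (fun y => (value_fluctuation_bounds hk hv hU hvU y).1)
    (fun y => (value_fluctuation_bounds hk hv hU hvU y).2.2) hs0 hsb j x
  have hE₂ := fun j => lintegral_pathOp_exp_le (measurable_pathWeight hk)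
    (lintegral_pathWeight_le hk hN) (pathWeight_le hk hNB) hN hF₂m
    (norm_degree_fluctuation_le hk) (centered_degree hk)
    (integral_degree_fluctuation_sq_le hk) hs0 hsb j x
  set Z : (Fin N → M) → ℝ≥0∞ := fun X => (pathOp W X)^[i] (G F₁ X) x +
    ∑ j ∈ Finset.range (i + 1), (pathOp W X)^[j] (G F₂ X) x with hZ
  set Θ : ℝ≥0∞ := ENNReal.ofReal (Real.exp (-(s * a / 2))) with hΘ
  -- The event forces the path sum `Z` to be large.
  have hsub : {X : Fin N → M | t < (discAvgReal k (fun _ => 1) X)^[i]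
      (fun z => ‖discAvg k (fun _ => 1) X v z - contAvg μ k (fun _ => 1) v z‖) x}
      ⊆ {X | 1 ≤ Θ * Z X} := by
    intro X hX
    have hdom : ∀ (F : M → M → ℂ) y, a / 2 ≤ ‖(N : ℂ)⁻¹ * ∑ l, F y (X l)‖ →
        ENNReal.ofReal (2 * U * ‖(N : ℂ)⁻¹ * ∑ l, F y (X l)‖)
          ≤ ENNReal.ofReal (t / 2) * Θ * G F X y := by
      intro F y hy
      rw [hΘ, hG, ← ENNReal.ofReal_mul (by positivity), ← ENNReal.ofReal_mul (by positivity)]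
      refine ENNReal.ofReal_le_ofReal ?_
      have := le_half_mul_exp ha0 hlarge hy
      calc _ ≤ 2 * U * (a / 2 * (Real.exp (-(s * a / 2)) *
            Real.exp (s * ‖(N : ℂ)⁻¹ * ∑ l, F y (X l)‖))) := by gcongr
        _ = _ := by rw [hta]; ring
    have h2 : ∀ y, ∑ l, k y (X l) < N * d y / 2 →
        ENNReal.ofReal (2 * U) ≤ ENNReal.ofReal (t / 2) * Θ * G F₂ X y := by
      intro y hy
      have h := one_le_degree_fluctuation_of_bad hk hN hy
      refine le_trans (ENNReal.ofReal_le_ofReal ?_) (hdom F₂ y (by linarith))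
      exact le_mul_of_one_le_right (by positivity) h
    have h1 : ∀ y, ENNReal.ofReal ‖discAvg k (fun _ => 1) X v y - contAvg μ k (fun _ => 1) v y‖
        ≤ ENNReal.ofReal (t / 2) + ENNReal.ofReal (t / 2) * Θ * (G F₁ X y + G F₂ X y) := by
      intro y
      rw [mul_add]
      rcases lt_or_ge (∑ l, k y (X l)) (N * d y / 2) with hbad | hgood
      · rw [← add_assoc]
        exact (ENNReal.ofReal_le_ofReal (hD X y)).trans ((h2 y hbad).trans le_add_self)
      · have h := norm_discAvg_sub_contAvg_le_of_good (v := v) hk hN hU hgood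
        rcases lt_or_ge ‖(N : ℂ)⁻¹ * ∑ l, F₁ y (X l)‖ (a / 2) with hs | hl
        · refine le_trans (ENNReal.ofReal_le_ofReal (h.trans ?_)) le_self_add
          calc _ ≤ 2 * U * (a / 2) := by gcongr
            _ = t / 2 := by rw [hta]; ring
        · exact ((ENNReal.ofReal_le_ofReal h).trans (hdom F₁ y hl)).trans
            (le_self_add.trans le_add_self)
    have h := ofReal_discAvgReal_iterate_le hk.nonneg hd0 hN (fun z => norm_nonneg _) (hD X)
      h1 h2 i x
    have h3 : ENNReal.ofReal t ≤ ENNReal.ofReal (t / 2) + ENNReal.ofReal (t / 2) * (Θ * Z X) := by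
      rw [← mul_assoc]
      exact (ENNReal.ofReal_le_ofReal (le_of_lt hX)).trans h
    have h4 : ENNReal.ofReal t = ENNReal.ofReal (t / 2) + ENNReal.ofReal (t / 2) * 1 := by
      rw [mul_one, ← ENNReal.ofReal_add (by positivity) (by positivity), add_halves]
    rw [h4] at h3
    have h5 := (ENNReal.add_le_add_iff_left ENNReal.ofReal_ne_top).1 h3
    exact (ENNReal.mul_le_mul_iff_right (ENNReal.ofReal_pos.2 (by positivity)).ne'
      ENNReal.ofReal_ne_top).1 h5
  have hZm : Measurable Z :=
    (hE₁ i).1.add (Finset.measurable_fun_sum _ fun j _ => (hE₂ j).1)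
  set e₀ := 4 * s ^ 2 * (4 * B / c) / N with he₀
  calc _ ≤ Measure.pi (fun _ : Fin N => μ) {X | 1 ≤ Θ * Z X} := measure_mono hsub
    _ ≤ ∫⁻ X, Θ * Z X ∂(Measure.pi fun _ : Fin N => μ) := by
        simpa using mul_meas_ge_le_lintegral (μ := Measure.pi fun _ : Fin N => μ)
          (hZm.const_mul Θ) 1
    _ ≤ Θ * (((i : ℝ≥0∞) + 2) * ENNReal.ofReal (4 * Real.exp e₀ *
          ((2 * Real.exp 1) ^ i * i.factorial))) := by
        rw [lintegral_const_mul _ hZm]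
        refine mul_le_mul_right ?_ _
        rw [hZ, lintegral_add_left (hE₁ i).1, lintegral_finsetSum _ fun j _ => (hE₂ j).1]
        calc _ ≤ ENNReal.ofReal (4 * Real.exp e₀ * ((2 * Real.exp 1) ^ i * i.factorial)) +
              ∑ j ∈ Finset.range (i + 1),
                ENNReal.ofReal (4 * Real.exp e₀ * ((2 * Real.exp 1) ^ i * i.factorial)) := by
              refine add_le_add (hE₁ i).2 (Finset.sum_le_sum fun j hj => (hE₂ j).2.trans ?_)
              have hji : j ≤ i := Nat.lt_succ_iff.1 (Finset.mem_range.1 hj)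
              gcongr
              linarith [Real.add_one_le_exp 1]
          _ = _ := by
              rw [Finset.sum_const, Finset.card_range, nsmul_eq_mul]
              push_cast
              ring
    _ = ENNReal.ofReal (4 * ((i : ℝ) + 2) * ((2 * Real.exp 1) ^ i * i.factorial) *
          Real.exp (-(s * a / 2) + e₀)) := by
        have : ((i : ℝ≥0∞) + 2) = ENNReal.ofReal ((i : ℝ) + 2) := by
          rw [ENNReal.ofReal_add (by positivity) (by norm_num)]; simp
        rw [hΘ, this, ← ENNReal.ofReal_mul (by positivity), ← ENNReal.ofReal_mul (by positivity),
          Real.exp_add]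
        congr 1
        ring
    _ ≤ _ := by
        refine ENNReal.ofReal_le_ofReal ?_
        have : -(s * a / 2) + e₀ = -(N * c / (1024 * B * U ^ 2) * t ^ 2) := by
          rw [hexpo, he₀, hs]
          field_simp
          norm_num
        rw [this]
        exact mul_le_mul_of_nonneg_right (pathSum_const_le i) (Real.exp_pos _).le

end UnweightedTail

/-! ### Concentration for the weighted averages, uniformly over the samples -/

section Weighted

variable {M : Type*} {N : ℕ} [MeasurableSpace M] {μ : Measure M}
  {k : M → M → ℝ} {B c C : ℝ}

theorem abs_rpow_neg_sub_le {a b m l : ℝ} (hm : 0 < m) (ha : m ≤ a) (hb : m ≤ b) (hl : 0 ≤ l) :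
    |a ^ (-l) - b ^ (-l)| ≤ l * m ^ (-l - 1) * |a - b| := by
  refine Convex.norm_image_sub_le_of_norm_hasDerivWithin_le (f := fun x : ℝ => x ^ (-l))
    (f' := fun x => -l * x ^ (-l - 1)) (s := Ici m) (fun x hx => ?_) (fun x hx => ?_)
    (convex_Ici m) hb ha
  · exact (Real.hasDerivAt_rpow_const (Or.inl (hm.trans_le hx).ne')).hasDerivWithinAt
  · have hx0 := hm.trans_le hx
    rw [norm_mul, norm_neg, Real.norm_of_nonneg hl, Real.norm_of_nonneg (by positivity)]
    exact mul_le_mul_of_nonneg_left (Real.rpow_le_rpow_of_nonpos hm hx (by linarith)) hl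

/-- Chernoff bound for the empirical mean `N⁻¹ ∑ₗ F(z, xₗ)`, where `z` is a fixed point or one of the
samples: in the second case it depends on the sample twice, but its conditional law given this sample
is controlled by an integral over the other samples. -/
theorem measure_mean_gt_le [IsProbabilityMeasure μ] (hN : 0 < N) {F : M → M → ℂ}
    (hF : Measurable (uncurry F)) (hB : 0 < B) (hC : 0 < C) (hb : ∀ y z, ‖F y z‖ ≤ B)
    (h0 : ∀ y, ∫ z, F y z ∂μ = 0) (hV : ∀ y, ∫ z, ‖F y z‖ ^ 2 ∂μ ≤ B * C) {η : ℝ} (hη : 0 ≤ η)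
    (hηC : η ≤ 4 * C) {z : (Fin N → M) → M} (hz : (∃ x, z = fun _ => x) ∨ ∃ j, z = fun X => X j) :
    Measure.pi (fun _ : Fin N => μ) {X | η < ‖(N : ℂ)⁻¹ * ∑ l, F (z X) (X l)‖}
    ≤ ENNReal.ofReal (4 * Real.exp 1 * Real.exp (-(N / (16 * B * C) * η ^ 2))) := by
  have hne : Nonempty M := nonempty_of_isProbabilityMeasure μ
  have hN' : (0 : ℝ) < N := Nat.cast_pos.2 hN
  set s : ℝ := N * η / (8 * B * C) with hs
  have hs0 : 0 ≤ s := by positivity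
  have hsb : 2 * s * B ≤ N := by
    have : 2 * s * B = N * (η / (4 * C)) := by rw [hs]; field_simp; ring
    rw [this]
    exact mul_le_of_le_one_right hN'.le ((div_le_one (by positivity)).2 hηC)
  obtain ⟨G, hG⟩ : ∃ G : M → (Fin N → M) → ℝ≥0∞, G = fun z X =>
    ENNReal.ofReal (Real.exp (s * ‖(N : ℂ)⁻¹ * ∑ l, F z (X l)‖)) := ⟨_, rfl⟩
  have hGm : Measurable (uncurry G) := by
    have : Measurable fun q : M × (Fin N → M) => ∑ l, F q.1 (q.2 l) :=
      Finset.measurable_fun_sum _ fun l _ =>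
        hF.comp (measurable_fst.prodMk ((measurable_pi_apply l).comp measurable_snd))
    rw [hG]
    exact (((this.const_mul _).norm.const_mul _).exp).ennreal_ofReal
  set R : ℝ≥0∞ := ENNReal.ofReal (4 * Real.exp (4 * s ^ 2 * (B * C) / N + 1)) with hR
  have hmarg : ∀ y (t : Finset (Fin N)) X, tᶜ.card ≤ 1 → (∫⋯∫⁻_t, G y ∂fun _ => μ) X ≤ R := by
    intro y t X ht
    rw [hG]
    refine (lmarginal_exp_norm_mean_le (hF.comp measurable_prodMk_left) (hb y) (h0 y) (hV y) hN
      hs0 hsb t X).trans (ENNReal.ofReal_le_ofReal ?_)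
    have : (tᶜ.card : ℝ) ≤ 1 := by exact_mod_cast ht
    gcongr
  obtain ⟨hzm, hzR⟩ : Measurable (fun X => G (z X) X) ∧
      ∫⁻ X, G (z X) X ∂(Measure.pi fun _ : Fin N => μ) ≤ R := by
    rcases hz with ⟨x, rfl⟩ | ⟨j, rfl⟩
    · refine ⟨hGm.comp measurable_prodMk_left, ?_⟩
      rw [lintegral_eq_lmarginal_univ (fun _ => x)]
      exact hmarg x _ _ (by simp)
    · have hGj : Measurable fun X : Fin N → M => G (X j) X :=
        hGm.comp (show Measurable fun X : Fin N → M => (X j, X) from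
          (measurable_pi_apply j).prodMk measurable_id)
      refine ⟨hGj, ?_⟩
      rw [lintegral_eq_lmarginal_univ (fun _ => hne.some), lmarginal_erase _ hGj (Finset.mem_univ j)]
      calc _ ≤ ∫⁻ _, R ∂μ := by
            refine lintegral_mono fun z => ?_
            rw [lmarginal_comp_frozen (Finset.notMem_erase j _) G]
            refine hmarg _ _ _ ?_
            rw [Finset.compl_erase, Finset.compl_univ]
            simp
        _ = R := by simp
  calc Measure.pi (fun _ : Fin N => μ) {X | η < ‖(N : ℂ)⁻¹ * ∑ l, F (z X) (X l)‖}
      ≤ Measure.pi (fun _ : Fin N => μ) {X | ENNReal.ofReal (Real.exp (s * η)) ≤ G (z X) X} := by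
        rw [hG]
        refine measure_mono fun X hX => ENNReal.ofReal_le_ofReal (Real.exp_le_exp.2 ?_)
        exact mul_le_mul_of_nonneg_left (le_of_lt hX) hs0
    _ ≤ (∫⁻ X, G (z X) X ∂(Measure.pi fun _ : Fin N => μ)) / ENNReal.ofReal (Real.exp (s * η)) :=
        meas_ge_le_lintegral_div hzm.aemeasurable
          (ENNReal.ofReal_pos.2 (Real.exp_pos _)).ne' ENNReal.ofReal_ne_top
    _ ≤ R / ENNReal.ofReal (Real.exp (s * η)) := by gcongr
    _ = _ := by
        rw [hR, ← ENNReal.ofReal_div_of_pos (Real.exp_pos _), mul_div_assoc, ← Real.exp_sub,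
          mul_assoc 4 (Real.exp 1), ← Real.exp_add]
        congr 3
        rw [hs]
        field_simp
        ring

/-- Union bound over the base point and the samples. -/
theorem measure_exists_mean_gt_le [IsProbabilityMeasure μ] (hN : 0 < N) {F : M → M → ℂ}
    (hF : Measurable (uncurry F)) (hB : 0 < B) (hC : 0 < C) (hb : ∀ y z, ‖F y z‖ ≤ B)
    (h0 : ∀ y, ∫ z, F y z ∂μ = 0) (hV : ∀ y, ∫ z, ‖F y z‖ ^ 2 ∂μ ≤ B * C) (x : M) {η : ℝ}
    (hη : 0 ≤ η) (hηC : η ≤ 4 * C) :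
    Measure.pi (fun _ : Fin N => μ) ({X | η < ‖(N : ℂ)⁻¹ * ∑ l, F x (X l)‖} ∪
      ⋃ j, {X | η < ‖(N : ℂ)⁻¹ * ∑ l, F (X j) (X l)‖})
    ≤ ENNReal.ofReal (4 * Real.exp 1 * (N + 1) * Real.exp (-(N / (16 * B * C) * η ^ 2))) := by
  have h := fun z hz => measure_mean_gt_le hN hF hB hC hb h0 hV hη hηC (z := z) hz
  set Q := 4 * Real.exp 1 * Real.exp (-(N / (16 * B * C) * η ^ 2)) with hQ
  calc _ ≤ ENNReal.ofReal Q + ∑ _j : Fin N, ENNReal.ofReal Q :=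
        (measure_union_le _ _).trans (add_le_add (h _ (Or.inl ⟨x, rfl⟩))
          ((measure_iUnion_fintype_le _ _).trans
            (Finset.sum_le_sum fun j _ => h _ (Or.inr ⟨j, rfl⟩))))
    _ = _ := by
        rw [Finset.sum_const, Finset.card_univ, Fintype.card_fin, nsmul_eq_mul,
          ← ENNReal.ofReal_natCast, ← ENNReal.ofReal_mul (by positivity),
          ← ENNReal.ofReal_add (by positivity) (by positivity)]
        congr 1
        ring

/-- The constant in `norm_weighted_error_le`: the ratio of the error of the weighted averages to
the errors of the empirical means, in terms of the bounds `c` and `C` on the degree. -/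
noncomputable def errorConst (c C l : ℝ) : ℝ :=
  2 * (l * (c / 2) ^ (-l - 1)) * (2 * C) ^ l + 4 / c * (c ^ (-l) * (2 * C) ^ l)

theorem four_div_le_errorConst (hc : 0 < c) (hcC : c ≤ C) {l : ℝ} (hl : 0 ≤ l) :
    4 / c ≤ errorConst c C l := by
  have hC := hc.trans_le hcC
  have h1 : 1 ≤ c ^ (-l) * (2 * C) ^ l := by
    rw [Real.rpow_neg hc.le, ← div_eq_inv_mul, one_le_div (by positivity)]
    exact Real.rpow_le_rpow hc.le (by linarith) hl
  have h2 : 4 / c * 1 ≤ 4 / c * (c ^ (-l) * (2 * C) ^ l) := by gcongr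
  have h3 : 0 ≤ 2 * (l * (c / 2) ^ (-l - 1)) * (2 * C) ^ l := by positivity
  rw [errorConst]
  linarith

omit [MeasurableSpace M] in
/-- If the empirical degrees at `y` and at the samples, and the centred empirical mean at `y`, are
accurate up to `η`, then so is the weighted average, up to the factor `errorConst c C l * U`. -/
theorem norm_weighted_error_le (hk : ∀ y z, 0 ≤ k y z) (hN : 0 < N) (hc : 0 < c)
    (hcC : c ≤ C) {d : M → ℝ} (hcd : ∀ y, c ≤ d y) (hdC : ∀ y, d y ≤ C) {l : ℝ} (hl : 0 ≤ l)
    {v : M → ℂ} {a : ℂ} {U : ℝ} (hU : 0 < U) (hva : ∀ z, ‖v z - a‖ ≤ 2 * U) {X : Fin N → M} {y : M}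
    {dN : M → ℝ} (hdN : ∀ z, dN z = (N : ℝ)⁻¹ * ∑ j, k z (X j)) {η : ℝ} (hη : η ≤ c / 2)
    (hy : |dN y - d y| ≤ η) (hX : ∀ j, |dN (X j) - d (X j)| ≤ η)
    (hmean : ‖(N : ℂ)⁻¹ * ∑ j, ((k y (X j) * d (X j) ^ (-l) / (2 * U * c ^ (-l)) : ℝ) : ℂ) *
      (v (X j) - a)‖ ≤ η) :
    ‖discAvg k (fun z => dN z ^ (-l)) X v y - a‖ ≤ errorConst c C l * U * η := by
  have hN' : (0 : ℝ) < N := Nat.cast_pos.2 hN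
  have hη0 : 0 ≤ η := (abs_nonneg _).trans hy
  have hC := hc.trans_le hcC
  have hdNX : ∀ j, c / 2 ≤ dN (X j) ∧ dN (X j) ≤ 2 * C := fun j => by
    have h1 := abs_le.1 (hX j)
    have h2 := hcd (X j)
    have h3 := hdC (X j)
    constructor <;> linarith
  have hdNy : c / 2 ≤ dN y := by
    have h1 := abs_le.1 hy
    have h2 := hcd y
    linarith
  have hsum : ∑ j, k y (X j) = N * dN y := by rw [hdN]; field_simp
  have hsum0 : 0 < N * dN y := mul_pos hN' (by linarith)
  set S := ∑ j, k y (X j) * dN (X j) ^ (-l) with hS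
  have hSge : (2 * C) ^ (-l) * (N * dN y) ≤ S := by
    rw [← hsum, Finset.mul_sum, hS]
    refine Finset.sum_le_sum fun j _ => ?_
    rw [mul_comm]
    refine mul_le_mul_of_nonneg_left ?_ (hk _ _)
    exact Real.rpow_le_rpow_of_nonpos (by linarith [hdNX j]) (hdNX j).2 (by linarith)
  have hP : 0 < (2 * C) ^ (-l) := by positivity
  have hS0 : 0 < S := lt_of_lt_of_le (by positivity) hSge
  have hSinv : S⁻¹ ≤ (2 * C) ^ l * (N * dN y)⁻¹ := by
    calc S⁻¹ ≤ ((2 * C) ^ (-l) * (N * dN y))⁻¹ := by gcongr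
      _ = _ := by rw [mul_inv, ← Real.rpow_neg (by positivity), neg_neg]
  have hlip : ∀ j, |dN (X j) ^ (-l) - d (X j) ^ (-l)| ≤ l * (c / 2) ^ (-l - 1) * η := fun j =>
    (abs_rpow_neg_sub_le (by positivity) (hdNX j).1 (by linarith [hcd (X j)]) hl).trans
      (by gcongr; exact hX j)
  rw [discAvg_sub_const hS0.ne', norm_mul, Complex.norm_real, Real.norm_of_nonneg (by positivity)]
  have hsplit : ∑ j, ((k y (X j) * dN (X j) ^ (-l) : ℝ) : ℂ) * (v (X j) - a)
      = ∑ j, ((k y (X j) * (dN (X j) ^ (-l) - d (X j) ^ (-l)) : ℝ) : ℂ) * (v (X j) - a)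
      + ((N * (2 * U * c ^ (-l)) : ℝ) : ℂ) * ((N : ℂ)⁻¹ *
        ∑ j, ((k y (X j) * d (X j) ^ (-l) / (2 * U * c ^ (-l)) : ℝ) : ℂ) * (v (X j) - a)) := by
    rw [Finset.mul_sum, Finset.mul_sum, ← Finset.sum_add_distrib]
    refine Finset.sum_congr rfl fun j _ => ?_
    have h1 : ((N * (2 * U * c ^ (-l)) : ℝ) : ℂ) * ((N : ℂ)⁻¹ *
        (((k y (X j) * d (X j) ^ (-l) / (2 * U * c ^ (-l)) : ℝ) : ℂ) * (v (X j) - a)))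
        = ((k y (X j) * d (X j) ^ (-l) : ℝ) : ℂ) * (v (X j) - a) := by
      rw [← mul_assoc, ← mul_assoc, ← Complex.ofReal_natCast, ← Complex.ofReal_inv,
        ← Complex.ofReal_mul, ← Complex.ofReal_mul]
      congr 2
      have : c ^ (-l) ≠ 0 := by positivity
      field_simp
    rw [h1]
    push_cast
    ring
  have h1 : ‖∑ j, ((k y (X j) * (dN (X j) ^ (-l) - d (X j) ^ (-l)) : ℝ) : ℂ) * (v (X j) - a)‖
      ≤ N * dN y * (l * (c / 2) ^ (-l - 1) * η * (2 * U)) := by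
    rw [← hsum, Finset.sum_mul]
    refine norm_sum_le_of_le _ fun j _ => ?_
    rw [norm_mul, Complex.norm_real, norm_mul, Real.norm_of_nonneg (hk _ _), Real.norm_eq_abs,
      mul_assoc]
    exact mul_le_mul_of_nonneg_left (mul_le_mul (hlip j) (hva _) (norm_nonneg _) (by positivity))
      (hk _ _)
  have h2 : ‖((N * (2 * U * c ^ (-l)) : ℝ) : ℂ) * ((N : ℂ)⁻¹ *
      ∑ j, ((k y (X j) * d (X j) ^ (-l) / (2 * U * c ^ (-l)) : ℝ) : ℂ) * (v (X j) - a))‖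
      ≤ N * (2 * U * c ^ (-l)) * η := by
    rw [norm_mul, Complex.norm_real, Real.norm_of_nonneg (by positivity)]
    gcongr
  have hdy : 0 < dN y := by linarith
  rw [hsplit]
  calc _ ≤ S⁻¹ * (N * dN y * (l * (c / 2) ^ (-l - 1) * η * (2 * U)) +
        N * (2 * U * c ^ (-l)) * η) := by
        gcongr
        exact (norm_add_le _ _).trans (add_le_add h1 h2)
    _ ≤ (2 * C) ^ l * (N * dN y)⁻¹ * (N * dN y * (l * (c / 2) ^ (-l - 1) * η * (2 * U)) +
        N * (2 * U * c ^ (-l)) * η) := by gcongr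
    _ = (2 * C) ^ l * (l * (c / 2) ^ (-l - 1) * η * (2 * U)) +
        (2 * C) ^ l * (2 * U * c ^ (-l)) * η * (dN y)⁻¹ := by field_simp
    _ ≤ (2 * C) ^ l * (l * (c / 2) ^ (-l - 1) * η * (2 * U)) +
        (2 * C) ^ l * (2 * U * c ^ (-l)) * η * (c / 2)⁻¹ := by gcongr
    _ = _ := by rw [errorConst]; field_simp; ring

variable [IsProbabilityMeasure μ]

section Fluctuations

variable (hk : IsBoundedKernel μ k B c)
include hk

theorem integrable_kernel_sq (y : M) : Integrable (fun z => k y z ^ 2) μ :=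
  Integrable.of_bound ((hk.measurable_right y).pow_const 2).aestronglyMeasurable (B ^ 2)
    (ae_of_all _ fun z => by
      rw [Real.norm_of_nonneg (sq_nonneg _)]
      exact pow_le_pow_left₀ (hk.nonneg y z) (hk.le y z) 2)

theorem kernel_fluctuation_bounds (hC : ∀ y, ∫ z, k y z ∂μ ≤ C) (y : M) :
    ∫ z, ((k y z - ∫ z', k y z' ∂μ : ℝ) : ℂ) ∂μ = 0 ∧
    (∀ z, ‖((k y z - ∫ z', k y z' ∂μ : ℝ) : ℂ)‖ ≤ B) ∧
    ∫ z, ‖((k y z - ∫ z', k y z' ∂μ : ℝ) : ℂ)‖ ^ 2 ∂μ ≤ B * C := by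
  have hd0 := hk.pos.trans_le (hk.degree_ge y)
  have hdB := hk.degree_le y
  have hB := hd0.trans_le hdB
  have hdC := hC y
  have hsq := hk.integral_sq_le y
  set d := ∫ z', k y z' ∂μ with hd
  refine ⟨?_, fun z => ?_, ?_⟩
  · rw [integral_complex_ofReal, integral_sub (hk.integrable y) (integrable_const _)]
    simp [hd]
  · rw [Complex.norm_real, Real.norm_eq_abs, abs_le]
    have h1 := hk.nonneg y z
    have h2 := hk.le y z
    constructor <;> linarith
  · have hpt : ∀ z, ‖((k y z - d : ℝ) : ℂ)‖ ^ 2 = k y z ^ 2 - (2 * d * k y z - d ^ 2) := fun z => by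
      rw [Complex.norm_real, Real.norm_eq_abs, sq_abs]
      ring
    simp only [hpt]
    have hi3 : Integrable (fun z => 2 * d * k y z - d ^ 2) μ :=
      ((hk.integrable y).const_mul _).sub (integrable_const _)
    rw [integral_sub (integrable_kernel_sq hk y) hi3, integral_sub ((hk.integrable y).const_mul _)
      (integrable_const _), integral_const_mul]
    simp only [integral_const, probReal_univ, one_smul]
    rw [← hd]
    have h1 : B * d ≤ B * C := by gcongr
    linarith [sq_nonneg d]

/-- The summand of the numerator of `discAvg v y - contAvg v y` with the continuum weights `q`,
normalized so that it is bounded by the kernel. -/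
theorem weighted_fluctuation_bounds (hC : ∀ y, ∫ z, k y z ∂μ ≤ C) {l : ℝ} (hl : 0 ≤ l)
    {v : M → ℂ} (hv : Measurable v) {U : ℝ} (hU : 0 < U) (hvU : ∀ z, ‖v z‖ ≤ U) {q : M → ℝ}
    (hqd : q = fun z => (∫ z', k z z' ∂μ) ^ (-l)) (y : M) :
    ∫ z, ((k y z * q z / (2 * U * c ^ (-l)) : ℝ) : ℂ) * (v z - contAvg μ k q v y) ∂μ = 0 ∧
    (∀ z, ‖((k y z * q z / (2 * U * c ^ (-l)) : ℝ) : ℂ) * (v z - contAvg μ k q v y)‖ ≤ B) ∧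
    ∫ z, ‖((k y z * q z / (2 * U * c ^ (-l)) : ℝ) : ℂ) * (v z - contAvg μ k q v y)‖ ^ 2 ∂μ
      ≤ B * C := by
  have hc := hk.pos
  have hd0 : ∀ y, 0 < ∫ z, k y z ∂μ := fun y => hc.trans_le (hk.degree_ge y)
  have hB := (hd0 y).trans_le (hk.degree_le y)
  have hC0 := (hd0 y).trans_le (hC y)
  have hq : ∀ z, 0 ≤ q z := fun z => by rw [hqd]; exact Real.rpow_nonneg (hd0 z).le _
  have hqc : ∀ z, q z ≤ c ^ (-l) := fun z => by
    rw [hqd]; exact Real.rpow_le_rpow_of_nonpos hc (hk.degree_ge z) (by linarith)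
  have hqC : ∀ z, C ^ (-l) ≤ q z := fun z => by
    rw [hqd]; exact Real.rpow_le_rpow_of_nonpos (hd0 z) (hC z) (by linarith)
  have hqm : Measurable q := by rw [hqd]; exact hk.measurable_degree.pow_const _
  have hcl : 0 < c ^ (-l) := by positivity
  have hiq : Integrable (fun z => k y z * q z) μ :=
    (hk.integrable y).mul_bdd (c := c ^ (-l)) hqm.aestronglyMeasurable
      (ae_of_all _ fun z => by rw [Real.norm_of_nonneg (hq z)]; exact hqc z)
  have hne : ∫ z, k y z * q z ∂μ ≠ 0 := by
    have h1 : C ^ (-l) * ∫ z, k y z ∂μ ≤ ∫ z, k y z * q z ∂μ := by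
      rw [← integral_const_mul]
      refine integral_mono ((hk.integrable y).const_mul _) hiq fun z => ?_
      beta_reduce
      rw [mul_comm]
      exact mul_le_mul_of_nonneg_left (hqC z) (hk.nonneg y z)
    have h2 := hd0 y
    exact (lt_of_lt_of_le (by positivity) h1).ne'
  have hcenter := integral_mul_sub_contAvg hiq
    (hiq.ofReal.mul_bdd (c := U) hv.aestronglyMeasurable (ae_of_all _ hvU)) hne
  have haU := norm_contAvg_le_const (μ := μ) hk.nonneg hq hvU y
  set a := contAvg μ k q v y with ha
  have hle : ∀ z, ‖((k y z * q z / (2 * U * c ^ (-l)) : ℝ) : ℂ) * (v z - a)‖ ≤ k y z := fun z => by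
    have h0 := hk.nonneg y z
    have h1 := hq z
    have hva : ‖v z - a‖ ≤ 2 * U := by linarith [norm_sub_le (v z) a, hvU z]
    have h2 : k y z * q z ≤ k y z * c ^ (-l) := mul_le_mul_of_nonneg_left (hqc z) h0
    rw [norm_mul, Complex.norm_real, Real.norm_of_nonneg (by positivity)]
    calc _ ≤ k y z * c ^ (-l) / (2 * U * c ^ (-l)) * (2 * U) :=
          mul_le_mul (div_le_div_of_nonneg_right h2 (by positivity)) hva (norm_nonneg _)
            (by positivity)
      _ = k y z := by field_simp
  refine ⟨?_, fun z => (hle z).trans (hk.le y z), ?_⟩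
  · have h1 : ∀ z, ((k y z * q z / (2 * U * c ^ (-l)) : ℝ) : ℂ) * (v z - a)
        = (((2 * U * c ^ (-l))⁻¹ : ℝ) : ℂ) * (((k y z * q z : ℝ) : ℂ) * (v z - a)) := fun z => by
      rw [← mul_assoc, ← Complex.ofReal_mul, div_eq_inv_mul]
    simp only [h1]
    rw [integral_const_mul, hcenter, mul_zero]
  · calc _ ≤ ∫ z, k y z ^ 2 ∂μ :=
          integral_mono_of_nonneg (ae_of_all _ fun z => sq_nonneg _) (integrable_kernel_sq hk y)
            (ae_of_all _ fun z => pow_le_pow_left₀ (norm_nonneg _) (hle z) 2)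
      _ ≤ B * ∫ z, k y z ∂μ := hk.integral_sq_le y
      _ ≤ B * C := by gcongr; exact hC y

end Fluctuations

theorem inv_mul_sum_sub_const (hN : 0 < N) (f : Fin N → ℝ) (r : ℝ) :
    ‖(N : ℂ)⁻¹ * ∑ j, ((f j - r : ℝ) : ℂ)‖ = |(N : ℝ)⁻¹ * ∑ j, f j - r| := by
  have hN' : (N : ℝ) ≠ 0 := Nat.cast_ne_zero.2 hN.ne'
  have : (N : ℂ)⁻¹ * ∑ j, ((f j - r : ℝ) : ℂ) = (((N : ℝ)⁻¹ * ∑ j, f j - r : ℝ) : ℂ) := by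
    rw [← Complex.ofReal_sum, ← Complex.ofReal_natCast, ← Complex.ofReal_inv,
      ← Complex.ofReal_mul]
    congr 1
    rw [Finset.sum_sub_distrib, Finset.sum_const, Finset.card_univ, Fintype.card_fin,
      nsmul_eq_mul]
    field_simp
  rw [this, Complex.norm_real, Real.norm_eq_abs]

/-- Tail bound for the error of the weighted averages, averaged along the random walk of `i` steps on
the samples. The weights depend on the empirical degrees at all the samples, so that these have to be
accurate simultaneously; the factor `exp (2 * i ^ 2 + 2 * i)` only serves to match
`measure_unweighted_gt_le`. -/
theorem measure_weighted_gt_le (hk : IsBoundedKernel μ k B c) (hN : 0 < N)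
    (hC : ∀ y, ∫ z, k y z ∂μ ≤ C) {l : ℝ} (hl : 0 ≤ l) {v : M → ℂ}
    (hv : Measurable v) {U : ℝ} (hU : 0 < U) (hvU : ∀ z, ‖v z‖ ≤ U) (x : M) (i : ℕ) {t : ℝ}
    (ht : 0 < t) :
    Measure.pi (fun _ : Fin N => μ) {X | t <
      (discAvgReal k (fun z => ((N : ℝ)⁻¹ * ∑ j, k z (X j)) ^ (-l)) X)^[i]
      (fun z => ‖discAvg k (fun z => ((N : ℝ)⁻¹ * ∑ j, k z (X j)) ^ (-l)) X v z
        - contAvg μ k (fun z => (∫ z', k z z' ∂μ) ^ (-l)) v z‖) x}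
    ≤ ENNReal.ofReal (8 * Real.exp 1 * (N + 1) * Real.exp (2 * i ^ 2 + 2 * i) *
        Real.exp (-(N / (16 * B * C * errorConst c C l ^ 2 * U ^ 2) * t ^ 2))) := by
  have hne : Nonempty M := ⟨x⟩
  have hB := hk.bound_pos
  have hc := hk.pos
  have hcC : c ≤ C := (hk.degree_ge x).trans (hC x)
  have hC0 : 0 < C := hc.trans_le hcC
  set d : M → ℝ := fun y => ∫ z, k y z ∂μ with hd
  have hd0 : ∀ y, 0 < d y := fun y => hc.trans_le (hk.degree_ge y)
  have hdm : Measurable d := hk.measurable_degree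
  have hq : ∀ z, 0 ≤ d z ^ (-l) := fun z => Real.rpow_nonneg (hd0 z).le _
  have hqN : ∀ (X : Fin N → M) z, 0 ≤ ((N : ℝ)⁻¹ * ∑ j, k z (X j)) ^ (-l) := fun X z =>
    Real.rpow_nonneg (mul_nonneg (by positivity) (Finset.sum_nonneg fun j _ => hk.nonneg _ _)) _
  set a := contAvg μ k (fun z => d z ^ (-l)) v with ha
  have hD : ∀ (X : Fin N → M) z,
      ‖discAvg k (fun z => ((N : ℝ)⁻¹ * ∑ j, k z (X j)) ^ (-l)) X v z - a z‖ ≤ 2 * U := fun X z =>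
    norm_discAvg_sub_contAvg_le hk.nonneg (hqN X) hq hvU X z
  set Γ := errorConst c C l with hΓ
  have hΓc : 4 / c ≤ Γ := four_div_le_errorConst hc hcC hl
  have hΓ0 : 0 < Γ := lt_of_lt_of_le (by positivity) hΓc
  rcases lt_or_ge (2 * U) t with htU | htU
  · -- The error never exceeds `2 * U`.
    refine le_of_eq_of_le ?_ zero_le
    rw [← measure_empty (μ := Measure.pi fun _ : Fin N => μ)]
    congr 1
    refine eq_empty_of_forall_notMem fun X hX => ?_
    exact absurd (lt_of_lt_of_le hX (discAvgReal_iterate_le_const hk.nonneg (hqN X) (by positivity)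
      (fun l => hD X _) (hD X _) i)) htU.not_gt
  set η := t / (Γ * U) with hη
  have hη0 : 0 < η := by positivity
  have hηc : η ≤ c / 2 := by
    rw [hη, div_le_iff₀ (by positivity)]
    have h1 : c / 2 * (4 / c * U) ≤ c / 2 * (Γ * U) := by gcongr
    have h2 : c / 2 * (4 / c * U) = 2 * U := by field_simp; norm_num
    linarith
  have htη : Γ * U * η = t := by rw [hη]; field_simp
  set F₁ : M → M → ℂ := fun y z =>
    ((k y z * d z ^ (-l) / (2 * U * c ^ (-l)) : ℝ) : ℂ) * (v z - a y) with hF₁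
  set F₂ : M → M → ℂ := fun y z => ((k y z - d y : ℝ) : ℂ) with hF₂
  have hF₁m : Measurable (uncurry F₁) :=
    (Complex.measurable_ofReal.comp ((hk.measurable.mul
      ((hdm.pow_const _).comp measurable_snd)).div_const _)).mul ((hv.comp measurable_snd).sub
      ((measurable_contAvg hk.measurable (hdm.pow_const _) hv).comp measurable_fst))
  have hF₂m : Measurable (uncurry F₂) :=
    Complex.measurable_ofReal.comp (hk.measurable.sub (hdm.comp measurable_fst))
  have hva : ∀ y z, ‖v z - a y‖ ≤ 2 * U := fun y z => by
    linarith [norm_sub_le (v z) (a y), hvU z,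
      norm_contAvg_le_const (μ := μ) (v := v) hk.nonneg hq hvU y]
  have hE₁ := measure_exists_mean_gt_le hN hF₁m hB hC0
    (fun y => (weighted_fluctuation_bounds hk hC hl hv hU hvU rfl y).2.1)
    (fun y => (weighted_fluctuation_bounds hk hC hl hv hU hvU rfl y).1)
    (fun y => (weighted_fluctuation_bounds hk hC hl hv hU hvU rfl y).2.2) x hη0.le (by linarith)
  have hE₂ := measure_exists_mean_gt_le hN hF₂m hB hC0
    (fun y => (kernel_fluctuation_bounds hk hC y).2.1)
    (fun y => (kernel_fluctuation_bounds hk hC y).1)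
    (fun y => (kernel_fluctuation_bounds hk hC y).2.2) x hη0.le (by linarith)
  set E₁ : Set (Fin N → M) := {X | η < ‖(N : ℂ)⁻¹ * ∑ j, F₁ x (X j)‖} ∪
    ⋃ m, {X | η < ‖(N : ℂ)⁻¹ * ∑ j, F₁ (X m) (X j)‖} with hE₁s
  set E₂ : Set (Fin N → M) := {X | η < ‖(N : ℂ)⁻¹ * ∑ j, F₂ x (X j)‖} ∪
    ⋃ m, {X | η < ‖(N : ℂ)⁻¹ * ∑ j, F₂ (X m) (X j)‖} with hE₂s
  have hsub : {X : Fin N → M | t <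
      (discAvgReal k (fun z => ((N : ℝ)⁻¹ * ∑ j, k z (X j)) ^ (-l)) X)^[i]
      (fun z => ‖discAvg k (fun z => ((N : ℝ)⁻¹ * ∑ j, k z (X j)) ^ (-l)) X v z - a z‖) x}
      ⊆ E₁ ∪ E₂ := by
    intro X hX
    by_contra hcon
    rw [hE₁s, hE₂s] at hcon
    simp only [mem_union, mem_iUnion, mem_ofPred_eq, not_or, not_exists, not_lt, hF₂,
      inv_mul_sum_sub_const hN] at hcon
    obtain ⟨⟨h1x, h1X⟩, h2x, h2X⟩ := hcon
    have key : ∀ y, |(N : ℝ)⁻¹ * ∑ j, k y (X j) - d y| ≤ η →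
        ‖(N : ℂ)⁻¹ * ∑ j, F₁ y (X j)‖ ≤ η →
        ‖discAvg k (fun z => ((N : ℝ)⁻¹ * ∑ j, k z (X j)) ^ (-l)) X v y - a y‖ ≤ t :=
      fun y hy1 hy2 => (norm_weighted_error_le hk.nonneg hN hc hcC hk.degree_ge hC hl hU (hva y)
        (fun _ => rfl) hηc hy1 h2X hy2).trans_eq htη
    exact absurd (lt_of_lt_of_le hX (discAvgReal_iterate_le_const hk.nonneg (hqN X) ht.le
      (fun j => key _ (h2X j) (h1X j)) (key _ h2x h1x) i)) (lt_irrefl _)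
  have hfin : ENNReal.ofReal (4 * Real.exp 1 * (N + 1) * Real.exp (-(N / (16 * B * C) * η ^ 2)))
      + ENNReal.ofReal (4 * Real.exp 1 * (N + 1) * Real.exp (-(N / (16 * B * C) * η ^ 2)))
      ≤ ENNReal.ofReal (8 * Real.exp 1 * (N + 1) * Real.exp (2 * i ^ 2 + 2 * i) *
        Real.exp (-(N / (16 * B * C * Γ ^ 2 * U ^ 2) * t ^ 2))) := by
    rw [← ENNReal.ofReal_add (by positivity) (by positivity)]
    refine ENNReal.ofReal_le_ofReal ?_
    have h1 : N / (16 * B * C) * η ^ 2 = N / (16 * B * C * Γ ^ 2 * U ^ 2) * t ^ 2 := by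
      rw [hη]; field_simp
    have h2 : 1 ≤ Real.exp (2 * (i : ℝ) ^ 2 + 2 * i) := Real.one_le_exp (by positivity)
    rw [h1]
    set E := Real.exp (-(N / (16 * B * C * Γ ^ 2 * U ^ 2) * t ^ 2))
    calc _ = 8 * Real.exp 1 * (N + 1) * 1 * E := by ring
      _ ≤ _ := by gcongr
  exact (measure_mono hsub).trans ((measure_union_le _ _).trans ((add_le_add hE₁ hE₂).trans hfin))

end Weighted

/-! ### The functional calculus of entire functions -/

section EntireCalc

variable {M : Type*}

/-- The binomial theorem for `(T + w) ^ m`. The linearity hypothesis on `T` concerns only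
combinations of the functions `T ^ j u`, since `T` need not be additive on nonmeasurable
functions. -/
theorem addScalarOp_iterate {T : (M → ℂ) → M → ℂ} {u : M → ℂ}
    (hT : ∀ (s : Finset (ℕ × ℕ)) (a : ℕ × ℕ → ℂ) (y : M),
      T (fun z => ∑ p ∈ s, a p * T^[p.1] u z) y = ∑ p ∈ s, a p * T^[p.1 + 1] u y)
    (w : ℂ) (m : ℕ) (y : M) :
    (addScalarOp T w)^[m] u y
      = ∑ p ∈ Finset.HasAntidiagonal.antidiagonal m, (m.choose p.1 : ℂ) * (w ^ p.2 * T^[p.1] u y) := by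
  induction m generalizing y with
  | zero => simp
  | succ m ih =>
    have ih' : (addScalarOp T w)^[m] u = fun z =>
        ∑ p ∈ Finset.HasAntidiagonal.antidiagonal m, (m.choose p.1 : ℂ) * w ^ p.2 * T^[p.1] u z := by
      funext z
      rw [ih z]
      exact Finset.sum_congr rfl fun p _ => (mul_assoc _ _ _).symm
    rw [iterate_succ_apply', addScalarOp, ih y, ih', hT,
      Finset.sum_antidiagonal_choose_succ_mul (fun i j => w ^ j * T^[i] u y) m, add_comm,
      Finset.mul_sum]
    congr 1
    · exact Finset.sum_congr rfl fun p _ => by ring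
    · refine Finset.sum_congr rfl fun p hp => ?_
      rw [Nat.choose_symm_of_eq_add (Finset.HasAntidiagonal.mem_antidiagonal.1 hp).symm]
      ring

theorem summable_norm_taylor_of_entire {f : ℂ → ℂ} (hf : Differentiable ℂ f) (r : ℝ) :
    Summable fun m : ℕ => ‖iteratedDeriv m f 0‖ / m.factorial * |r| ^ m := by
  have h := (Complex.hasSum_taylorSeries_of_entire hf 0 (r : ℂ)).summable.norm
  refine h.congr fun m => ?_
  simp only [sub_zero, smul_eq_mul, norm_mul, norm_inv, norm_pow, Complex.norm_natCast,
    Complex.norm_real, Real.norm_eq_abs]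
  ring

/-- Recentring the functional calculus: `f(T + w) = ∑ⱼ f⁽ʲ⁾(w) / j! Tʲ`, for a power-bounded `T`. -/
theorem hasSum_entireCalc_addScalarOp {f : ℂ → ℂ} (hf : Differentiable ℂ f)
    {T : (M → ℂ) → M → ℂ} {u : M → ℂ}
    (hT : ∀ (s : Finset (ℕ × ℕ)) (a : ℕ × ℕ → ℂ) (y : M),
      T (fun z => ∑ p ∈ s, a p * T^[p.1] u z) y = ∑ p ∈ s, a p * T^[p.1 + 1] u y)
    {U : ℝ} {x : M} (hU : ∀ j, ‖T^[j] u x‖ ≤ U) (w : ℂ) :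
    HasSum (fun j : ℕ => iteratedDeriv j f w / (j.factorial : ℂ) * T^[j] u x)
      (entireCalc f (addScalarOp T w) u x) := by
  set A : ℕ × ℕ → ℂ := fun p =>
    iteratedDeriv (p.1 + p.2) f 0 / (p.1.factorial * p.2.factorial) * w ^ p.2 * T^[p.1] u x with hA
  have hU0 : 0 ≤ U := (norm_nonneg _).trans (hU 0)
  have hfac : ∀ m : ℕ, ∀ p ∈ Finset.HasAntidiagonal.antidiagonal m,
      (m.factorial : ℝ) = m.choose p.1 * (p.1.factorial * p.2.factorial) := by
    intro m p hp
    have h1 : p.1 ≤ m := by have := Finset.HasAntidiagonal.mem_antidiagonal.1 hp; omega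
    have h2 : m - p.1 = p.2 := by have := Finset.HasAntidiagonal.mem_antidiagonal.1 hp; omega
    rw [← mul_assoc]
    exact_mod_cast h2 ▸ (Nat.choose_mul_factorial_mul_factorial h1).symm
  -- Summation along the antidiagonals gives the original series.
  have hfiber : ∀ m, ∑ p ∈ Finset.HasAntidiagonal.antidiagonal m, A p
      = iteratedDeriv m f 0 / (m.factorial : ℂ) * (addScalarOp T w)^[m] u x := by
    intro m
    rw [addScalarOp_iterate hT, Finset.mul_sum]
    refine Finset.sum_congr rfl fun p hp => ?_
    have h1 : (m.factorial : ℂ) = m.choose p.1 * (p.1.factorial * p.2.factorial) := by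
      exact_mod_cast hfac m p hp
    have h2 : (m.choose p.1 : ℂ) ≠ 0 := by
      exact_mod_cast (Nat.choose_pos (by
        have := Finset.HasAntidiagonal.mem_antidiagonal.1 hp; omega)).ne'
    have h3 : (p.1.factorial : ℂ) ≠ 0 := by exact_mod_cast p.1.factorial_ne_zero
    have h4 : (p.2.factorial : ℂ) ≠ 0 := by exact_mod_cast p.2.factorial_ne_zero
    rw [h1, hA]
    simp only [Finset.HasAntidiagonal.mem_antidiagonal.1 hp]
    field_simp
  have hnorm : ∀ m, ∑ p ∈ Finset.HasAntidiagonal.antidiagonal m, ‖A p‖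
      ≤ ‖iteratedDeriv m f 0‖ / m.factorial * |1 + ‖w‖| ^ m * U := by
    intro m
    rw [abs_of_nonneg (by positivity : 0 ≤ 1 + ‖w‖), Commute.add_pow' (Commute.all _ _),
      Finset.mul_sum, Finset.sum_mul]
    refine Finset.sum_le_sum fun p hp => ?_
    have h1 := hfac m p hp
    have h2 : (0 : ℝ) < m.choose p.1 := by
      exact_mod_cast (Nat.choose_pos (by
        have := Finset.HasAntidiagonal.mem_antidiagonal.1 hp; omega))
    rw [hA]
    simp only [Finset.HasAntidiagonal.mem_antidiagonal.1 hp, norm_mul, norm_div, norm_pow,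
      Complex.norm_natCast, one_pow, one_mul, nsmul_eq_mul]
    rw [h1]
    calc _ ≤ ‖iteratedDeriv m f 0‖ / (p.1.factorial * p.2.factorial) * ‖w‖ ^ p.2 * U := by
          gcongr; exact hU _
      _ = _ := by field_simp
  have hsumA : Summable A := by
    refine summable_norm_iff.1
      (Finset.HasAntidiagonal.sigmaAntidiagonalEquivProd.summable_iff.1
        ((summable_sigma_of_nonneg fun _ => norm_nonneg _).2 ⟨fun m => Summable.of_finite, ?_⟩))
    refine Summable.of_nonneg_of_le (fun m => tsum_nonneg fun _ => norm_nonneg _) (fun m => ?_)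
      ((summable_norm_taylor_of_entire hf (1 + ‖w‖)).mul_right U)
    rw [tsum_fintype]
    simp only [Finset.HasAntidiagonal.sigmaAntidiagonalEquivProd_apply]
    rw [Finset.sum_coe_sort (Finset.HasAntidiagonal.antidiagonal m) fun p => ‖A p‖]
    exact hnorm m
  have htot : ∑' p, A p = entireCalc f (addScalarOp T w) u x := by
    rw [← Finset.HasAntidiagonal.sigmaAntidiagonalEquivProd.tsum_eq, Summable.tsum_sigma'
      (f := fun c => A (Finset.HasAntidiagonal.sigmaAntidiagonalEquivProd c))
      (fun m => Summable.of_finite)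
      (Finset.HasAntidiagonal.sigmaAntidiagonalEquivProd.summable_iff.2 hsumA), entireCalc]
    refine tsum_congr fun m => ?_
    rw [tsum_fintype]
    simp only [Finset.HasAntidiagonal.sigmaAntidiagonalEquivProd_apply]
    rw [Finset.sum_coe_sort (Finset.HasAntidiagonal.antidiagonal m) A, hfiber]
  rw [← htot]
  refine hsumA.hasSum.prod_fiberwise fun j => ?_
  -- The inner sums are the Taylor series at `0` of the derivatives of `f`.
  have hd : Differentiable ℂ (iteratedDeriv j f) :=
    (hf.contDiff (n := ⊤)).differentiable_iteratedDeriv j (by simp)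
  have h := (Complex.hasSum_taylorSeries_of_entire hd 0 w).mul_left
    (((j.factorial : ℂ))⁻¹ * T^[j] u x)
  have e1 : ∀ l, iteratedDeriv l (iteratedDeriv j f) 0 = iteratedDeriv (j + l) f 0 := fun l => by
    rw [iteratedDeriv_eq_iterate, iteratedDeriv_eq_iterate, iteratedDeriv_eq_iterate,
      ← iterate_add_apply, add_comm]
  have e2 : (fun l => A (j, l)) = fun l => ((j.factorial : ℂ))⁻¹ * T^[j] u x *
      ((l.factorial : ℂ)⁻¹ • (w - 0) ^ l • iteratedDeriv l (iteratedDeriv j f) 0) := by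
    funext l
    rw [e1, hA]
    simp only [sub_zero, smul_eq_mul, div_eq_mul_inv, mul_inv]
    ring
  have e3 : iteratedDeriv j f w / (j.factorial : ℂ) * T^[j] u x
      = ((j.factorial : ℂ))⁻¹ * T^[j] u x * iteratedDeriv j f w := by
    rw [div_eq_mul_inv]; ring
  rw [e2, e3]
  exact h

/-- Errors of order `m ^ 2 * τ` in the powers of `T` cost only a constant, as
`∑ m ^ 2 / m! ≤ exp 2`. -/
theorem norm_entireCalc_sub_le {f : ℂ → ℂ} (hf : Differentiable ℂ f) {w : ℂ} {Kw : ℝ}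
    (hKw : ∀ m, ‖iteratedDeriv m f w‖ ≤ Kw) {T T' : (M → ℂ) → M → ℂ} {u : M → ℂ}
    (hT : ∀ (s : Finset (ℕ × ℕ)) (a : ℕ × ℕ → ℂ) (y : M),
      T (fun z => ∑ p ∈ s, a p * T^[p.1] u z) y = ∑ p ∈ s, a p * T^[p.1 + 1] u y)
    (hT' : ∀ (s : Finset (ℕ × ℕ)) (a : ℕ × ℕ → ℂ) (y : M),
      T' (fun z => ∑ p ∈ s, a p * T'^[p.1] u z) y = ∑ p ∈ s, a p * T'^[p.1 + 1] u y)
    {U : ℝ} {x : M} (hU : ∀ j, ‖T^[j] u x‖ ≤ U) (hU' : ∀ j, ‖T'^[j] u x‖ ≤ U) {τ : ℝ}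
    (hτ : 0 ≤ τ) (hdiff : ∀ m : ℕ, ‖T^[m] u x - T'^[m] u x‖ ≤ m * (m * τ)) :
    ‖entireCalc f (addScalarOp T w) u x - entireCalc f (addScalarOp T' w) u x‖
      ≤ Kw * τ * Real.exp 2 := by
  have hK0 : 0 ≤ Kw := (norm_nonneg _).trans (hKw 0)
  have h := (hasSum_entireCalc_addScalarOp hf hT hU w).sub
    (hasSum_entireCalc_addScalarOp hf hT' hU' w)
  have h1 := (hasSum_nat_add_iff' 1).2 h
  simp only [Finset.sum_range_one, iterate_zero, id_eq, sub_self, sub_zero] at h1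
  have h2 : HasSum (fun m : ℕ => Kw * τ * ((2 : ℝ) ^ m / m.factorial)) (Kw * τ * Real.exp 2) := by
    rw [Real.exp_eq_exp_ℝ]
    exact (NormedSpace.expSeries_div_hasSum_exp (2 : ℝ)).mul_left _
  refine h1.norm_le_of_bounded h2 fun m => ?_
  rw [← mul_sub, norm_mul, norm_div, Complex.norm_natCast]
  have h3 : ((m : ℝ) + 1) ≤ 2 ^ m := by exact_mod_cast Nat.lt_two_pow_self
  have hm := hdiff (m + 1)
  calc _ ≤ Kw / (m + 1).factorial * (((m + 1 : ℕ) : ℝ) * ((m + 1 : ℕ) * τ)) := by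
        gcongr
        exact hKw _
    _ = Kw * τ * ((m + 1) / m.factorial) := by
        rw [Nat.factorial_succ]
        push_cast
        field_simp
    _ ≤ _ := by gcongr

end EntireCalc

section Tail

variable {M : Type*} {N : ℕ} [MeasurableSpace M] {P : Measure (Fin N → M)}

/-- The growth of the tail bounds with the number `i` of steps is beaten by the growth of the
thresholds. -/
theorem tail_exponent_le {E : ℝ} (hE : 5 ≤ E) (i j : ℕ) :
    Real.exp (2 * (i : ℝ) ^ 2 + 2 * i) * Real.exp (-(E * ((i : ℝ) + j + 1) ^ 2))
      ≤ Real.exp (-E) * ((1 / 2) ^ i * (1 / 2) ^ j) := by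
  have he : Real.exp (-1) ≤ 1 / 2 := by
    rw [Real.exp_neg, one_div]
    exact inv_anti₀ two_pos (by linarith [Real.add_one_le_exp 1])
  have hi : (0 : ℝ) ≤ i := Nat.cast_nonneg i
  have hj : (0 : ℝ) ≤ j := Nat.cast_nonneg j
  calc _ = Real.exp (2 * (i : ℝ) ^ 2 + 2 * i - E * ((i : ℝ) + j + 1) ^ 2) := by
        rw [← Real.exp_add]; ring_nf
    _ ≤ Real.exp (-E + (i * (-1) + j * (-1))) := by
        refine Real.exp_le_exp.2 ?_
        have h1 : 5 * (((i : ℝ) + j + 1) ^ 2 - 1) ≤ E * (((i : ℝ) + j + 1) ^ 2 - 1) := by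
          gcongr
          nlinarith
        nlinarith [mul_nonneg hi hj]
    _ = Real.exp (-E) * (Real.exp (-1) ^ i * Real.exp (-1) ^ j) := by
        rw [Real.exp_add, Real.exp_add, Real.exp_nat_mul, Real.exp_nat_mul]
    _ ≤ _ := by gcongr

/-- From the tails of the one-step errors, averaged along the random walk, to those of the functional
calculus. The threshold in the union bound grows linearly with the order `m = i + j + 1` of the
term. -/
theorem measure_entireCalc_sub_gt_le {k : M → M → ℝ} (hk : ∀ y z, 0 ≤ k y z)
    {q : (Fin N → M) → M → ℝ} (hq : ∀ X z, 0 ≤ q X z) {T : (M → ℂ) → M → ℂ} {u : M → ℂ}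
    (hT : ∀ (s : Finset (ℕ × ℕ)) (a : ℕ × ℕ → ℂ) (y : M),
      T (fun z => ∑ p ∈ s, a p * T^[p.1] u z) y = ∑ p ∈ s, a p * T^[p.1 + 1] u y)
    {U : ℝ} (hU : ∀ j y, ‖T^[j] u y‖ ≤ U) {x : M} {A b : ℝ} (hA : 0 ≤ A)
    (H : ∀ (i j : ℕ) (t : ℝ), 0 < t → P {X | t < (discAvgReal k (q X) X)^[i]
      (fun z => ‖discAvg k (q X) X (T^[j] u) z - T (T^[j] u) z‖) x}
      ≤ ENNReal.ofReal (A * Real.exp (2 * i ^ 2 + 2 * i) * Real.exp (-(b * t ^ 2))))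
    {f : ℂ → ℂ} (hf : Differentiable ℂ f) {w : ℂ} {Kw : ℝ} (hKw0 : 0 < Kw)
    (hKw : ∀ m, ‖iteratedDeriv m f w‖ ≤ Kw) {δ : ℝ} (hδ : 0 < δ) {E : ℝ} (hE : 5 ≤ E)
    (hEb : E = b * (δ / (4 * Real.exp 1 * Kw)) ^ 2) :
    P {X | δ < ‖entireCalc f (addScalarOp (discAvg k (q X) X) w) u x
      - entireCalc f (addScalarOp T w) u x‖} ≤ ENNReal.ofReal (4 * A * Real.exp (-E)) := by
  set τ := δ / (4 * Real.exp 1 * Kw) with hτ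
  have hτ0 : 0 < τ := by positivity
  set B : ℕ × ℕ → Set (Fin N → M) := fun p =>
    {X | ((p.1 + p.2 + 1 : ℕ) : ℝ) * τ < (discAvgReal k (q X) X)^[p.1]
      (fun z => ‖discAvg k (q X) X (T^[p.2] u) z - T (T^[p.2] u) z‖) x} with hB
  have hsub : {X | δ < ‖entireCalc f (addScalarOp (discAvg k (q X) X) w) u x
      - entireCalc f (addScalarOp T w) u x‖} ⊆ ⋃ p, B p := by
    intro X hX
    by_contra hcon
    rw [mem_iUnion, not_exists] at hcon
    have hdiff : ∀ m : ℕ, ‖(discAvg k (q X) X)^[m] u x - T^[m] u x‖ ≤ m * (m * τ) := by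
      intro m
      refine (norm_discAvg_iterate_sub_le hk (hq X) T u m x).trans ?_
      calc _ ≤ ∑ _i ∈ Finset.range m, (m : ℝ) * τ := by
            refine Finset.sum_le_sum fun i hi => ?_
            have h1 : i + (m - 1 - i) + 1 = m := by have := Finset.mem_range.1 hi; omega
            have h2 := hcon (i, m - 1 - i)
            simp only [hB, mem_ofPred_eq, not_lt, h1] at h2
            exact h2
        _ = _ := by rw [Finset.sum_const, Finset.card_range, nsmul_eq_mul]
    have h := norm_entireCalc_sub_le (x := x) (w := w) hf hKw
      (T := discAvg k (q X) X) (T' := T) (u := u) (fun s a y => ?_) hT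
      (fun j => norm_discAvg_iterate_le hk (hq X) (hU 0) j x) (fun j => hU j x) hτ0.le hdiff
    · have h2 : Kw * τ * Real.exp 2 ≤ δ := by
        have e2 : Real.exp 2 = Real.exp 1 * Real.exp 1 := by rw [← Real.exp_add]; norm_num
        have : Kw * τ * Real.exp 2 = δ * (Real.exp 1 / 4) := by rw [e2, hτ]; field_simp
        rw [this]
        exact mul_le_of_le_one_right hδ.le (by linarith [Real.exp_one_lt_d9])
      exact absurd (lt_of_lt_of_le hX (h.trans h2)) (lt_irrefl _)
    · simp only [iterate_succ_apply']
      exact discAvg_sum s a _ y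
  have hBp : ∀ p, P (B p) ≤
      ENNReal.ofReal (A * Real.exp (-E)) * ((2 : ℝ≥0∞)⁻¹ ^ p.1 * (2 : ℝ≥0∞)⁻¹ ^ p.2) := by
    intro p
    have hhalf : (2 : ℝ≥0∞)⁻¹ = ENNReal.ofReal (1 / 2) := by
      rw [one_div, ENNReal.ofReal_inv_of_pos two_pos, ENNReal.ofReal_ofNat]
    refine (H p.1 p.2 _ (by positivity)).trans ?_
    rw [hhalf, ← ENNReal.ofReal_pow (by positivity), ← ENNReal.ofReal_pow (by positivity),
      ← ENNReal.ofReal_mul (by positivity), ← ENNReal.ofReal_mul (by positivity)]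
    refine ENNReal.ofReal_le_ofReal ?_
    have h1 : b * (((p.1 + p.2 + 1 : ℕ) : ℝ) * τ) ^ 2 = E * ((p.1 : ℝ) + p.2 + 1) ^ 2 := by
      rw [hEb]; push_cast; ring
    rw [h1, mul_assoc, mul_assoc]
    exact mul_le_mul_of_nonneg_left (tail_exponent_le hE p.1 p.2) hA
  calc _ ≤ P (⋃ p, B p) := measure_mono hsub
    _ ≤ ∑' p, P (B p) := measure_iUnion_le _
    _ ≤ ∑' p : ℕ × ℕ,
        ENNReal.ofReal (A * Real.exp (-E)) * ((2 : ℝ≥0∞)⁻¹ ^ p.1 * (2 : ℝ≥0∞)⁻¹ ^ p.2) :=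
        ENNReal.tsum_le_tsum hBp
    _ = ENNReal.ofReal (A * Real.exp (-E)) * 4 := by
        rw [ENNReal.tsum_mul_left, ENNReal.tsum_prod']
        simp only [ENNReal.tsum_mul_left, ENNReal.tsum_mul_right, ENNReal.tsum_geometric,
          ENNReal.one_sub_inv_two, inv_inv]
        norm_num
    _ = _ := by
        rw [mul_assoc 4 A, mul_comm 4 (A * _),
          ENNReal.ofReal_mul (by positivity : 0 ≤ A * Real.exp (-E)), ENNReal.ofReal_ofNat]

end Tail

/-! ### The renormalized averaging operators -/

section Identification

variable {M : Type*} {n D : ℕ} {ι : M → EuclideanSpace ℝ (Fin D)} {k : ℝ → ℝ} {lam ε : ℝ}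

/-- The factor `p_{ε,N}(x) ^ (-λ)` cancels; where `p_{ε,N}(x) = 0`, both sides vanish. -/
theorem avgOpN_eq_discAvg (hk : IsKernelFunction k) (hε : 0 < ε) {N : ℕ} (hN : 0 < N)
    (X : Fin N → M) : avgOpN n ι k lam ε X = discAvg (kernelEps n ι k ε)
      (fun z => ((N : ℝ)⁻¹ * ∑ j, kernelEps n ι k ε z (X j)) ^ (-lam)) X := by
  funext u x
  have hN' : (0 : ℝ) < N := Nat.cast_pos.2 hN
  have hk0 : ∀ y z, 0 ≤ kernelEps n ι k ε y z := fun y z => kernelEps_nonneg hk hε y z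
  set d : M → ℝ := fun z => (N : ℝ)⁻¹ * ∑ j, kernelEps n ι k ε z (X j) with hd
  have hdN : ∀ z, degreeEpsN n ι k ε X z = d z := fun _ => rfl
  have hd0 : ∀ z, 0 ≤ d z := fun z =>
    mul_nonneg (by positivity) (Finset.sum_nonneg fun j _ => hk0 _ _)
  rcases (hd0 x).eq_or_lt with h0 | h0
  · have h1 : ∑ j, kernelEps n ι k ε x (X j) = 0 := by
      simpa [hd, hN'.ne'] using h0.symm
    have h2 : ∀ j, kernelEps n ι k ε x (X j) = 0 := fun j =>
      (Finset.sum_eq_zero_iff_of_nonneg fun j _ => hk0 _ _).1 h1 j (Finset.mem_univ j)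
    simp [avgOpN, discAvg, kernelLamN, h2]
  · have h1 : ∀ j, kernelLamN n ι k lam ε X x (X j)
        = d x ^ (-lam) * (kernelEps n ι k ε x (X j) * d (X j) ^ (-lam)) := fun j => by
      rw [kernelLamN, hdN, hdN, Real.mul_rpow h0.le (hd0 _), Real.rpow_neg h0.le,
        Real.rpow_neg (hd0 _), div_eq_mul_inv, mul_inv]
      ring
    have h2 : (N : ℝ)⁻¹ * d x ^ (-lam) ≠ 0 := (mul_pos (by positivity)
      (Real.rpow_pos_of_pos h0 _)).ne'
    have e1 : degreeLamN n ι k lam ε X x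
        = (N : ℝ)⁻¹ * d x ^ (-lam) * ∑ j, kernelEps n ι k ε x (X j) * d (X j) ^ (-lam) := by
      simp only [degreeLamN, h1, ← Finset.mul_sum, mul_assoc]
    have e2 : (N : ℂ)⁻¹ * ∑ j, (kernelLamN n ι k lam ε X x (X j) : ℂ) * u (X j)
        = (((N : ℝ)⁻¹ * d x ^ (-lam) : ℝ) : ℂ) *
          ∑ j, ((kernelEps n ι k ε x (X j) * d (X j) ^ (-lam) : ℝ) : ℂ) * u (X j) := by
      simp only [h1, Complex.ofReal_mul (d x ^ (-lam)), mul_assoc (((d x ^ (-lam) : ℝ)) : ℂ),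
        ← Finset.mul_sum]
      push_cast
      ring
    rw [avgOpN, e1, e2, ← mul_assoc, ← Complex.ofReal_mul, mul_inv, mul_right_comm,
      inv_mul_cancel₀ h2, one_mul]
    rfl

theorem avgOp_eq_contAvg [MeasurableSpace M] {p : M → ℝ} (hp : Measurable p) (hp0 : ∀ x, 0 ≤ p x)
    (hd : ∀ y, 0 < ∫ z, kernelEps n ι k ε y z ∂(samplingLaw n ι p)) :
    avgOp n ι k p lam ε = contAvg (samplingLaw n ι p) (kernelEps n ι k ε)
      (fun z => (∫ z', kernelEps n ι k ε z z' ∂(samplingLaw n ι p)) ^ (-lam)) := by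
  funext u x
  set d : M → ℝ := fun z => ∫ z', kernelEps n ι k ε z z' ∂(samplingLaw n ι p)
  have hdE : ∀ z, degreeEps n ι k p ε z = d z := fun z => degreeEps_eq hp hp0 k ε z
  have h1 : ∀ y, kernelLam n ι k p lam ε x y
      = d x ^ (-lam) * (kernelEps n ι k ε x y * d y ^ (-lam)) := fun y => by
    rw [kernelLam, hdE, hdE, Real.mul_rpow (hd x).le (hd y).le, Real.rpow_neg (hd x).le,
      Real.rpow_neg (hd y).le, div_eq_mul_inv, mul_inv]
    ring
  have e1 : degreeLam n ι k p lam ε x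
      = d x ^ (-lam) * ∫ y, kernelEps n ι k ε x y * d y ^ (-lam) ∂(samplingLaw n ι p) := by
    rw [← integral_const_mul, integral_samplingLaw hp hp0, degreeLam]
    simp only [h1, smul_eq_mul]
    exact integral_congr_ae (ae_of_all _ fun y => mul_comm _ _)
  have e2 : ∫ y, ((kernelLam n ι k p lam ε x y * p y : ℝ) : ℂ) * u y ∂(embeddedVolume n ι)
      = ((d x ^ (-lam) : ℝ) : ℂ) *
        ∫ y, ((kernelEps n ι k ε x y * d y ^ (-lam) : ℝ) : ℂ) * u y ∂(samplingLaw n ι p) := by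
    rw [← integral_const_mul, integral_samplingLaw hp hp0]
    refine integral_congr_ae (ae_of_all _ fun y => ?_)
    simp only [h1, Complex.real_smul]
    push_cast
    ring
  rw [avgOp, e1, e2, ← mul_assoc, ← Complex.ofReal_mul, mul_inv, mul_right_comm,
    inv_mul_cancel₀ (Real.rpow_pos_of_pos (hd x) _).ne', one_mul]
  rfl

end Identification

/-! ### From Gaussian tails to the Bernstein-type bounds -/

section Bernstein

/-- A Gaussian tail that is known only for large exponents implies the corresponding bound with a
smaller exponent everywhere, as the latter is trivial for small exponents. -/
theorem le_mul_exp_of_large {P : ℝ≥0∞} (hP1 : P ≤ 1) {A A' E E' : ℝ} (hA : 0 ≤ A) (hA' : 3 ≤ A')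
    (hAA : 4 * A * Real.exp (-4) ≤ A') (hE : E' ≤ E / 5)
    (hP : 5 ≤ E → P ≤ ENNReal.ofReal (4 * A * Real.exp (-E))) :
    P ≤ ENNReal.ofReal (A' * Real.exp (-E')) := by
  rcases le_or_gt 5 E with h5 | h5
  · refine (hP h5).trans (ENNReal.ofReal_le_ofReal ?_)
    calc 4 * A * Real.exp (-E) ≤ 4 * A * Real.exp (-4 + -E') := by gcongr; linarith
      _ = 4 * A * Real.exp (-4) * Real.exp (-E') := by rw [Real.exp_add]; ring
      _ ≤ _ := by gcongr
  · refine hP1.trans ?_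
    rw [← ENNReal.ofReal_one]
    refine ENNReal.ofReal_le_ofReal ?_
    -- The right-hand side is at least `3 * exp (-1) > 1`.
    have h1 : Real.exp (-1) ≤ Real.exp (-E') := Real.exp_le_exp.2 (by linarith)
    have h2 : 1 / 3 < Real.exp (-1) := by linarith [Real.exp_neg_one_gt_d9]
    nlinarith

variable {n : ℕ} {K Kl kinf cp lam ε : ℝ} {N : ℕ} {U δ : ℝ}

theorem le_ofReal_gammaBound {P : ℝ≥0∞} (hP1 : P ≤ 1)
    (hL : P ≤ ENNReal.ofReal (bernsteinLam n K Kl kinf cp lam ε N U δ))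
    (hZ : lam = 0 → P ≤ ENNReal.ofReal (bernsteinZero n K kinf ε N U δ)) :
    P ≤ ENNReal.ofReal (gammaBound n K Kl kinf cp lam ε N U δ) := by
  have h1 : P ≤ ENNReal.ofReal 1 := by simpa using hP1
  rw [gammaBound, ENNReal.ofReal_min, ENNReal.ofReal_min]
  refine le_min h1 (le_min ?_ ?_)
  · split_ifs
    exacts [hL, h1]
  · split_ifs with h
    exacts [hZ h, h1]

theorem ofReal_le_gammaTilde (γ : ℝ) : ENNReal.ofReal γ ≤ gammaTilde γ := by
  conv_lhs => rw [← div_one (ENNReal.ofReal γ)]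
  exact ENNReal.div_le_div_left (pow_le_one' tsub_le_self 2) _

/-- The exponent in `bernsteinLam`, compared with that of `measure_weighted_gt_le`: the quotient `5`
is the one of `le_mul_exp_of_large`, and `4` comes from the threshold in
`measure_entireCalc_sub_gt_le`. -/
theorem bernsteinLam_exponent_le (hK : 1 ≤ K) (hε : 0 < ε) (hkinf : 0 < kinf) {c C Γ : ℝ}
    (hC : 0 < C) (hΓ : 0 < Γ) (hU : 0 < U) (hδ : 0 < δ)
    (hG : 1 + 160 * kinf * C * Γ ^ 2 ≤ Kl * c ^ (-lam)) :
    (N * ε ^ ((n : ℝ) / 2) * δ ^ 2) /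
      (2 * Kl * c ^ (-lam) * U * (K * Kl * U * c ^ (-lam) + kinf * δ / 3))
      ≤ N / (16 * (kinf * ε ^ (-((n : ℝ) / 2))) * C * Γ ^ 2 * U ^ 2) * δ ^ 2 / 4 / 5 := by
  set G := Kl * c ^ (-lam) with hGdef
  set e := ε ^ ((n : ℝ) / 2) with he
  have he0 : 0 < e := Real.rpow_pos_of_pos hε _
  have hs : 0 < kinf * C * Γ ^ 2 := by positivity
  have hG1 : 1 ≤ G := by nlinarith
  have h1 : N / (16 * (kinf * ε ^ (-((n : ℝ) / 2))) * C * Γ ^ 2 * U ^ 2) * δ ^ 2 / 4 / 5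
      = N * e * δ ^ 2 / (320 * (kinf * C * Γ ^ 2) * U ^ 2) := by
    rw [Real.rpow_neg hε.le, ← he]
    field_simp
    ring
  have hG2 : 320 * (kinf * C * Γ ^ 2) ≤ 2 * (G * G) := by nlinarith [mul_self_nonneg (G - 1)]
  have hK2 : G * G ≤ K * (G * G) := le_mul_of_one_le_left (by positivity) hK
  rw [h1]
  refine div_le_div_of_nonneg_left (by positivity) (by positivity) ?_
  calc 320 * (kinf * C * Γ ^ 2) * U ^ 2 ≤ 2 * (G * G) * U ^ 2 := by
        gcongr
    _ ≤ 2 * (K * (G * G)) * U ^ 2 := by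
        gcongr
    _ ≤ 2 * (K * (G * G)) * U ^ 2 + 2 * G * U * (kinf * δ / 3) := by
        have : 0 ≤ 2 * G * U * (kinf * δ / 3) := by positivity
        linarith
    _ = _ := by rw [hGdef]; ring

/-- The exponent in `bernsteinZero`, compared with that of `measure_unweighted_gt_le`. -/
theorem bernsteinZero_exponent_le (hε : 0 < ε) (hkinf : 0 < kinf) {c : ℝ} (hc : 0 < c)
    (hK : 2560 * kinf / c ≤ K) (hU : 0 < U) (hδ : 0 < δ) :
    (N * ε ^ ((n : ℝ) / 2) * δ ^ 2) / (8 * U * (K * U + kinf * δ / 6))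
      ≤ N * c / (1024 * (kinf * ε ^ (-((n : ℝ) / 2))) * U ^ 2) * δ ^ 2 / 4 / 5 := by
  set e := ε ^ ((n : ℝ) / 2) with he
  have he0 : 0 < e := Real.rpow_pos_of_pos hε _
  have h1 : N * c / (1024 * (kinf * ε ^ (-((n : ℝ) / 2))) * U ^ 2) * δ ^ 2 / 4 / 5
      = N * e * δ ^ 2 / (8 * (2560 * kinf / c) * U ^ 2) := by
    rw [Real.rpow_neg hε.le, ← he]
    field_simp
    ring
  rw [h1]
  refine div_le_div_of_nonneg_left (by positivity) (by positivity) ?_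
  calc 8 * (2560 * kinf / c) * U ^ 2 ≤ 8 * K * U ^ 2 + 8 * U * (kinf * δ / 6) := by
        have h2 : 8 * (2560 * kinf / c) * U ^ 2 ≤ 8 * K * U ^ 2 := by gcongr
        have : 0 ≤ 8 * U * (kinf * δ / 6) := by positivity
        linarith
    _ = _ := by ring

end Bernstein

section Tail

variable {M : Type*} {N : ℕ} [MeasurableSpace M] {μ : Measure M} [IsProbabilityMeasure μ]
  {k : M → M → ℝ} {B c : ℝ}

theorem measurable_contAvg_iterate (hk : Measurable (uncurry k)) {q : M → ℝ} (hq : Measurable q)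
    {u : M → ℂ} (hu : Measurable u) (j : ℕ) : Measurable ((contAvg μ k q)^[j] u) := by
  induction j with
  | zero => exact hu
  | succ j ih => rw [iterate_succ_apply']; exact measurable_contAvg hk hq ih

omit [IsProbabilityMeasure μ] in
theorem norm_contAvg_iterate_le (hk : ∀ y z, 0 ≤ k y z) {q : M → ℝ} (hq : ∀ z, 0 ≤ q z)
    {u : M → ℂ} {U : ℝ} (hu : ∀ z, ‖u z‖ ≤ U) (j : ℕ) (y : M) : ‖(contAvg μ k q)^[j] u y‖ ≤ U := by
  induction j generalizing y with
  | zero => exact hu y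
  | succ j ih => rw [iterate_succ_apply']; exact norm_contAvg_le_const hk hq ih y

theorem contAvg_sum_iterate (hk : IsBoundedKernel μ k B c) {q : M → ℝ} (hqm : Measurable q)
    (hq : ∀ z, 0 ≤ q z) {Q : ℝ} (hqQ : ∀ z, q z ≤ Q) {u : M → ℂ} (hum : Measurable u) {U : ℝ}
    (hu : ∀ z, ‖u z‖ ≤ U) (s : Finset (ℕ × ℕ)) (a : ℕ × ℕ → ℂ) (y : M) :
    contAvg μ k q (fun z => ∑ p ∈ s, a p * (contAvg μ k q)^[p.1] u z) y
      = ∑ p ∈ s, a p * (contAvg μ k q)^[p.1 + 1] u y := by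
  simp only [iterate_succ_apply']
  refine contAvg_sum s a fun p _ => Integrable.of_bound (C := B * Q * U) ?_ (ae_of_all _ fun z => ?_)
  · exact ((Complex.measurable_ofReal.comp ((hk.measurable_right y).mul hqm)).mul
      (measurable_contAvg_iterate hk.measurable hqm hum p.1)).aestronglyMeasurable
  · rw [norm_mul, Complex.norm_real, Real.norm_of_nonneg (mul_nonneg (hk.nonneg y z) (hq z))]
    have h1 := hk.nonneg y z
    have h2 := hq z
    have h3 := h1.trans (hk.le y z)
    gcongr
    · exact mul_nonneg h3 (h2.trans (hqQ z))
    · exact hk.le y z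
    · exact hqQ z
    · exact norm_contAvg_iterate_le hk.nonneg hq hu p.1 z

variable {P : Measure (Fin N → M)} [IsProbabilityMeasure P]

/-- Concentration of `discAvg` and of its functional calculus, for any operator `T` whose one-step errors have
Gaussian tails along the random walk. -/
theorem measure_sub_gt_le_of_tail (hk : ∀ y z, 0 ≤ k y z)
    {q : (Fin N → M) → M → ℝ} (hq : ∀ X z, 0 ≤ q X z) {T : (M → ℂ) → M → ℂ} {u : M → ℂ}
    (hT : ∀ (s : Finset (ℕ × ℕ)) (a : ℕ × ℕ → ℂ) (y : M),
      T (fun z => ∑ p ∈ s, a p * T^[p.1] u z) y = ∑ p ∈ s, a p * T^[p.1 + 1] u y)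
    {U : ℝ} (hU : ∀ j y, ‖T^[j] u y‖ ≤ U) {x : M} {A b A' : ℝ} (hA : 0 ≤ A) (hA' : 3 ≤ A')
    (hAA : 4 * A * Real.exp (-4) ≤ A')
    (H : ∀ (i j : ℕ) (t : ℝ), 0 < t → P {X | t < (discAvgReal k (q X) X)^[i]
      (fun z => ‖discAvg k (q X) X (T^[j] u) z - T (T^[j] u) z‖) x}
      ≤ ENNReal.ofReal (A * Real.exp (2 * i ^ 2 + 2 * i) * Real.exp (-(b * t ^ 2))))
    {E' : ℝ → ℝ} (hE' : ∀ δ, 0 < δ → E' δ ≤ b * δ ^ 2 / 4 / 5) :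
    (∀ δ : ℝ, 0 < δ → P {X | δ < ‖discAvg k (q X) X u x - T u x‖}
      ≤ ENNReal.ofReal (A' * Real.exp (-E' δ))) ∧
    (∀ (f : ℂ → ℂ) (_ : Differentiable ℂ f) (w : ℂ) (Kw : ℝ) (_ : 0 < Kw)
      (_ : ∀ m : ℕ, ‖iteratedDeriv m f w‖ < Kw) (δ : ℝ) (_ : 0 < δ),
      P {X | δ < ‖entireCalc f (addScalarOp (discAvg k (q X) X) w) u x
            - entireCalc f (addScalarOp T w) u x‖}
      ≤ ENNReal.ofReal (A' * Real.exp (-E' (δ / (2 * Real.exp 1 * Kw))))) := by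
  refine ⟨fun δ hδ => ?_, fun f hf w Kw hKw0 hKw δ hδ => ?_⟩
  · refine le_mul_exp_of_large prob_le_one hA hA' hAA (hE' δ hδ) fun h5 => ?_
    refine (H 0 0 δ hδ).trans (ENNReal.ofReal_le_ofReal ?_)
    have h1 : Real.exp (-(b * δ ^ 2)) ≤ Real.exp (-(b * δ ^ 2 / 4)) :=
      Real.exp_le_exp.2 (by linarith)
    have h2 := mul_le_mul_of_nonneg_left h1 hA
    have h3 : 0 ≤ A * Real.exp (-(b * δ ^ 2 / 4)) := by positivity
    simp only [Nat.cast_zero, ne_eq, OfNat.ofNat_ne_zero, not_false_eq_true, zero_pow, mul_zero,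
      add_zero, Real.exp_zero, mul_one]
    linarith
  · refine le_mul_exp_of_large prob_le_one hA hA' hAA (hE' _ (by positivity)) fun h5 => ?_
    exact measure_entireCalc_sub_gt_le hk hq hT hU hA H hf hKw0 (fun m => (hKw m).le) hδ h5
      (by field_simp; ring)

end Tail

section Bernstein

variable {M : Type*} {N : ℕ} [MeasurableSpace M] {μ : Measure M} [IsProbabilityMeasure μ]
  {k : M → M → ℝ} {c C kinf : ℝ} {n : ℕ} {ε K : ℝ}

/-- The bound for general `λ`; the condition on `Kl` is what the choice of `K_λ` ensures. -/
theorem weighted_sub_gt_le_bernsteinLam (hε : 0 < ε) (hkinf : 0 < kinf)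
    (hk : IsBoundedKernel μ k (kinf * ε ^ (-((n : ℝ) / 2))) c) (hN : 0 < N)
    (hC : ∀ y, ∫ z, k y z ∂μ ≤ C) (hK : 1 ≤ K) {lam Kl : ℝ} (hl : 0 ≤ lam)
    (hKl : 1 + 160 * kinf * C * errorConst c C lam ^ 2 ≤ Kl * c ^ (-lam)) {u : M → ℂ}
    (hu : Measurable u) {U : ℝ} (hU : 0 < U) (huU : ∀ z, ‖u z‖ ≤ U) (x : M) :
    (∀ δ : ℝ, 0 < δ → Measure.pi (fun _ : Fin N => μ) {X | δ <
      ‖discAvg k (fun z => ((N : ℝ)⁻¹ * ∑ j, k z (X j)) ^ (-lam)) X u x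
        - contAvg μ k (fun z => (∫ z', k z z' ∂μ) ^ (-lam)) u x‖}
      ≤ ENNReal.ofReal (bernsteinLam n K Kl kinf c lam ε N U δ)) ∧
    (∀ (f : ℂ → ℂ) (_ : Differentiable ℂ f) (w : ℂ) (Kw : ℝ) (_ : 0 < Kw)
      (_ : ∀ m : ℕ, ‖iteratedDeriv m f w‖ < Kw) (δ : ℝ) (_ : 0 < δ),
      Measure.pi (fun _ : Fin N => μ) {X | δ < ‖entireCalc f (addScalarOp
          (discAvg k (fun z => ((N : ℝ)⁻¹ * ∑ j, k z (X j)) ^ (-lam)) X) w) u x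
        - entireCalc f (addScalarOp
          (contAvg μ k (fun z => (∫ z', k z z' ∂μ) ^ (-lam))) w) u x‖}
      ≤ ENNReal.ofReal (bernsteinLam n K Kl kinf c lam ε N U (δ / (2 * Real.exp 1 * Kw)))) := by
  have hc := hk.pos
  have hcC : c ≤ C := (hk.degree_ge x).trans (hC x)
  have hC0 := hc.trans_le hcC
  have hd0 : ∀ y, 0 < ∫ z, k y z ∂μ := fun y => hc.trans_le (hk.degree_ge y)
  have hΓ : 0 < errorConst c C lam :=
    lt_of_lt_of_le (by positivity) (four_div_le_errorConst hc hcC hl)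
  have hq : ∀ z, 0 ≤ (∫ z', k z z' ∂μ) ^ (-lam) := fun z => Real.rpow_nonneg (hd0 z).le _
  have hqm : Measurable fun z => (∫ z', k z z' ∂μ) ^ (-lam) := hk.measurable_degree.pow_const _
  have hqc : ∀ z, (∫ z', k z z' ∂μ) ^ (-lam) ≤ c ^ (-lam) := fun z =>
    Real.rpow_le_rpow_of_nonpos hc (hk.degree_ge z) (by linarith)
  have hN' : (0 : ℝ) ≤ N := Nat.cast_nonneg N
  refine measure_sub_gt_le_of_tail (A := 8 * Real.exp 1 * (N + 1))
    (b := N / (16 * (kinf * ε ^ (-((n : ℝ) / 2))) * C * errorConst c C lam ^ 2 * U ^ 2))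
    (A' := 4 + 2 * N) hk.nonneg
    (fun X z => Real.rpow_nonneg (mul_nonneg (by positivity)
      (Finset.sum_nonneg fun j _ => hk.nonneg _ _)) _)
    (contAvg_sum_iterate hk hqm hq hqc hu huU) (norm_contAvg_iterate_le hk.nonneg hq huU)
    (by positivity) (by linarith) ?_ (fun i j t ht => ?_)
    (fun δ hδ => bernsteinLam_exponent_le hK hε hkinf hC0 hΓ hU hδ hKl)
  · have h1 : Real.exp 1 * Real.exp (-4) = Real.exp (-1) ^ 3 := by
      rw [← Real.exp_add, ← Real.exp_nat_mul]; norm_num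
    have h2 : Real.exp (-1) ^ 3 ≤ 0.37 ^ 3 := by
      gcongr
      linarith [Real.exp_neg_one_lt_d9]
    calc 4 * (8 * Real.exp 1 * (N + 1)) * Real.exp (-4)
        = 32 * (N + 1) * (Real.exp 1 * Real.exp (-4)) := by ring
      _ ≤ 32 * (N + 1) * 0.37 ^ 3 := by rw [h1]; gcongr
      _ ≤ _ := by norm_num; nlinarith
  · exact measure_weighted_gt_le hk hN hC hl (measurable_contAvg_iterate hk.measurable hqm hu j) hU
      (norm_contAvg_iterate_le hk.nonneg hq huU j) x i ht

theorem unweighted_sub_gt_le_bernsteinZero (hε : 0 < ε) (hkinf : 0 < kinf)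
    (hk : IsBoundedKernel μ k (kinf * ε ^ (-((n : ℝ) / 2))) c) (hN : 0 < N)
    (hK : 2560 * kinf / c ≤ K) {u : M → ℂ}
    (hu : Measurable u) {U : ℝ} (hU : 0 < U) (huU : ∀ z, ‖u z‖ ≤ U) (x : M) :
    (∀ δ : ℝ, 0 < δ → Measure.pi (fun _ : Fin N => μ) {X | δ <
      ‖discAvg k (fun _ => 1) X u x - contAvg μ k (fun _ => 1) u x‖}
      ≤ ENNReal.ofReal (bernsteinZero n K kinf ε N U δ)) ∧
    (∀ (f : ℂ → ℂ) (_ : Differentiable ℂ f) (w : ℂ) (Kw : ℝ) (_ : 0 < Kw)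
      (_ : ∀ m : ℕ, ‖iteratedDeriv m f w‖ < Kw) (δ : ℝ) (_ : 0 < δ),
      Measure.pi (fun _ : Fin N => μ) {X | δ <
        ‖entireCalc f (addScalarOp (discAvg k (fun _ => 1) X) w) u x
        - entireCalc f (addScalarOp (contAvg μ k (fun _ => 1)) w) u x‖}
      ≤ ENNReal.ofReal (bernsteinZero n K kinf ε N U (δ / (2 * Real.exp 1 * Kw)))) := by
  have hq : ∀ _ : M, (0 : ℝ) ≤ 1 := fun _ => zero_le_one
  refine measure_sub_gt_le_of_tail (A := 8)
    (b := N * c / (1024 * (kinf * ε ^ (-((n : ℝ) / 2))) * U ^ 2)) (A' := 6)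
    (q := fun _ _ => 1) hk.nonneg (fun _ => hq)
    (contAvg_sum_iterate hk measurable_const hq (fun _ => le_rfl) hu huU)
    (norm_contAvg_iterate_le hk.nonneg hq huU) (by norm_num) (by norm_num) ?_ (fun i j t ht => ?_)
    (fun δ hδ => bernsteinZero_exponent_le hε hkinf hk.pos hK hU hδ)
  · have h1 : Real.exp (-4) = Real.exp (-1) ^ 4 := by
      rw [← Real.exp_nat_mul]; norm_num
    have h2 : Real.exp (-1) ^ 4 ≤ 0.37 ^ 4 := by
      gcongr
      linarith [Real.exp_neg_one_lt_d9]
    rw [h1]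
    norm_num at h2 ⊢
    linarith
  · exact measure_unweighted_gt_le hk hN
      (measurable_contAvg_iterate hk.measurable measurable_const hu j) hU
      (norm_contAvg_iterate_le hk.nonneg hq huU j) x i ht

end Bernstein

theorem mainTheorem12 :
    ∃ Kfun : ℝ → ℝ → ℝ → ℝ → ℝ, (∀ a b c l, 1 < Kfun a b c l) ∧
    ∀ (n D : ℕ) (_ : n + 1 ≤ D)
      (M : Type*) [TopologicalSpace M] [T2Space M] [CompactSpace M]
      [ChartedSpace (EuclideanSpace ℝ (Fin n)) M] [IsManifold (𝓡 n) ∞ M]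
      [MeasurableSpace M] [BorelSpace M]
      (g : Bundle.ContMDiffRiemannianMetric (𝓡 n) ∞ (EuclideanSpace ℝ (Fin n))
        (fun x : M => TangentSpace (𝓡 n) x))
      (ι : M → EuclideanSpace ℝ (Fin D)) (_ : IsSmoothIsometricEmbedding g ι)
      (p : M → ℝ) (_ : ContMDiff (𝓡 n) 𝓘(ℝ, ℝ) ∞ p) (_ : ∀ x, 0 < p x)
      (_ : IsProbabilityMeasure (samplingLaw n ι p))
      (k : ℝ → ℝ) (_ : IsKernelFunction k)
      (ε₀ : ℝ) (_ : 0 < ε₀),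
    ∃ K : ℝ, 0 < K ∧
    ∀ (lam : ℝ) (_ : 0 ≤ lam) (ε : ℝ) (_ : 0 < ε) (_ : ε ≤ ε₀) (N : ℕ) (_ : 0 < N)
      (u : M → ℂ) (_ : ContMDiff (𝓡 n) 𝓘(ℝ, ℂ) ∞ u) (x : M)
      (Kl : ℝ) (_ : Kl = Kfun (kernelSup k) (⨅ y, degreeEps n ι k p ε y)
        (⨆ y, degreeEps n ι k p ε y) lam)
      (γ : ℝ → ℝ) (_ : γ = gammaBound n K Kl (kernelSup k) (⨅ y, degreeEps n ι k p ε y)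
        lam ε N (supNorm u)),
    (∀ δ : ℝ, 0 < δ →
      Measure.pi (fun _ : Fin N => samplingLaw n ι p)
        {X | δ < ‖avgOpN n ι k lam ε X u x - avgOp n ι k p lam ε u x‖}
      ≤ ENNReal.ofReal (γ δ)) ∧
    (∀ (f : ℂ → ℂ) (_ : Differentiable ℂ f) (w : ℂ) (Kw : ℝ) (_ : 0 < Kw)
      (_ : ∀ m : ℕ, ‖iteratedDeriv m f w‖ < Kw) (δ : ℝ) (_ : 0 < δ),
      Measure.pi (fun _ : Fin N => samplingLaw n ι p)
        {X | δ < ‖entireCalc f (addScalarOp (avgOpN n ι k lam ε X) w) u x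
            - entireCalc f (addScalarOp (avgOp n ι k p lam ε) w) u x‖}
      ≤ gammaTilde (γ (δ / (2 * Real.exp 1 * Kw)))) := by
  refine ⟨fun a b c l => max 2 (b ^ l * (1 + 160 * a * c * errorConst b c l ^ 2)),
    fun a b c l => lt_max_of_lt_left one_lt_two, ?_⟩
  intro n D _ M _ _ _ _ _ _ _ g ι hι p hp hp0 hprob k hk ε₀ hε₀
  obtain ⟨c₀, hc₀, hdeg⟩ := exists_degreeEps_ge hι hp.continuous hp0 hk hε₀
  have hkinf := hk.kernelSup_pos
  -- The first entry is needed for all `λ`, the second one only for `λ = 0`.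
  refine ⟨max 1 (2560 * kernelSup k / c₀), by positivity, ?_⟩
  intro lam hlam ε hε hεε₀ N hN u hu x Kl hKl γ hγ
  have hpm : Measurable p := hp.continuous.measurable
  have hpn : ∀ x, 0 ≤ p x := fun x => (hp0 x).le
  have hιm : Measurable ι := hι.smooth.continuous.measurable
  set μ := samplingLaw n ι p with hμ
  set κ := kernelEps n ι k ε with hκ
  have hne : Nonempty M := ⟨x⟩
  have hdE : ∀ y, degreeEps n ι k p ε y = ∫ z, κ y z ∂μ := fun y => degreeEps_eq hpm hpn k ε y
  have hkb : ∀ c, 0 < c → (∀ y, c ≤ degreeEps n ι k p ε y) →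
      IsBoundedKernel μ κ (kernelSup k * ε ^ (-((n : ℝ) / 2))) c := fun c hc h =>
    ⟨measurable_kernelEps hιm hk hε, kernelEps_nonneg hk hε, kernelEps_le hk hε, hc,
      fun y => (h y).trans_eq (hdE y)⟩
  have hk₀ := hkb c₀ hc₀ (hdeg ε hε hεε₀)
  set c := ⨅ y, degreeEps n ι k p ε y with hc
  set C := ⨆ y, degreeEps n ι k p ε y with hC
  have hk₁ : IsBoundedKernel μ κ (kernelSup k * ε ^ (-((n : ℝ) / 2))) c :=
    hkb c (hc₀.trans_le (le_ciInf (hdeg ε hε hεε₀)))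
      (ciInf_le ⟨c₀, forall_mem_range.2 (hdeg ε hε hεε₀)⟩)
  have hkC : ∀ y, ∫ z, κ y z ∂μ ≤ C := fun y => (hdE y).symm.trans_le (le_ciSup
    (f := fun y => degreeEps n ι k p ε y)
    ⟨kernelSup k * ε ^ (-((n : ℝ) / 2)), forall_mem_range.2 fun y =>
      (hdE y).trans_le (hk₀.degree_le y)⟩ y)
  have hd0 : ∀ y, 0 < ∫ z, κ y z ∂μ := fun y => hc₀.trans_le (hk₀.degree_ge y)
  have eN : ∀ X : Fin N → M, avgOpN n ι k lam ε X = discAvg κ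
      (fun z => ((N : ℝ)⁻¹ * ∑ j, κ z (X j)) ^ (-lam)) X := avgOpN_eq_discAvg hk hε hN
  have eC : avgOp n ι k p lam ε = contAvg μ κ (fun z => (∫ z', κ z z' ∂μ) ^ (-lam)) :=
    avgOp_eq_contAvg hpm hpn hd0
  simp only [eN, eC, hγ]
  have huU : ∀ z, ‖u z‖ ≤ supNorm u :=
    le_ciSup (isCompact_range hu.continuous.norm).bddAbove
  rcases ((norm_nonneg _).trans (huU x)).eq_or_lt with hU | hU
  · -- For `u = 0` the exponents are quotients by `0`, so that all the bounds are trivial.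
    have htriv : ∀ (P : ℝ≥0∞) (δ : ℝ), P ≤ 1 → P ≤ ENNReal.ofReal (gammaBound n
        (max 1 (2560 * kernelSup k / c₀)) Kl (kernelSup k) c lam ε N (supNorm u) δ) := by
      intro P δ hP
      refine le_ofReal_gammaBound hP (hP.trans ?_) fun _ => hP.trans ?_
      · rw [← ENNReal.ofReal_one]
        refine ENNReal.ofReal_le_ofReal ?_
        have hN' : (0 : ℝ) ≤ N := Nat.cast_nonneg N
        simp only [bernsteinLam, ← hU, mul_zero, zero_mul, div_zero, neg_zero, Real.exp_zero]
        linarith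
      · rw [← ENNReal.ofReal_one]
        refine ENNReal.ofReal_le_ofReal ?_
        simp only [bernsteinZero, ← hU, mul_zero, zero_mul, div_zero, neg_zero, Real.exp_zero]
        norm_num
    exact ⟨fun δ _ => htriv _ _ prob_le_one,
      fun f _ w Kw _ _ δ _ => (htriv _ _ prob_le_one).trans (ofReal_le_gammaTilde _)⟩
  have hKlc : 1 + 160 * kernelSup k * C * errorConst c C lam ^ 2 ≤ Kl * c ^ (-lam) := by
    have h1 : c ^ lam * (1 + 160 * kernelSup k * C * errorConst c C lam ^ 2) ≤ Kl :=
      (le_max_right _ _).trans_eq hKl.symm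
    have h2 : 0 < c ^ lam := Real.rpow_pos_of_pos hk₁.pos _
    rw [Real.rpow_neg hk₁.pos.le, ← div_eq_mul_inv, le_div_iff₀ h2, mul_comm]
    exact h1
  have hL := weighted_sub_gt_le_bernsteinLam hε hkinf hk₁ hN hkC
    (le_max_left 1 (2560 * kernelSup k / c₀)) hlam hKlc hu.continuous.measurable hU huU x
  have hZ := unweighted_sub_gt_le_bernsteinZero hε hkinf hk₀ hN
    (le_max_right 1 (2560 * kernelSup k / c₀)) hu.continuous.measurable hU huU x
  refine ⟨fun δ hδ => le_ofReal_gammaBound prob_le_one (hL.1 δ hδ) fun h0 => ?_,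
    fun f hf w Kw hKw0 hKw δ hδ => (le_ofReal_gammaBound prob_le_one
      (hL.2 f hf w Kw hKw0 hKw δ hδ) fun h0 => ?_).trans (ofReal_le_gammaTilde _)⟩
  · simpa only [h0, neg_zero, Real.rpow_zero] using hZ.1 δ hδ
  · simpa only [h0, neg_zero, Real.rpow_zero] using hZ.2 f hf w Kw hKw0 hKw δ hδ
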